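/- Let $k$ be a field of characteristic $3$. Vector superspaces are $\mathbb{Z}/2$-graded, $|x|$ denotes the parity of a homogeneous element $x$, ideals of superalgebras are graded, and the definition of a Lie superalgebra includes $[x,[x,x]]=0$ for odd $x$. **The algebras.** $S_2$ is the (purely even) symmetric composition algebra with basis $e^+,e^-$, product $e^\pm\bullet e^\pm=e^\mp$, $e^\pm\bullet e^\mp=0$ and norm $q(e^\pm)=0$, $b(e^+,e^-)=1$, where $b$ is the polar form of $q$. Let $V=k^2$ with a nonzero alternating form $\langle\cdot|\cdot\rangle$ and let $B(4,2)=\mathrm{End}_k(V)\oplus V$ (even part $\mathrm{End}_k(V)$, odd part $V$), with product given by composition on $\mathrm{End}_k(V)$, $v\cdot f=f(v)=\bar f\cdot v$ and $u\cdot v=\langle\,\cdot\,|u\rangle v$, where $\bar f$ is the symplectic involution $\langle f(u)|v\rangle=\langle u|\bar f(v)\rangle$; its norm is $q(f)=\det f$, with bilinear form $b(f,g)=\mathrm{tr}(f\bar g)$, $b(u,v)=\langle u|v\rangle$, $b(f,u)=0$. Put $\bar x=b(x,1)1-x$. Then $S_{4,2}$ is $B(4,2)$ with the product $x\bullet y=\bar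 x\cdot\bar y$ and the same norm; it is a symmetric composition superalgebra. **The construction.** For a symmetric composition superalgebra $(S,\bullet,q)$ let $\mathfrak{osp}(S,q)$ be the orthosymplectic Lie superalgebra of $b$ and $\mathfrak{tri}(S)\subseteq\mathfrak{osp}(S,q)^3$ the Lie superalgebra spanned by the homogeneous triples with $d_0(x\bullet y)=d_1(x)\bullet y+(-1)^{|d_1||x|}x\bullet d_2(y)$. Let $\theta(d_0,d_1,d_2)=(d_2,d_0,d_1)$ and $$t_{x,y}=\bigl(\sigma_{x,y},\tfrac12 b(x,y)1-r_xl_y,\tfrac12 b(x,y)1-l_xr_y\bigr)\in\mathfrak{tri}(S),$$ where $\sigma_{x,y}(z)=(-1)^{|y||z|}b(x,z)y-(-1)^{|x|(|y|+|z|)}b(y,z)x$, $l_x(y)=x\bullet y$, $r_x(y)=(-1)^{|x||y|}y\bullet x$. For two such superalgebras $S,S'$ let $$\mathfrak g(S,S')=\mathfrak{tri}(S)\oplus\mathfrak{tri}(S')\oplus\bigoplus_{i=0}^2\iota_i(S\otimes S'),$$ where $\mathfrak{tri}(S)\oplus\mathfrak{tri}(S')$ is a subalgebra (a direct sum of Lie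 superalgebras) and, with indices modulo $3$, the superanticommutative product is given by $$[(d_0,d_1,d_2),\iota_i(x\otimes x')]=\iota_i(d_i(x)\otimes x'),\qquad [(d'_0,d'_1,d'_2),\iota_i(x\otimes x')]=(-1)^{|d'_i||x|}\iota_i(x\otimes d'_i(x')),$$ $$[\iota_i(x\otimes x'),\iota_{i+1}(y\otimes y')]=(-1)^{|x'||y|}\iota_{i+2}\bigl((x\bullet y)\otimes(x'\bullet y')\bigr),$$ $$[\iota_i(x\otimes x'),\iota_i(y\otimes y')]=(-1)^{|x||x'|+|x||y'|+|y||y'|}b'(x',y')\theta^i(t_{x,y})+(-1)^{|y||x'|}b(x,y)\theta'^i(t'_{x',y'}).$$ **Contragredient Lie superalgebras.** Let $A$ be an $n\times n$ matrix over $k$ of rank $\ell$, $\tau\subseteq\{1,\dots,n\}$, and let $(\mathfrak h,\Pi,\Pi^\vee)$ be a realization of $A$: $\dim\mathfrak h=2n-\ell$, and $\Pi=\{\alpha_1,\dots,\alpha_n\}\subseteq\mathfrak h^*$, $\Pi^\vee=\{h_1,\dots,h_n\}\subseteq\mathfrak h$ are linearly independent with $\alpha_j(h_i)=A_{ij}$.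 Let $\tilde{\mathfrak g}(A,\tau)$ be the Lie superalgebra generated by $\mathfrak h$ (even) and $e_i,f_i$ (odd exactly for $i\in\tau$) subject to $[e_i,f_j]=\delta_{ij}h_i$, $[h,h']=0$, $[h,e_i]=\alpha_i(h)e_i$, $[h,f_i]=-\alpha_i(h)f_i$, $\mathbb Z$-graded by $\deg\mathfrak h=0$, $\deg e_i=1$, $\deg f_i=-1$. Then $\mathfrak g(A,\tau)$ is the quotient of $\tilde{\mathfrak g}(A,\tau)$ by its largest homogeneous ideal that intersects $\mathfrak h$ trivially; $\mathfrak c$ denotes its center. **Proposition.** Let $\mathfrak g=\mathfrak g(S_2,S_{4,2})$ and $$A_{S_2,S_{4,2}}=\begin{pmatrix}2&-1&0&0&0\\-1&2&-1&0&0\\0&-1&0&-1&1\\0&0&-1&2&0\\0&0&1&0&0\end{pmatrix}.$$ 1. $\mathfrak g$ is a Lie superalgebra, isomorphic to the centerless contragredient Lie superalgebra $\mathfrak g(A_{S_2,S_{4,2}},\{3,5\})/\mathfrak c$ (formed from any realization of $A_{S_2,S_{4,2}}$). 2. $\mathfrak g$ is not simple, but $[\mathfrak g,\mathfrak g]$ is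 an ideal of codimension $1$, and is a simple Lie superalgebra. 3. The even part $\mathfrak g_{\bar 0}$ is isomorphic to $\mathfrak{pgl}_6=\mathfrak{gl}_6/k1$. The odd part $\mathfrak g_{\bar 1}$ has dimension $20$ and is isomorphic to the third exterior power of the natural module $W=k^6$, twisted by the trace: there are a Lie algebra isomorphism $\varphi:\mathfrak{pgl}_6\to\mathfrak g_{\bar 0}$ and a linear isomorphism $\psi:\bigwedge^3W\to\mathfrak g_{\bar 1}$ such that for all $X\in\mathfrak{gl}_6$ and $w_1,w_2,w_3\in W$ $$[\varphi(X+k1),\psi(w_1\wedge w_2\wedge w_3)]=\psi\bigl(Xw_1\wedge w_2\wedge w_3+w_1\wedge Xw_2\wedge w_3+w_1\wedge w_2\wedge Xw_3+\mathrm{tr}(X)\,w_1\wedge w_2\wedge w_3\bigr).$$ In particular $\mathfrak g_{\bar 1}\cong\bigwedge^3W$ as a module for $\mathfrak{sl}_6$. -/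

import Mathlib

open scoped TensorProduct

noncomputable section

namespace SuperSquare

/-! ### Superspaces -/

/-- The sign `(-1)^i` for `i ∈ ℤ/2`. -/
def sgn (k : Type*) [Field k] (i : ZMod 2) : k := (-1) ^ i.val

lemma sgn_zero (k : Type*) [Field k] : sgn k 0 = 1 := by simp [sgn]

lemma sgn_one (k : Type*) [Field k] : sgn k 1 = -1 := by
  simp [sgn, show (1 : ZMod 2).val = 1 from rfl]

lemma parity_cases (i : ZMod 2) : i = 0 ∨ i = 1 := by decide +revert

lemma one_add_one_parity : (1 : ZMod 2) + 1 = 0 := rfl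

/-- A `ℤ/2`-grading of a vector space, given by its two projections. -/
structure SuperSpace (k S : Type*) [Field k] [AddCommGroup S] [Module k S] where
  proj : ZMod 2 → S →ₗ[k] S
  proj_proj : ∀ i j x, proj i (proj j x) = if i = j then proj j x else 0
  proj_add : ∀ x, proj 0 x + proj 1 x = x

namespace SuperSpace

variable {k S S' : Type*} [Field k] [AddCommGroup S] [Module k S] [AddCommGroup S'] [Module k S']

/-- The homogeneous component of parity `i`. -/
def gr (C : SuperSpace k S) (i : ZMod 2) : Submodule k S := LinearMap.range (C.proj i)

lemma proj_mem (C : SuperSpace k S) (i : ZMod 2) (x : S) : C.proj i x ∈ C.gr i := ⟨x, rfl⟩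

lemma proj_of_mem (C : SuperSpace k S) {i : ZMod 2} {x : S} (hx : x ∈ C.gr i) (j : ZMod 2) :
    C.proj j x = if j = i then x else 0 := by
  obtain ⟨y, rfl⟩ := hx
  rw [C.proj_proj]

lemma ind (C : SuperSpace k S) {P : S → Prop} (hadd : ∀ x y, P x → P y → P (x + y))
    (h : ∀ i, ∀ x ∈ C.gr i, P x) (x : S) : P x := by
  rw [← C.proj_add x]
  exact hadd _ _ (h 0 _ (C.proj_mem _ _)) (h 1 _ (C.proj_mem _ _))

/-- The component of parity `i` of an endomorphism of a superspace. -/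
def endProj (C : SuperSpace k S) (i : ZMod 2) : Module.End k S →ₗ[k] Module.End k S where
  toFun d := ∑ j, C.proj (i + j) ∘ₗ d ∘ₗ C.proj j
  map_add' d e := by ext x; simp [Finset.sum_add_distrib]
  map_smul' c d := by ext x; simp [Finset.smul_sum]

/-- The supercommutator `[f, g] = f g - (-1)^{|f||g|} g f` of endomorphisms of a superspace. -/
def superComm (C : SuperSpace k S) :
    Module.End k S →ₗ[k] Module.End k S →ₗ[k] Module.End k S :=
  LinearMap.mk₂ k
    (fun f g => ∑ i, ∑ j, (C.endProj i f * C.endProj j g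
      - sgn k (i * j) • (C.endProj j g * C.endProj i f)))
    (fun f f' g => by
      simp only [map_add, add_mul, mul_add, smul_add, ← Finset.sum_add_distrib]
      refine Finset.sum_congr rfl fun i _ => Finset.sum_congr rfl fun j _ => ?_
      abel)
    (fun c f g => by
      simp only [map_smul, smul_mul_assoc, mul_smul_comm, Finset.smul_sum, smul_sub,
        smul_comm c])
    (fun f g g' => by
      simp only [map_add, add_mul, mul_add, smul_add, ← Finset.sum_add_distrib]
      refine Finset.sum_congr rfl fun i _ => Finset.sum_congr rfl fun j _ => ?_
      abel)
    (fun c f g => by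
      simp only [map_smul, smul_mul_assoc, mul_smul_comm, Finset.smul_sum, smul_sub,
        smul_comm c])

/-- The projection of `S ⊗ S'` onto its component of parity `i`. -/
def tensorProj (C : SuperSpace k S) (C' : SuperSpace k S') (i : ZMod 2) :
    S ⊗[k] S' →ₗ[k] S ⊗[k] S' :=
  ∑ a, TensorProduct.map (C.proj a) (C'.proj (i - a))

/-- The bilinear map on `S ⊗ S'` that sends `(x ⊗ x', y ⊗ y')` to
`s |x| |x'| |y| |y'| • (B (x, y) ⊗ B' (x', y'))` for homogeneous `x, x', y, y'`. -/
def signedMap₂ {P P' : Type*} [AddCommGroup P] [Module k P] [AddCommGroup P'] [Module k P']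
    (C : SuperSpace k S) (C' : SuperSpace k S') (s : ZMod 2 → ZMod 2 → ZMod 2 → ZMod 2 → k)
    (B : S →ₗ[k] S →ₗ[k] P) (B' : S' →ₗ[k] S' →ₗ[k] P') :
    S ⊗[k] S' →ₗ[k] S ⊗[k] S' →ₗ[k] P ⊗[k] P' :=
  ∑ a, ∑ a', ∑ c, ∑ c', s a a' c c' •
    (TensorProduct.map₂ B B').compl₁₂ (TensorProduct.map (C.proj a) (C'.proj a'))
      (TensorProduct.map (C.proj c) (C'.proj c'))

end SuperSpace

/-! ### Symmetric composition superalgebras -/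

/-- A symmetric composition superalgebra over a field of characteristic `≠ 2` (where the
norm is regular if and only if its polar form is nondegenerate). -/
structure SymComp (k S : Type*) [Field k] [AddCommGroup S] [Module k S]
    extends SuperSpace k S where
  mul : S →ₗ[k] S →ₗ[k] S
  mul_mem : ∀ i j, ∀ x ∈ toSuperSpace.gr i, ∀ y ∈ toSuperSpace.gr j,
    mul x y ∈ toSuperSpace.gr (i + j)
  q : QuadraticForm k (toSuperSpace.gr 0)
  b : LinearMap.BilinForm k S
  b_even : ∀ i j, i ≠ j → ∀ x ∈ toSuperSpace.gr i, ∀ y ∈ toSuperSpace.gr j, b x y = 0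
  b_alt : ∀ x ∈ toSuperSpace.gr 1, b x x = 0
  b_polar : ∀ x y : toSuperSpace.gr 0, b x y = q (x + y) - q x - q y
  regular : ∀ x, (∀ y, b x y = 0) → x = 0
  norm_mul : ∀ x y : toSuperSpace.gr 0,
    q ⟨mul x y, by simpa using mul_mem 0 0 x x.2 y y.2⟩ = q x * q y
  norm_left : ∀ (x : toSuperSpace.gr 0) (y z : S), b (mul x y) (mul x z) = q x * b y z
  norm_right : ∀ (x : toSuperSpace.gr 0) (y z : S), b (mul y x) (mul z x) = q x * b y z
  norm_super : ∀ i j l m, ∀ x ∈ toSuperSpace.gr i, ∀ y ∈ toSuperSpace.gr j,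
    ∀ z ∈ toSuperSpace.gr l, ∀ t ∈ toSuperSpace.gr m,
    b (mul x y) (mul z t) + sgn k (i * j + i * l + j * l) * b (mul z y) (mul x t)
      = sgn k (j * l) * (b x z * b y t)
  assoc : ∀ x y z, b (mul x y) z = b x (mul y z)

namespace SymComp

variable {k S : Type*} [Field k] [AddCommGroup S] [Module k S]

/-- The component of parity `i` of the orthosymplectic Lie superalgebra `osp(S, q)`. -/
def osp (C : SymComp k S) (i : ZMod 2) : Submodule k (Module.End k S) where
  carrier := {d | (∀ j, ∀ x ∈ C.gr j, d x ∈ C.gr (i + j)) ∧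
    ∀ j, ∀ x ∈ C.gr j, ∀ y, C.b (d x) y + sgn k (i * j) * C.b x (d y) = 0}
  add_mem' := by
    rintro d e ⟨h1, h2⟩ ⟨h3, h4⟩
    refine ⟨fun j x hx => add_mem (h1 j x hx) (h3 j x hx), fun j x hx y => ?_⟩
    simp only [LinearMap.add_apply, map_add]
    linear_combination h2 j x hx y + h4 j x hx y
  zero_mem' := by simp
  smul_mem' := by
    rintro c d ⟨h1, h2⟩
    refine ⟨fun j x hx => Submodule.smul_mem _ c (h1 j x hx), fun j x hx y => ?_⟩
    simp only [LinearMap.smul_apply, map_smul, smul_eq_mul]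
    linear_combination c * h2 j x hx y

/-- The component of parity `i` of the triality Lie superalgebra of `S`. -/
def triHom (C : SymComp k S) (i : ZMod 2) : Submodule k (Fin 3 → Module.End k S) where
  carrier := {d | (∀ n, d n ∈ C.osp i) ∧ ∀ j, ∀ x ∈ C.gr j, ∀ y,
    d 0 (C.mul x y) = C.mul (d 1 x) y + sgn k (i * j) • C.mul x (d 2 y)}
  add_mem' := by
    rintro d e ⟨h1, h2⟩ ⟨h3, h4⟩
    refine ⟨fun n => add_mem (h1 n) (h3 n), fun j x hx y => ?_⟩
    simp only [Pi.add_apply, LinearMap.add_apply, map_add, h2 j x hx y, h4 j x hx y]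
    module
  zero_mem' := by simp
  smul_mem' := by
    rintro c d ⟨h1, h2⟩
    refine ⟨fun n => Submodule.smul_mem _ c (h1 n), fun j x hx y => ?_⟩
    simp only [Pi.smul_apply, LinearMap.smul_apply, map_smul, h2 j x hx y]
    module

/-- The triality Lie superalgebra of `S`. -/
def tri (C : SymComp k S) : Submodule k (Fin 3 → Module.End k S) := C.triHom 0 ⊔ C.triHom 1

/-- The automorphism `θ (d₀, d₁, d₂) = (d₂, d₀, d₁)`. -/
def theta (k S : Type*) [Field k] [AddCommGroup S] [Module k S] :
    Module.End k (Fin 3 → Module.End k S) :=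
  LinearMap.funLeft k (Module.End k S) (fun n => n - 1)

/-- The componentwise supercommutator on triples of endomorphisms. -/
def tripleComm (C : SymComp k S) :
    (Fin 3 → Module.End k S) →ₗ[k] (Fin 3 → Module.End k S) →ₗ[k] (Fin 3 → Module.End k S) :=
  LinearMap.mk₂ k (fun d e n => C.superComm (d n) (e n))
    (fun _ _ _ => by ext; simp) (fun _ _ _ => by ext; simp)
    (fun _ _ _ => by ext; simp) (fun _ _ _ => by ext; simp)

/-- `σ_{x,y} : z ↦ (-1)^{|y||z|} b(x,z) y - (-1)^{|x|(|y|+|z|)} b(y,z) x`. -/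
def sigma (C : SymComp k S) : S →ₗ[k] S →ₗ[k] Module.End k S :=
  LinearMap.mk₂ k
    (fun x y => ∑ i, ∑ j, ∑ l,
      (sgn k (j * l) • (C.b (C.proj i x) ∘ₗ C.proj l).smulRight (C.proj j y)
        - sgn k (i * (j + l)) • (C.b (C.proj j y) ∘ₗ C.proj l).smulRight (C.proj i x)))
    (fun x x' y => by
      ext z
      simp only [LinearMap.add_apply, LinearMap.sum_apply, ← Finset.sum_add_distrib]
      refine Finset.sum_congr rfl fun i _ => Finset.sum_congr rfl fun j _ =>
        Finset.sum_congr rfl fun l _ => ?_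
      simp
      module)
    (fun c x y => by
      ext z
      simp only [LinearMap.smul_apply, LinearMap.sum_apply, Finset.smul_sum]
      refine Finset.sum_congr rfl fun i _ => Finset.sum_congr rfl fun j _ =>
        Finset.sum_congr rfl fun l _ => ?_
      simp
      module)
    (fun x y y' => by
      ext z
      simp only [LinearMap.add_apply, LinearMap.sum_apply, ← Finset.sum_add_distrib]
      refine Finset.sum_congr rfl fun i _ => Finset.sum_congr rfl fun j _ =>
        Finset.sum_congr rfl fun l _ => ?_
      simp
      module)
    (fun c x y => by
      ext z
      simp only [LinearMap.smul_apply, LinearMap.sum_apply, Finset.smul_sum]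
      refine Finset.sum_congr rfl fun i _ => Finset.sum_congr rfl fun j _ =>
        Finset.sum_congr rfl fun l _ => ?_
      simp
      module)

/-- `r_x (y) = (-1)^{|x||y|} y • x`. The operator `l_x (y) = x • y` is `C.mul x`. -/
def rmul (C : SymComp k S) : S →ₗ[k] S →ₗ[k] S :=
  ∑ i, ∑ j, sgn k (i * j) • C.mul.flip.compl₁₂ (C.proj i) (C.proj j)

/-- `t_{x,y} = (σ_{x,y}, b(x,y)/2 - r_x l_y, b(x,y)/2 - l_x r_y)`. -/
def t (C : SymComp k S) : S →ₗ[k] S →ₗ[k] (Fin 3 → Module.End k S) :=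
  LinearMap.mk₂ k
    (fun x y => ![C.sigma x y,
      ((2 : k)⁻¹ * C.b x y) • 1 - C.rmul x ∘ₗ C.mul y,
      ((2 : k)⁻¹ * C.b x y) • 1 - C.mul x ∘ₗ C.rmul y])
    (fun x x' y => by
      ext n z; fin_cases n <;> simp <;> module)
    (fun c x y => by
      ext n z; fin_cases n <;> simp <;> module)
    (fun x y y' => by
      ext n z; fin_cases n <;> simp <;> module)
    (fun c x y => by
      ext n z; fin_cases n <;> simp <;> module)

/-! ### The triality Lie superalgebra is closed under the operations used below -/

lemma b_comm (C : SymComp k S) {i j : ZMod 2} {x y : S} (hx : x ∈ C.gr i) (hy : y ∈ C.gr j) :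
    C.b x y = sgn k (i * j) * C.b y x := by
  by_cases h : i = j
  · subst h
    rcases parity_cases i with rfl | rfl
    · have h1 := C.b_polar ⟨x, hx⟩ ⟨y, hy⟩
      have h2 := C.b_polar ⟨y, hy⟩ ⟨x, hx⟩
      rw [add_comm] at h2
      simp only [mul_zero, sgn_zero] at *
      linear_combination h1 - h2
    · have h1 := C.b_alt _ (add_mem hx hy)
      have h2 := C.b_alt _ hx
      have h3 := C.b_alt _ hy
      simp only [map_add, LinearMap.add_apply] at h1
      simp only [mul_one, sgn_one]
      linear_combination h1 - h2 - h3
  · rw [C.b_even i j h x hx y hy, C.b_even j i (Ne.symm h) y hy x hx, mul_zero]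

lemma eq_of_left (C : SymComp k S) {u v : S} (h : ∀ m, ∀ z ∈ C.gr m, C.b u z = C.b v z) :
    u = v := by
  rw [← sub_eq_zero]
  refine C.regular _ (C.ind (fun y z hy hz => by rw [map_add, hy, hz, add_zero]) ?_)
  intro m z hz
  simp [h m z hz]

lemma eq_of_right (C : SymComp k S) {a : ZMod 2} {u v : S} (hu : u ∈ C.gr a) (hv : v ∈ C.gr a)
    (h : ∀ m, ∀ z ∈ C.gr m, C.b z u = C.b z v) : u = v := by
  refine C.eq_of_left fun m z hz => ?_
  rw [C.b_comm hu hz, C.b_comm hv hz, h m z hz]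

lemma mul_mul_left (C : SymComp k S) {i j l : ZMod 2} {x y z : S} (hx : x ∈ C.gr i)
    (hy : y ∈ C.gr j) (hz : z ∈ C.gr l) :
    C.mul (C.mul x y) z + sgn k (i * j + i * l + j * l) • C.mul (C.mul z y) x
      = (sgn k (j * l) * C.b x z) • y := by
  refine C.eq_of_left fun m t ht => ?_
  have h := C.norm_super i j l m x hx y hy z hz t ht
  rw [← C.assoc, ← C.assoc] at h
  simp only [map_add, map_smul, LinearMap.add_apply, LinearMap.smul_apply, smul_eq_mul]
  linear_combination h

lemma mul_mul_right (C : SymComp k S) {i j l : ZMod 2} {x y z : S} (hx : x ∈ C.gr i)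
    (hy : y ∈ C.gr j) (hz : z ∈ C.gr l) :
    C.mul x (C.mul y z) + sgn k (i * j + i * l + j * l) • C.mul z (C.mul y x)
      = (sgn k (j * l) * C.b x z) • y := by
  by_cases hil : i = l
  · subst hil
    have e1 := C.mul_mem _ _ _ hx _ (C.mul_mem _ _ _ hy _ hz)
    have e2 := C.mul_mem _ _ _ hz _ (C.mul_mem _ _ _ hy _ hx)
    have e3 : i + (j + i) = j := by
      rcases parity_cases i with rfl | rfl <;> rcases parity_cases j with rfl | rfl <;> rfl
    rw [e3] at e1 e2
    refine C.eq_of_right (add_mem e1 (Submodule.smul_mem _ _ e2)) (Submodule.smul_mem _ _ hy) ?_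
    intro m t ht
    have h := C.norm_super m i j i t ht x hx y hy z hz
    rw [C.b_comm (C.mul_mem _ _ _ hy _ hx) (C.mul_mem _ _ _ ht _ hz), C.assoc, C.assoc] at h
    simp only [map_add, map_smul, smul_eq_mul]
    rcases parity_cases i with rfl | rfl <;> rcases parity_cases j with rfl | rfl <;>
      rcases parity_cases m with rfl | rfl <;>
      simp only [mul_zero, mul_one, add_zero, zero_add, one_add_one_parity, sgn_zero,
        sgn_one] at h ⊢ <;> linear_combination h
  · have h0 := C.b_even i l hil x hx z hz
    have e1 := C.mul_mem _ _ _ hx _ (C.mul_mem _ _ _ hy _ hz)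
    have e2 := C.mul_mem _ _ _ hz _ (C.mul_mem _ _ _ hy _ hx)
    have e3 : l + (j + i) = i + (j + l) := by ring
    rw [e3] at e2
    refine C.eq_of_right (add_mem e1 (Submodule.smul_mem _ _ e2))
      (by simp [h0]) ?_
    intro m t ht
    have h := C.norm_super m i j l t ht x hx y hy z hz
    rw [C.b_comm (C.mul_mem _ _ _ hy _ hx) (C.mul_mem _ _ _ ht _ hz), C.assoc, C.assoc, h0] at h
    simp only [map_add, map_smul, smul_eq_mul, h0]
    rcases parity_cases i with rfl | rfl <;> rcases parity_cases j with rfl | rfl <;>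
      rcases parity_cases m with rfl | rfl <;> rcases parity_cases l with rfl | rfl <;>
      simp only [mul_zero, mul_one, add_zero, zero_add, one_add_one_parity, sgn_zero,
        sgn_one] at h ⊢ <;> linear_combination h

lemma theta_triHom (C : SymComp k S) {i : ZMod 2} {d : Fin 3 → Module.End k S}
    (hd : d ∈ C.triHom i) : theta k S d ∈ C.triHom i := by
  obtain ⟨h1, h2⟩ := hd
  refine ⟨fun n => h1 _, fun j x hx => C.ind (fun y z hy hz => ?_) fun l y hy => ?_⟩
  · simp only [map_add, hy, hz]
    module
  change d 2 (C.mul x y) = C.mul (d 0 x) y + sgn k (i * j) • C.mul x (d 1 y)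
  refine C.eq_of_left fun m z hz => ?_
  have e1 := (h1 2).2 _ _ (C.mul_mem _ _ _ hx _ hy) z
  have e2 := congrArg (C.b x) (h2 _ y hy z)
  have e3 := (h1 0).2 _ _ hx (C.mul y z)
  simp only [map_add, map_smul, LinearMap.add_apply, LinearMap.smul_apply, smul_eq_mul,
    C.assoc] at e1 e2 e3 ⊢
  rcases parity_cases i with rfl | rfl <;> rcases parity_cases j with rfl | rfl <;>
    rcases parity_cases l with rfl | rfl <;>
    simp only [mul_zero, mul_one, add_zero, zero_add, one_add_one_parity, sgn_zero,
      sgn_one] at e1 e2 e3 ⊢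
  all_goals first
    | linear_combination e1 - e2 + e3
    | linear_combination e1 + e2 + e3
    | linear_combination e1 - e2 - e3
    | linear_combination e1 + e2 - e3

lemma endProj_of_mem (C : SuperSpace k S) {i : ZMod 2} {f : Module.End k S}
    (hf : ∀ j, ∀ x ∈ C.gr j, f x ∈ C.gr (i + j)) (a : ZMod 2) :
    C.endProj a f = if a = i then f else 0 := by
  ext x
  refine C.ind (P := fun x => C.endProj a f x = (if a = i then f else 0) x)
    (fun x y hx hy => by rw [map_add, map_add, hx, hy]) ?_ x
  intro j x hx
  have h1 : ∀ l, C.proj (a + l) (f (C.proj l x)) = if l = j then (if a = i then f x else 0) else 0 := by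
    intro l
    rw [C.proj_of_mem hx]
    by_cases hl : l = j
    · subst hl
      rw [if_pos rfl, if_pos rfl, C.proj_of_mem (hf l x hx)]
      simp
    · simp [hl]
  simp only [SuperSpace.endProj, LinearMap.coe_mk, AddHom.coe_mk, LinearMap.sum_apply,
    LinearMap.comp_apply, h1]
  rw [Finset.sum_ite_eq' Finset.univ j, if_pos (Finset.mem_univ j)]
  split_ifs <;> rfl

lemma superComm_of_mem (C : SuperSpace k S) {i j : ZMod 2} {f g : Module.End k S}
    (hf : ∀ l, ∀ x ∈ C.gr l, f x ∈ C.gr (i + l)) (hg : ∀ l, ∀ x ∈ C.gr l, g x ∈ C.gr (j + l)) :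
    C.superComm f g = f * g - sgn k (i * j) • (g * f) := by
  simp only [SuperSpace.superComm, LinearMap.mk₂_apply, endProj_of_mem C hf, endProj_of_mem C hg]
  rw [Finset.sum_eq_single i, Finset.sum_eq_single j]
  · simp
  · intro b _ hb; simp [hb]
  · simp
  · intro b _ hb; simp [hb]
  · simp

lemma superComm_osp (C : SymComp k S) {i j : ZMod 2} {f g : Module.End k S}
    (hf : f ∈ C.osp i) (hg : g ∈ C.osp j) : C.superComm f g ∈ C.osp (i + j) := by
  rw [superComm_of_mem C.toSuperSpace hf.1 hg.1]
  refine ⟨fun l x hx => ?_, fun l x hx y => ?_⟩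
  · have h1 := hf.1 _ _ (hg.1 l x hx)
    have h2 := hg.1 _ _ (hf.1 l x hx)
    rw [← add_assoc] at h1 h2
    rw [add_comm j i] at h2
    exact sub_mem h1 (Submodule.smul_mem _ _ h2)
  · have h1 := hf.2 _ _ (hg.1 l x hx) y
    have h2 := hg.2 _ _ (hf.1 l x hx) y
    have h3 := hf.2 _ _ hx (g y)
    have h4 := hg.2 _ _ hx (f y)
    simp only [LinearMap.sub_apply, LinearMap.smul_apply, Module.End.mul_apply, map_sub, map_smul,
      smul_eq_mul]
    rcases parity_cases i with rfl | rfl <;> rcases parity_cases j with rfl | rfl <;>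
      rcases parity_cases l with rfl | rfl <;>
      simp only [mul_zero, mul_one, add_zero, zero_add, one_add_one_parity, sgn_zero,
        sgn_one] at h1 h2 h3 h4 ⊢
    all_goals first
      | linear_combination h1 - h2 + h4 - h3
      | linear_combination h1 - h2 - h4 + h3
      | linear_combination h1 - h2 - h4 - h3
      | linear_combination h1 - h2 + h4 + h3
      | linear_combination h1 + h2 + h4 - h3
      | linear_combination h1 + h2 - h4 + h3
      | linear_combination h1 + h2 - h4 - h3
      | linear_combination h1 + h2 + h4 + h3

lemma tripleComm_triHom (C : SymComp k S) {i j : ZMod 2} {d e : Fin 3 → Module.End k S}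
    (hd : d ∈ C.triHom i) (he : e ∈ C.triHom j) : C.tripleComm d e ∈ C.triHom (i + j) := by
  refine ⟨fun n => C.superComm_osp (hd.1 n) (he.1 n), fun l x hx y => ?_⟩
  have hc : ∀ n, C.tripleComm d e n = d n * e n - sgn k (i * j) • (e n * d n) := fun n =>
    superComm_of_mem C.toSuperSpace (hd.1 n).1 (he.1 n).1
  have h1 := congrArg (d 0) (he.2 _ _ hx y)
  have h2 := congrArg (e 0) (hd.2 _ _ hx y)
  have h3 := hd.2 _ _ ((he.1 1).1 _ _ hx) y
  have h4 := hd.2 _ _ hx (e 2 y)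
  have h5 := he.2 _ _ ((hd.1 1).1 _ _ hx) y
  have h6 := he.2 _ _ hx (d 2 y)
  rw [map_add, map_smul, h3, h4] at h1
  rw [map_add, map_smul, h5, h6] at h2
  simp only [hc, LinearMap.sub_apply, LinearMap.smul_apply, Module.End.mul_apply, map_sub,
    map_smul, h1, h2]
  rcases parity_cases i with rfl | rfl <;> rcases parity_cases j with rfl | rfl <;>
    rcases parity_cases l with rfl | rfl <;>
    simp only [mul_zero, mul_one, add_zero, zero_add, one_add_one_parity, sgn_zero,
      sgn_one] <;> module

lemma sigma_of_mem (C : SymComp k S) {i j l : ZMod 2} {x y z : S} (hx : x ∈ C.gr i)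
    (hy : y ∈ C.gr j) (hz : z ∈ C.gr l) :
    C.sigma x y z = sgn k (j * l) • C.b x z • y - sgn k (i * (j + l)) • C.b y z • x := by
  simp only [sigma, LinearMap.mk₂_apply, LinearMap.sum_apply, LinearMap.sub_apply,
    LinearMap.smul_apply, LinearMap.smulRight_apply, LinearMap.comp_apply]
  rw [Finset.sum_eq_single i, Finset.sum_eq_single j, Finset.sum_eq_single l]
  · simp [C.proj_of_mem hx, C.proj_of_mem hy, C.proj_of_mem hz]
  · intro b _ hb; simp [C.proj_of_mem hz, hb]
  · simp
  · intro b _ hb; simp [C.proj_of_mem hy, hb]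
  · simp
  · intro b _ hb; simp [C.proj_of_mem hx, hb]
  · simp

lemma rmul_of_mem (C : SymComp k S) {i j : ZMod 2} {x y : S} (hx : x ∈ C.gr i)
    (hy : y ∈ C.gr j) : C.rmul x y = sgn k (i * j) • C.mul y x := by
  simp only [rmul, LinearMap.sum_apply, LinearMap.smul_apply, LinearMap.compl₁₂_apply,
    LinearMap.flip_apply]
  rw [Finset.sum_eq_single i, Finset.sum_eq_single j]
  · simp [C.proj_of_mem hx, C.proj_of_mem hy]
  · intro b _ hb; simp [C.proj_of_mem hy, hb]
  · simp
  · intro b _ hb; simp [C.proj_of_mem hx, hb]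
  · simp

lemma sigma_osp (C : SymComp k S) {i j : ZMod 2} {x y : S} (hx : x ∈ C.gr i)
    (hy : y ∈ C.gr j) : C.sigma x y ∈ C.osp (i + j) := by
  refine ⟨fun l z hz => ?_, fun l z hz => C.ind (fun u v hu hv => ?_) fun m u hu => ?_⟩
  · rw [C.sigma_of_mem hx hy hz]
    refine sub_mem (Submodule.smul_mem _ _ ?_) (Submodule.smul_mem _ _ ?_)
    · by_cases h : i = l
      · have : i + j + l = j := by
          rw [h, add_comm l j, add_assoc, CharTwo.add_self_eq_zero, add_zero]
        rw [this]
        exact Submodule.smul_mem _ _ hy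
      · simp [C.b_even i l h x hx z hz]
    · by_cases h : j = l
      · have : i + j + l = i := by
          rw [h, add_assoc, CharTwo.add_self_eq_zero, add_zero]
        rw [this]
        exact Submodule.smul_mem _ _ hx
      · simp [C.b_even j l h y hy z hz]
  · simp only [map_add]
    linear_combination hu + hv
  · rw [C.sigma_of_mem hx hy hz, C.sigma_of_mem hx hy hu]
    have h1 := C.b_comm hz hx
    have h2 := C.b_comm hz hy
    have e1 := C.b_even i l
    have e2 := C.b_even j l
    have e3 := C.b_even i m
    have e4 := C.b_even j m
    simp only [map_sub, map_smul, LinearMap.sub_apply, LinearMap.smul_apply, smul_eq_mul, h1, h2]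
    rcases parity_cases i with rfl | rfl <;> rcases parity_cases j with rfl | rfl <;>
      rcases parity_cases l with rfl | rfl <;> rcases parity_cases m with rfl | rfl <;>
      simp only [mul_zero, mul_one, add_zero, zero_add, one_add_one_parity, sgn_zero,
        sgn_one, ne_eq, zero_ne_one, one_ne_zero, not_false_eq_true, not_true_eq_false,
        forall_true_left, false_imp_iff] at e1 e2 e3 e4 ⊢ <;>
      simp_all <;> ring

lemma mul_osp_aux (C : SymComp k S) {i j l : ZMod 2} {x y u : S} (hx : x ∈ C.gr i)
    (hy : y ∈ C.gr j) (hu : u ∈ C.gr l) :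
    C.rmul x (C.mul y u) = sgn k (i * (j + l)) • C.mul (C.mul y u) x ∧
    C.mul x (C.rmul y u) = sgn k (j * l) • C.mul x (C.mul u y) := by
  rw [C.rmul_of_mem hx (C.mul_mem _ _ _ hy _ hu), C.rmul_of_mem hy hu, map_smul]
  exact ⟨rfl, rfl⟩

lemma half_add_half (h2 : (2 : k) ≠ 0) (a : k) : (2 : k)⁻¹ * a + (2 : k)⁻¹ * a = a := by
  field_simp; ring

lemma t_one_osp (h2 : (2 : k) ≠ 0) (C : SymComp k S) {i j : ZMod 2} {x y : S} (hx : x ∈ C.gr i)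
    (hy : y ∈ C.gr j) : C.t x y 1 ∈ C.osp (i + j) := by
  change ((2 : k)⁻¹ * C.b x y) • (1 : Module.End k S) - C.rmul x ∘ₗ C.mul y ∈ _
  refine ⟨fun l z hz => ?_, fun l z hz => C.ind (fun u v hu hv => ?_) fun m u hu => ?_⟩
  · refine sub_mem ?_ ?_
    · by_cases h : i = j
      · rw [h, CharTwo.add_self_eq_zero, zero_add]
        exact Submodule.smul_mem _ _ hz
      · simp [C.b_even i j h x hx y hy]
    · rw [LinearMap.comp_apply, (C.mul_osp_aux hx hy hz).1]
      have := C.mul_mem _ _ _ (C.mul_mem _ _ _ hy _ hz) _ hx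
      rw [show j + l + i = i + j + l by ring] at this
      exact Submodule.smul_mem _ _ this
  · simp only [map_add]
    linear_combination hu + hv
  · have h := half_add_half h2 (C.b x y)
    have n := C.norm_super j l i m y hy z hz x hx u hu
    have c1 := C.b_comm hz (C.mul_mem _ _ _ (C.mul_mem _ _ _ hy _ hu) _ hx)
    have c2 := C.b_comm (C.mul_mem _ _ _ hx _ hz) (C.mul_mem _ _ _ hy _ hu)
    have c3 := C.b_comm hy hx
    have c4 : i ≠ j → C.b x y = 0 := fun h => C.b_even i j h x hx y hy
    simp only [LinearMap.sub_apply, LinearMap.smul_apply, LinearMap.comp_apply,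
      (C.mul_osp_aux hx hy hz).1, (C.mul_osp_aux hx hy hu).1, Module.End.one_apply, map_sub,
      map_smul, smul_eq_mul] at c1 c2 c3 ⊢
    rw [C.assoc _ x z] at c1
    rw [C.assoc _ x u, c1]
    rw [c2, c3] at n
    rcases parity_cases i with rfl | rfl <;> rcases parity_cases j with rfl | rfl <;>
      rcases parity_cases l with rfl | rfl <;> rcases parity_cases m with rfl | rfl <;>
      simp only [mul_zero, mul_one, add_zero, zero_add, one_add_one_parity, sgn_zero,
        sgn_one, ne_eq, zero_ne_one, one_ne_zero, not_false_eq_true, not_true_eq_false,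
        forall_true_left, false_imp_iff] at n c4 ⊢
    all_goals try rw [c4] at n ⊢
    all_goals first
      | linear_combination n
      | linear_combination -n
      | linear_combination C.b z u * h - n
      | linear_combination C.b z u * h + n

lemma t_two_osp (h2 : (2 : k) ≠ 0) (C : SymComp k S) {i j : ZMod 2} {x y : S} (hx : x ∈ C.gr i)
    (hy : y ∈ C.gr j) : C.t x y 2 ∈ C.osp (i + j) := by
  change ((2 : k)⁻¹ * C.b x y) • (1 : Module.End k S) - C.mul x ∘ₗ C.rmul y ∈ _
  refine ⟨fun l z hz => ?_, fun l z hz => C.ind (fun u v hu hv => ?_) fun m u hu => ?_⟩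
  · refine sub_mem ?_ ?_
    · by_cases h : i = j
      · rw [h, CharTwo.add_self_eq_zero, zero_add]
        exact Submodule.smul_mem _ _ hz
      · simp [C.b_even i j h x hx y hy]
    · rw [LinearMap.comp_apply, (C.mul_osp_aux hx hy hz).2]
      have := C.mul_mem _ _ _ hx _ (C.mul_mem _ _ _ hz _ hy)
      rw [show i + (l + j) = i + j + l by ring] at this
      exact Submodule.smul_mem _ _ this
  · simp only [map_add]
    linear_combination hu + hv
  · have h := half_add_half h2 (C.b x y)
    have n := C.norm_super l i m j z hz x hx u hu y hy
    have c1 := C.b_comm (C.mul_mem _ _ _ hx _ (C.mul_mem _ _ _ hz _ hy)) hu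
    have c4 : i ≠ j → C.b x y = 0 := fun h => C.b_even i j h x hx y hy
    rw [← C.assoc u] at c1
    simp only [LinearMap.sub_apply, LinearMap.smul_apply, LinearMap.comp_apply,
      (C.mul_osp_aux hx hy hz).2, (C.mul_osp_aux hx hy hu).2, Module.End.one_apply, map_sub,
      map_smul, smul_eq_mul, c1]
    rw [← C.assoc z]
    rcases parity_cases i with rfl | rfl <;> rcases parity_cases j with rfl | rfl <;>
      rcases parity_cases l with rfl | rfl <;> rcases parity_cases m with rfl | rfl <;>
      simp only [mul_zero, mul_one, add_zero, zero_add, one_add_one_parity, sgn_zero,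
        sgn_one, ne_eq, zero_ne_one, one_ne_zero, not_false_eq_true, not_true_eq_false,
        forall_true_left, false_imp_iff] at n c4 ⊢
    all_goals try rw [c4] at n ⊢
    all_goals first
      | linear_combination n
      | linear_combination -n
      | linear_combination C.b z u * h - n
      | linear_combination C.b z u * h + n

lemma t_triHom (h2 : (2 : k) ≠ 0) (C : SymComp k S) {i j : ZMod 2} {x y : S} (hx : x ∈ C.gr i)
    (hy : y ∈ C.gr j) : C.t x y ∈ C.triHom (i + j) := by
  refine ⟨fun n => ?_, fun l u hu => C.ind (fun v w hv hw => ?_) fun m v hv => ?_⟩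
  · fin_cases n
    · exact C.sigma_osp hx hy
    · exact C.t_one_osp h2 hx hy
    · exact C.t_two_osp h2 hx hy
  · simp only [map_add, hv, hw]
    module
  · change C.sigma x y (C.mul u v)
      = C.mul ((((2 : k)⁻¹ * C.b x y) • (1 : Module.End k S) - C.rmul x ∘ₗ C.mul y) u) v
        + sgn k ((i + j) * l) •
          C.mul u ((((2 : k)⁻¹ * C.b x y) • (1 : Module.End k S) - C.mul x ∘ₗ C.rmul y) v)
    have h := congrArg (fun a => a • C.mul u v) (half_add_half h2 (C.b x y))
    have hyu := C.mul_mem _ _ _ hy _ hu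
    have hvx := C.mul_mem _ _ _ hv _ hx
    have F1 := congrArg (fun w => sgn k (i * (j + l)) • w) (C.mul_mul_left hyu hx hv)
    have F2 := congrArg (fun w => (sgn k (i * (j + l)) *
      sgn k ((j + l) * i + (j + l) * m + i * m)) • w) (C.mul_mul_right hvx hy hu)
    have F3 := congrArg (fun w => (sgn k (i * (j + l)) *
      sgn k ((j + l) * i + (j + l) * m + i * m) *
      sgn k ((m + i) * j + (m + i) * l + j * l)) • C.mul u w) (C.mul_mul_right hy hv hx)
    have c1 := C.b_comm hvx hu
    have c2 := C.b_comm (C.mul_mem _ _ _ hu _ hv) hx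
    have c3 := C.b_comm hy hx
    have c4 : i ≠ j → C.b x y = 0 := fun h => C.b_even i j h x hx y hy
    rw [← C.assoc, c2] at c1
    simp only [C.sigma_of_mem hx hy (C.mul_mem _ _ _ hu _ hv), LinearMap.sub_apply,
      LinearMap.smul_apply, LinearMap.comp_apply, (C.mul_osp_aux hx hy hu).1,
      (C.mul_osp_aux hx hy hv).2, Module.End.one_apply, map_sub, map_smul]
    simp only [c1, c3, C.assoc y u v, map_add, map_smul] at F1 F2 F3
    clear c1 c2 c3 hyu hvx
    rcases parity_cases i with rfl | rfl <;> rcases parity_cases j with rfl | rfl <;>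
      rcases parity_cases l with rfl | rfl <;> rcases parity_cases m with rfl | rfl <;>
      simp only [mul_zero, mul_one, add_zero, zero_add, one_add_one_parity, sgn_zero,
        sgn_one, ne_eq, zero_ne_one, one_ne_zero, not_false_eq_true, not_true_eq_false,
        forall_true_left, false_imp_iff] at F1 F2 F3 c4 ⊢
    all_goals try rw [c4] at F3 h ⊢
    all_goals linear_combination (norm := module) F1 - F2 + F3 - h

lemma tripleComm_tri (C : SymComp k S) {d e : Fin 3 → Module.End k S}
    (hd : d ∈ C.tri) (he : e ∈ C.tri) : C.tripleComm d e ∈ C.tri := by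
  have key : ∀ i j, ∀ d ∈ C.triHom i, ∀ e ∈ C.triHom j, C.tripleComm d e ∈ C.tri := by
    intro i j d hd e he
    have h := C.tripleComm_triHom hd he
    rcases parity_cases (i + j) with h0 | h0 <;> rw [h0] at h
    · exact Submodule.mem_sup_left h
    · exact Submodule.mem_sup_right h
  obtain ⟨d0, hd0, d1, hd1, rfl⟩ := Submodule.mem_sup.1 hd
  obtain ⟨e0, he0, e1, he1, rfl⟩ := Submodule.mem_sup.1 he
  simp only [map_add, LinearMap.add_apply]
  exact add_mem (add_mem (key 0 0 _ hd0 _ he0) (key 1 0 _ hd1 _ he0))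
    (add_mem (key 0 1 _ hd0 _ he1) (key 1 1 _ hd1 _ he1))

lemma theta_pow_tri (C : SymComp k S) (n : ℕ) {d : Fin 3 → Module.End k S}
    (hd : d ∈ C.tri) : (theta k S ^ n) d ∈ C.tri := by
  induction n with
  | zero => simpa using hd
  | succ n ih =>
    rw [pow_succ', Module.End.mul_apply]
    obtain ⟨d0, hd0, d1, hd1, h⟩ := Submodule.mem_sup.1 ih
    rw [← h, map_add]
    exact add_mem (Submodule.mem_sup_left (C.theta_triHom hd0))
      (Submodule.mem_sup_right (C.theta_triHom hd1))

lemma t_tri (h2 : (2 : k) ≠ 0) (C : SymComp k S) (x y : S) : C.t x y ∈ C.tri := by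
  refine C.ind (P := fun x => C.t x y ∈ C.tri)
    (fun x x' hx hx' => by simpa using add_mem hx hx') (fun i x hx => ?_) x
  refine C.ind (P := fun y => C.t x y ∈ C.tri)
    (fun x x' hx hx' => by simpa using add_mem hx hx') (fun j y hy => ?_) y
  have h := C.t_triHom h2 hx hy
  rcases parity_cases (i + j) with h0 | h0 <;> rw [h0] at h
  · exact Submodule.mem_sup_left h
  · exact Submodule.mem_sup_right h

end SymComp

/-! ### Superalgebras -/

/-- A superalgebra: a vector space with a bilinear product and a pair of subspaces, the even and
the odd part. -/
structure SuperAlg (k L : Type*) [Field k] [AddCommGroup L] [Module k L] where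
  br : L →ₗ[k] L →ₗ[k] L
  gr : ZMod 2 → Submodule k L

namespace SuperAlg

variable {k L M : Type*} [Field k] [AddCommGroup L] [Module k L] [AddCommGroup M] [Module k M]

/-- Lie superalgebras over a field of characteristic `≠ 2`. The last axiom follows from the
others in characteristic `≠ 3`, and is part of the definition in characteristic `3`. -/
structure IsLieSuperalgebra (A : SuperAlg k L) : Prop where
  isCompl : IsCompl (A.gr 0) (A.gr 1)
  br_mem : ∀ i j, ∀ x ∈ A.gr i, ∀ y ∈ A.gr j, A.br x y ∈ A.gr (i + j)
  skew : ∀ i j, ∀ x ∈ A.gr i, ∀ y ∈ A.gr j, A.br x y = -(sgn k (i * j) • A.br y x)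
  jacobi : ∀ i j l, ∀ x ∈ A.gr i, ∀ y ∈ A.gr j, ∀ z ∈ A.gr l,
    A.br (A.br x y) z = A.br x (A.br y z) - sgn k (i * j) • A.br y (A.br x z)
  odd_cube : ∀ x ∈ A.gr 1, A.br x (A.br x x) = 0

/-- Two-sided ideals (not necessarily graded). -/
def IsIdeal (A : SuperAlg k L) (I : Submodule k L) : Prop :=
  ∀ x, ∀ y ∈ I, A.br x y ∈ I ∧ A.br y x ∈ I

/-- `I` is the sum of its intersections with the subspaces `G i`. -/
def IsHomogeneous {ι : Type*} (G : ι → Submodule k L) (I : Submodule k L) : Prop :=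
  I ≤ ⨆ i, I ⊓ G i

/-- Graded two-sided ideals: the ideals of superalgebras. -/
def IsGradedIdeal (A : SuperAlg k L) (I : Submodule k L) : Prop :=
  A.IsIdeal I ∧ IsHomogeneous A.gr I

/-- Simple superalgebras: the product is not zero and there are no proper nonzero graded ideals. -/
def IsSimple (A : SuperAlg k L) : Prop :=
  (∃ x y, A.br x y ≠ 0) ∧ ∀ I, A.IsGradedIdeal I → I = ⊥ ∨ I = ⊤

/-- The derived superalgebra `[L, L]`, as a subspace. -/
def derived (A : SuperAlg k L) : Submodule k L :=
  Submodule.span k {z | ∃ x y, A.br x y = z}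

/-- The derived superalgebra `[L, L]`, as a superalgebra. -/
def derivedAlg (A : SuperAlg k L) : SuperAlg k A.derived where
  br := LinearMap.mk₂ k
    (fun x y => ⟨A.br x y, Submodule.subset_span ⟨x, y, rfl⟩⟩)
    (fun _ _ _ => by ext; simp) (fun _ _ _ => by ext; simp)
    (fun _ _ _ => by ext; simp) (fun _ _ _ => by ext; simp)
  gr i := (A.gr i).comap A.derived.subtype

/-- The center. -/
def center (A : SuperAlg k L) : Submodule k L where
  carrier := {x | ∀ y, A.br x y = 0 ∧ A.br y x = 0}
  add_mem' := by
    intro x y hx hy z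
    simp [(hx z).1, (hx z).2, (hy z).1, (hy z).2]
  zero_mem' := by simp
  smul_mem' := by
    intro c x hx z
    simp [(hx z).1, (hx z).2]

lemma isIdeal_center (A : SuperAlg k L) : A.IsIdeal A.center := by
  intro x y hy
  rw [(hy x).1, (hy x).2]
  exact ⟨zero_mem _, zero_mem _⟩

lemma isIdeal_sInf (A : SuperAlg k L) (F : Set (Submodule k L)) (h : ∀ I ∈ F, A.IsIdeal I) :
    A.IsIdeal (sInf F) := by
  intro x y hy
  simp only [Submodule.mem_sInf] at hy ⊢
  exact ⟨fun I hI => (h I hI x y (hy I hI)).1, fun I hI => (h I hI x y (hy I hI)).2⟩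

lemma isIdeal_sSup (A : SuperAlg k L) (F : Set (Submodule k L)) (h : ∀ I ∈ F, A.IsIdeal I) :
    A.IsIdeal (sSup F) := by
  intro x y hy
  have h1 : sSup F ≤ (sSup F).comap (A.br x) :=
    sSup_le fun I hI z hz => (le_sSup hI : I ≤ sSup F) (h I hI x z hz).1
  have h2 : sSup F ≤ (sSup F).comap (A.br.flip x) :=
    sSup_le fun I hI z hz => (le_sSup hI : I ≤ sSup F) (h I hI x z hz).2
  exact ⟨h1 hy, h2 hy⟩

/-- The quotient of a superalgebra by an ideal. -/
def quotient (A : SuperAlg k L) (I : Submodule k L) (hI : A.IsIdeal I) : SuperAlg k (L ⧸ I) where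
  br := I.liftQ
    { toFun := fun x => I.mapQ I (A.br x) fun y hy => (hI x y hy).1
      map_add' := fun x y => by
        apply Submodule.linearMap_qext; ext z; simp
      map_smul' := fun c x => by
        apply Submodule.linearMap_qext; ext z; simp }
    (fun x hx => by
      rw [LinearMap.mem_ker]
      apply Submodule.linearMap_qext
      ext z
      simpa using (hI z x hx).2)
  gr i := (A.gr i).map I.mkQ

/-- Isomorphisms of superalgebras: linear bijections that preserve the product and the parity. -/
structure Iso (A : SuperAlg k L) (B : SuperAlg k M) where
  toEquiv : L ≃ₗ[k] M
  map_br : ∀ x y, toEquiv (A.br x y) = B.br (toEquiv x) (toEquiv y)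
  map_gr : ∀ i x, toEquiv x ∈ B.gr i ↔ x ∈ A.gr i

end SuperAlg

/-! ### The Lie superalgebra `g(S, S')` -/

section Magic

variable {k S S' : Type*} [Field k] [AddCommGroup S] [Module k S] [AddCommGroup S'] [Module k S']

/-- Triples of endomorphisms of `S`, triples of endomorphisms of `S'` and three copies
`ι₀(S ⊗ S')`, `ι₁(S ⊗ S')`, `ι₂(S ⊗ S')` of `S ⊗ S'`. -/
abbrev Amb (k S S' : Type*) [Field k] [AddCommGroup S] [Module k S] [AddCommGroup S']
    [Module k S'] : Type _ :=
  (Fin 3 → Module.End k S) × (Fin 3 → Module.End k S') × (Fin 3 → S ⊗[k] S')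

variable (C : SymComp k S) (C' : SymComp k S')

/-- The projection onto the component of parity `i`. -/
def ambProj (i : ZMod 2) : Amb k S S' →ₗ[k] Amb k S S' where
  toFun u := (fun n => C.endProj i (u.1 n), fun n => C'.endProj i (u.2.1 n),
    fun n => C.tensorProj C'.toSuperSpace i (u.2.2 n))
  map_add' u v := by ext <;> simp
  map_smul' c u := by ext <;> simp

/-- `(x ⊗ x', y ⊗ y') ↦ (-1)^{|x'||y|} (x • y) ⊗ (x' * y')`. -/
def tensorMul : S ⊗[k] S' →ₗ[k] S ⊗[k] S' →ₗ[k] S ⊗[k] S' :=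
  C.signedMap₂ C'.toSuperSpace (fun _ a' c _ => sgn k (a' * c)) C.mul C'.mul

/-- `(x ⊗ x', y ⊗ y') ↦ (-1)^{|x||x'| + |x||y'| + |y||y'|} b'(x',y') t_{x,y}`. -/
def tensorT : S ⊗[k] S' →ₗ[k] S ⊗[k] S' →ₗ[k] (Fin 3 → Module.End k S) :=
  (C.signedMap₂ C'.toSuperSpace (fun a a' c c' => sgn k (a * a' + a * c' + c * c')) C.t C'.b).compr₂
    (TensorProduct.rid k (Fin 3 → Module.End k S)).toLinearMap

/-- `(x ⊗ x', y ⊗ y') ↦ (-1)^{|y||x'|} b(x,y) t'_{x',y'}`. -/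
def tensorT' : S ⊗[k] S' →ₗ[k] S ⊗[k] S' →ₗ[k] (Fin 3 → Module.End k S') :=
  (C.signedMap₂ C'.toSuperSpace (fun _ a' c _ => sgn k (c * a')) C.b C'.t).compr₂
    (TensorProduct.lid k (Fin 3 → Module.End k S')).toLinearMap

/-- The action of an endomorphism `d'` of `S'`: `x ⊗ x' ↦ (-1)^{|d'||x|} x ⊗ d'(x')`. -/
def tensorAct' (d' : Module.End k S') : S ⊗[k] S' →ₗ[k] S ⊗[k] S' :=
  ∑ l, ∑ a, sgn k (l * a) • TensorProduct.map (C.proj a) (C'.endProj l d')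

/-- The sum of the products `[(d₀,d₁,d₂), ι_i(x ⊗ x')]`, `[(d₀',d₁',d₂'), ι_i(x ⊗ x')]` and
`[ι_i(x ⊗ x'), ι_{i+1}(y ⊗ y')] = (-1)^{|x'||y|} ι_{i+2}((x • y) ⊗ (x' * y'))`. -/
def halfBr : Amb k S S' →ₗ[k] Amb k S S' →ₗ[k] Amb k S S' :=
  LinearMap.mk₂ k
    (fun u w => (0, 0, fun n =>
      TensorProduct.map (u.1 n) LinearMap.id (w.2.2 n) + tensorAct' C C' (u.2.1 n) (w.2.2 n)
        + tensorMul C C' (u.2.2 (n + 1)) (w.2.2 (n + 2))))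
    (fun u u' w => by
      ext n
      · simp
      · simp
      · simp [tensorAct', TensorProduct.map_add_left, TensorProduct.map_add_right,
          Finset.sum_add_distrib]
        abel)
    (fun c u w => by
      ext n
      · simp
      · simp
      · simp [tensorAct', TensorProduct.map_smul_left, TensorProduct.map_smul_right,
          Finset.smul_sum, smul_comm c])
    (fun u w w' => by
      ext n
      · simp
      · simp
      · simp
        abel)
    (fun c u w => by
      ext n <;> simp)

/-- The sum of the products `[(d₀,d₁,d₂), (e₀,e₁,e₂)]`, `[(d₀',d₁',d₂'), (e₀',e₁',e₂')]` and
`[ι_i(x ⊗ x'), ι_i(y ⊗ y')] = (-1)^{|x||x'| + |x||y'| + |y||y'|} b'(x',y') θ^i(t_{x,y})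
+ (-1)^{|y||x'|} b(x,y) θ'^i(t'_{x',y'})`. -/
def diagBr : Amb k S S' →ₗ[k] Amb k S S' →ₗ[k] Amb k S S' :=
  LinearMap.mk₂ k
    (fun u w =>
      (C.tripleComm u.1 w.1
          + ∑ i : Fin 3, (SymComp.theta k S ^ i.val) (tensorT C C' (u.2.2 i) (w.2.2 i)),
        C'.tripleComm u.2.1 w.2.1
          + ∑ i : Fin 3, (SymComp.theta k S' ^ i.val) (tensorT' C C' (u.2.2 i) (w.2.2 i)),
        0))
    (fun u u' w => by
      ext1
      · simp [Finset.sum_add_distrib]; abel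
      · ext1
        · simp [Finset.sum_add_distrib]; abel
        · simp)
    (fun c u w => by
      ext1
      · simp [Finset.smul_sum]
      · ext1
        · simp [Finset.smul_sum]
        · simp)
    (fun u w w' => by
      ext1
      · simp [Finset.sum_add_distrib]; abel
      · ext1
        · simp [Finset.sum_add_distrib]; abel
        · simp)
    (fun c u w => by
      ext1
      · simp [Finset.smul_sum]
      · ext1
        · simp [Finset.smul_sum]
        · simp)

/-- The superanticommutative product with the values above; here
`[u, w] = -(-1)^{|u||w|} [w, u]` gives the products that are not listed there. -/
def ambBr : Amb k S S' →ₗ[k] Amb k S S' →ₗ[k] Amb k S S' :=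
  diagBr C C' + halfBr C C'
    - ∑ i, ∑ j, sgn k (i * j) • (halfBr C C').flip.compl₁₂ (ambProj C C' i) (ambProj C C' j)

/-- The underlying space `tri(S) ⊕ tri(S') ⊕ ι₀(S ⊗ S') ⊕ ι₁(S ⊗ S') ⊕ ι₂(S ⊗ S')`. -/
def magicSub : Submodule k (Amb k S S') := C.tri.prod (C'.tri.prod ⊤)

lemma halfBr_mem (u w : Amb k S S') : halfBr C C' u w ∈ magicSub C C' :=
  ⟨zero_mem _, zero_mem _, trivial⟩

lemma tensorT_mem (h2 : (2 : k) ≠ 0) (u w : S ⊗[k] S') : tensorT C C' u w ∈ C.tri := by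
  have key : ∀ u w : S ⊗[k] S', TensorProduct.rid k (Fin 3 → Module.End k S)
      (TensorProduct.map₂ C.t C'.b u w) ∈ C.tri := by
    intro u w
    induction u with
    | zero => simp
    | add u u' hu hu' => simpa using add_mem hu hu'
    | tmul x x' =>
      induction w with
      | zero => simp
      | add u u' hu hu' => simpa using add_mem hu hu'
      | tmul y y' => simpa using Submodule.smul_mem _ _ (C.t_tri h2 x y)
  simp only [tensorT, SuperSpace.signedMap₂, LinearMap.compr₂_apply, LinearMap.sum_apply, map_sum,
    LinearMap.smul_apply, map_smul, LinearMap.compl₁₂_apply, LinearEquiv.coe_coe]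
  exact Submodule.sum_mem _ fun a _ => Submodule.sum_mem _ fun a' _ => Submodule.sum_mem _
    fun c _ => Submodule.sum_mem _ fun c' _ => Submodule.smul_mem _ _ (key _ _)

lemma tensorT'_mem (h2 : (2 : k) ≠ 0) (u w : S ⊗[k] S') : tensorT' C C' u w ∈ C'.tri := by
  have key : ∀ u w : S ⊗[k] S', TensorProduct.lid k (Fin 3 → Module.End k S')
      (TensorProduct.map₂ C.b C'.t u w) ∈ C'.tri := by
    intro u w
    induction u with
    | zero => simp
    | add u u' hu hu' => simpa using add_mem hu hu'
    | tmul x x' =>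
      induction w with
      | zero => simp
      | add u u' hu hu' => simpa using add_mem hu hu'
      | tmul y y' => simpa using Submodule.smul_mem _ _ (C'.t_tri h2 x' y')
  simp only [tensorT', SuperSpace.signedMap₂, LinearMap.compr₂_apply, LinearMap.sum_apply, map_sum,
    LinearMap.smul_apply, map_smul, LinearMap.compl₁₂_apply, LinearEquiv.coe_coe]
  exact Submodule.sum_mem _ fun a _ => Submodule.sum_mem _ fun a' _ => Submodule.sum_mem _
    fun c _ => Submodule.sum_mem _ fun c' _ => Submodule.smul_mem _ _ (key _ _)

lemma ambBr_mem (h2 : (2 : k) ≠ 0) {u w : Amb k S S'} (hu : u ∈ magicSub C C')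
    (hw : w ∈ magicSub C C') : ambBr C C' u w ∈ magicSub C C' := by
  simp only [ambBr, LinearMap.sub_apply, LinearMap.add_apply, LinearMap.sum_apply,
    LinearMap.smul_apply, LinearMap.compl₁₂_apply, LinearMap.flip_apply]
  refine sub_mem (add_mem ⟨?_, ?_, trivial⟩ (halfBr_mem C C' _ _))
    (Submodule.sum_mem _ fun i _ => Submodule.sum_mem _ fun j _ => Submodule.smul_mem _ _
      (halfBr_mem C C' _ _))
  · exact add_mem (C.tripleComm_tri hu.1 hw.1) (Submodule.sum_mem _ fun i _ =>
      C.theta_pow_tri _ (tensorT_mem C C' h2 _ _))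
  · exact add_mem (C'.tripleComm_tri hu.2.1 hw.2.1) (Submodule.sum_mem _ fun i _ =>
      C'.theta_pow_tri _ (tensorT'_mem C C' h2 _ _))

lemma two_ne_zero_of_charP (k : Type*) [Field k] [CharP k 3] : (2 : k) ≠ 0 := by
  intro h
  have h1 := (CharP.cast_eq_zero_iff k 3 2).1 (by exact_mod_cast h)
  omega

/-- The restriction of a bilinear product to a subspace that is closed under it. -/
def restrictBr {k A : Type*} [Field k] [AddCommGroup A] [Module k A] (B : A →ₗ[k] A →ₗ[k] A)
    (p : Submodule k A) (h : ∀ u ∈ p, ∀ w ∈ p, B u w ∈ p) : p →ₗ[k] p →ₗ[k] p :=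
  LinearMap.mk₂ k (fun u w => ⟨B u w, h u u.2 w w.2⟩)
    (fun _ _ _ => by ext; simp) (fun _ _ _ => by ext; simp)
    (fun _ _ _ => by ext; simp) (fun _ _ _ => by ext; simp)

/-- The space `tri(S) ⊕ tri(S') ⊕ ι₀(S ⊗ S') ⊕ ι₁(S ⊗ S') ⊕ ι₂(S ⊗ S')`, as a type. -/
def Magic : Type _ := magicSub C C'

instance : AddCommGroup (Magic C C') := inferInstanceAs (AddCommGroup (magicSub C C'))

instance : Module k (Magic C C') := inferInstanceAs (Module k (magicSub C C'))

/-- The inclusion of `g(S, S')` in the space of all triples of endomorphisms. -/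
def Magic.incl : Magic C C' →ₗ[k] Amb k S S' := (magicSub C C').subtype

/-- The product of `g(S, S')`. -/
def Magic.br [CharP k 3] : Magic C C' →ₗ[k] Magic C C' →ₗ[k] Magic C C' :=
  restrictBr (ambBr C C') (magicSub C C')
    (fun _ hu _ hw => ambBr_mem C C' (two_ne_zero_of_charP k) hu hw)

lemma Magic.incl_br [CharP k 3] (u w : Magic C C') :
    Magic.incl C C' (Magic.br C C' u w) = ambBr C C' (Magic.incl C C' u) (Magic.incl C C' w) := rfl

/-- The Lie superalgebra `g(S, S')` (over a field of characteristic `3`). -/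
def magicAlg [CharP k 3] : SuperAlg k (Magic C C') where
  br := Magic.br C C'
  gr i := ((C.triHom i).prod ((C'.triHom i).prod
    (Submodule.pi Set.univ fun _ => LinearMap.range (C.tensorProj C'.toSuperSpace i)))).comap
      (Magic.incl C C')

end Magic

/-! ### The symmetric composition superalgebras `S₂` and `S_{4,2}` -/

section Examples

variable (k : Type*) [Field k]

/-- A vector space, as a superspace with zero odd part. -/
def evenSpace (S : Type*) [AddCommGroup S] [Module k S] : SuperSpace k S where
  proj i := if i = 0 then LinearMap.id else 0
  proj_proj i j x := by
    rcases parity_cases i with rfl | rfl <;> rcases parity_cases j with rfl | rfl <;> simp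
  proj_add x := by simp

/-- The superspace with even part `U` and odd part `W`. -/
def prodSpace (U W : Type*) [AddCommGroup U] [Module k U] [AddCommGroup W] [Module k W] :
    SuperSpace k (U × W) where
  proj i := if i = 0 then LinearMap.inl k U W ∘ₗ LinearMap.fst k U W
    else LinearMap.inr k U W ∘ₗ LinearMap.snd k U W
  proj_proj i j x := by
    rcases parity_cases i with rfl | rfl <;> rcases parity_cases j with rfl | rfl <;> simp
  proj_add x := by simp

lemma evenSpace_one {S : Type*} [AddCommGroup S] [Module k S] {i : ZMod 2} {x : S}
    (hx : x ∈ (evenSpace k S).gr i) : i = 0 ∨ x = 0 := by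
  rcases parity_cases i with rfl | rfl
  · exact Or.inl rfl
  · obtain ⟨y, rfl⟩ := hx
    exact Or.inr (by simp [evenSpace])

lemma prodSpace_zero {U W : Type*} [AddCommGroup U] [Module k U] [AddCommGroup W] [Module k W]
    {x : U × W} : x ∈ (prodSpace k U W).gr 0 ↔ x.2 = 0 := by
  constructor
  · rintro ⟨y, rfl⟩; simp [prodSpace]
  · intro h; exact ⟨x, by ext <;> simp [prodSpace, h]⟩

lemma prodSpace_one {U W : Type*} [AddCommGroup U] [Module k U] [AddCommGroup W] [Module k W]
    {x : U × W} : x ∈ (prodSpace k U W).gr 1 ↔ x.1 = 0 := by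
  constructor
  · rintro ⟨y, rfl⟩; simp [prodSpace]
  · intro h; exact ⟨x, by ext <;> simp [prodSpace, h]⟩

/-- The split two-dimensional para-Hurwitz algebra: `x 0` and `x 1` are the coordinates with
respect to a basis `e⁺, e⁻` with `e^± • e^± = e^∓`, `e^± • e^∓ = 0`, `q(e^±) = 0` and
`b(e⁺, e⁻) = 1`. -/
def S2 : SymComp k (Fin 2 → k) where
  toSuperSpace := evenSpace k (Fin 2 → k)
  mul := LinearMap.mk₂ k (fun x y => ![x 1 * y 1, x 0 * y 0])
    (fun x y z => by ext i; fin_cases i <;> simp <;> ring)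
    (fun x y z => by ext i; fin_cases i <;> simp <;> ring)
    (fun x y z => by ext i; fin_cases i <;> simp <;> ring)
    (fun x y z => by ext i; fin_cases i <;> simp <;> ring)
  mul_mem i j x hx y hy := by
    rcases evenSpace_one k hx with rfl | rfl
    · rcases evenSpace_one k hy with rfl | rfl
      · exact ⟨_, by simp [evenSpace]; rfl⟩
      · rw [map_zero]; exact zero_mem _
    · rw [LinearMap.map_zero₂]; exact zero_mem _
  q := (QuadraticMap.proj (0 : Fin 2) (1 : Fin 2)).comp (Submodule.subtype _)
  b := LinearMap.mk₂ k (fun x y => x 0 * y 1 + x 1 * y 0)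
    (fun x y z => by simp; ring) (fun x y z => by simp; ring)
    (fun x y z => by simp; ring) (fun x y z => by simp; ring)
  b_even i j hij x hx y hy := by
    rcases evenSpace_one k hx with rfl | rfl
    · rcases evenSpace_one k hy with rfl | rfl
      · exact absurd rfl hij
      · simp
    · simp
  b_alt x hx := by
    rcases evenSpace_one k hx with h | rfl
    · exact absurd h one_ne_zero
    · simp
  b_polar x y := by simp; ring
  regular x h := by
    have h0 := h ![1, 0]
    have h1 := h ![0, 1]
    ext i
    fin_cases i
    · simpa using h1
    · simpa using h0
  norm_mul x y := by simp; ring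
  norm_left x y z := by simp; ring
  norm_right x y z := by simp; ring
  norm_super i j l m x hx y hy z hz t ht := by
    rcases evenSpace_one k hx with rfl | rfl
    · rcases evenSpace_one k hy with rfl | rfl
      · rcases evenSpace_one k hz with rfl | rfl
        · simp [sgn]; ring
        · simp
      · simp
    · simp
  assoc x y z := by simp; ring

/-- The nonzero alternating bilinear form of the two-dimensional space `V = k²`. -/
def omega : LinearMap.BilinForm k (Fin 2 → k) :=
  LinearMap.mk₂ k (fun u v => u 0 * v 1 - u 1 * v 0)
    (fun x y z => by simp; ring) (fun x y z => by simp; ring)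
    (fun x y z => by simp; ring) (fun x y z => by simp; ring)

/-- The underlying space `End(V) ⊕ V` of `B(4,2)`. -/
abbrev B42 : Type _ := Matrix (Fin 2) (Fin 2) k × (Fin 2 → k)

/-- The polar form of the norm of `B(4,2)`: `b(f, g) = tr(f ḡ)` is the polar form of `det`, and
`b(u, v) = ⟨u|v⟩`. -/
def B42b : LinearMap.BilinForm k (B42 k) :=
  LinearMap.mk₂ k (fun x y => (x.1 * y.1.adjugate).trace + omega k x.2 y.2)
    (fun x y z => by simp [Matrix.trace_fin_two, Matrix.adjugate_fin_two, Matrix.mul_apply, Fin.sum_univ_two]; ring)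
    (fun x y z => by simp [Matrix.trace_fin_two, Matrix.adjugate_fin_two, Matrix.mul_apply, Fin.sum_univ_two]; ring)
    (fun x y z => by simp [Matrix.trace_fin_two, Matrix.adjugate_fin_two, Matrix.mul_apply, Fin.sum_univ_two]; ring)
    (fun x y z => by simp [Matrix.trace_fin_two, Matrix.adjugate_fin_two, Matrix.mul_apply, Fin.sum_univ_two]; ring)

/-- The symplectic involution of `End(V)` is the adjugate. -/
lemma omega_adjugate (f : Matrix (Fin 2) (Fin 2) k) (u v : Fin 2 → k) :
    omega k (f.mulVec u) v = omega k u (f.adjugate.mulVec v) := by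
  simp [omega, Matrix.adjugate_fin_two, dotProduct, Fin.sum_univ_two]
  ring

/-- The product of `B(4,2)`: the composition in `End(V)`, `v · f = f(v) = f̄ · v` and
`u · v = (w ↦ ⟨w|u⟩ v)`. -/
def B42mul : B42 k →ₗ[k] B42 k →ₗ[k] B42 k :=
  LinearMap.mk₂ k
    (fun x y => (x.1 * y.1 + LinearMap.toMatrix' (((omega k).flip x.2).smulRight y.2),
      y.1.mulVec x.2 + x.1.adjugate.mulVec y.2))
    (fun x y z => by
      ext i j <;> fin_cases i <;> try fin_cases j
      all_goals
        simp [Matrix.adjugate_fin_two, Matrix.mul_apply, dotProduct,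
          Fin.sum_univ_two, LinearMap.toMatrix'_apply]
        ring)
    (fun c x y => by
      ext i j <;> fin_cases i <;> try fin_cases j
      all_goals
        simp [Matrix.adjugate_fin_two, Matrix.mul_apply, dotProduct,
          Fin.sum_univ_two, LinearMap.toMatrix'_apply]
        ring)
    (fun x y z => by
      ext i j <;> fin_cases i <;> try fin_cases j
      all_goals
        simp [Matrix.adjugate_fin_two, Matrix.mul_apply, dotProduct,
          Fin.sum_univ_two, LinearMap.toMatrix'_apply]
        ring)
    (fun c x y => by
      ext i j <;> fin_cases i <;> try fin_cases j
      all_goals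
        simp [Matrix.adjugate_fin_two, Matrix.mul_apply, dotProduct,
          Fin.sum_univ_two, LinearMap.toMatrix'_apply]
        ring)

/-- The superinvolution `x̄ = b(x, 1) 1 - x` of `B(4,2)`. -/
def B42conj : B42 k →ₗ[k] B42 k :=
  ((B42b k).flip (1, 0)).smulRight (1, 0) - LinearMap.id

/-- The product `x • y = x̄ · ȳ` of the para-Hurwitz superalgebra of `B(4,2)`. -/
def S42mul : B42 k →ₗ[k] B42 k →ₗ[k] B42 k :=
  (B42mul k).compl₁₂ (B42conj k) (B42conj k)

lemma B42b_apply (x y : B42 k) : B42b k x y =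
    x.1 0 0 * y.1 1 1 + x.1 1 1 * y.1 0 0 - x.1 0 1 * y.1 1 0 - x.1 1 0 * y.1 0 1
      + (x.2 0 * y.2 1 - x.2 1 * y.2 0) := by
  simp [B42b, omega, Matrix.trace_fin_two, Matrix.adjugate_fin_two, Matrix.mul_apply,
    Fin.sum_univ_two]
  ring

lemma S42mul_apply (x y : B42 k) : S42mul k x y =
    (!![x.1 1 1 * y.1 1 1 + x.1 0 1 * y.1 1 0 + y.2 0 * x.2 1,
        -(x.1 1 1 * y.1 0 1) - x.1 0 1 * y.1 0 0 - y.2 0 * x.2 0;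
        -(x.1 1 0 * y.1 1 1) - x.1 0 0 * y.1 1 0 + y.2 1 * x.2 1,
        x.1 1 0 * y.1 0 1 + x.1 0 0 * y.1 0 0 - y.2 1 * x.2 0],
      ![-(y.1 1 1 * x.2 0) + y.1 0 1 * x.2 1 - x.1 0 0 * y.2 0 - x.1 0 1 * y.2 1,
        y.1 1 0 * x.2 0 - y.1 0 0 * x.2 1 - x.1 1 0 * y.2 0 - x.1 1 1 * y.2 1]) := by
  ext i j <;> fin_cases i <;> try fin_cases j
  all_goals
    simp [S42mul, B42mul, B42conj, B42b_apply, omega, Matrix.adjugate_fin_two, Matrix.mul_apply,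
      dotProduct, Fin.sum_univ_two, LinearMap.toMatrix'_apply]
    ring


lemma prodSpace_gr {U W : Type*} [AddCommGroup U] [Module k U] [AddCommGroup W] [Module k W]
    {i : ZMod 2} {x : U × W} (hx : x ∈ (prodSpace k U W).gr i) :
    (i = 0 ∧ x.2 = 0) ∨ (i = 1 ∧ x.1 = 0) := by
  rcases parity_cases i with rfl | rfl
  · exact Or.inl ⟨rfl, (prodSpace_zero k).1 hx⟩
  · exact Or.inr ⟨rfl, (prodSpace_one k).1 hx⟩

lemma S42mul_mem (i j : ZMod 2) (x : B42 k)
    (hx : x ∈ (prodSpace k (Matrix (Fin 2) (Fin 2) k) (Fin 2 → k)).gr i) (y : B42 k)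
    (hy : y ∈ (prodSpace k (Matrix (Fin 2) (Fin 2) k) (Fin 2 → k)).gr j) :
    S42mul k x y ∈ (prodSpace k (Matrix (Fin 2) (Fin 2) k) (Fin 2 → k)).gr (i + j) := by
  obtain ⟨f, u⟩ := x
  obtain ⟨g, v⟩ := y
  rcases prodSpace_gr k hx with ⟨rfl, rfl⟩ | ⟨rfl, rfl⟩ <;>
    rcases prodSpace_gr k hy with ⟨rfl, rfl⟩ | ⟨rfl, rfl⟩
  · refine (prodSpace_zero k).2 ?_
    ext i; fin_cases i <;> simp [S42mul_apply]
  · refine (prodSpace_one k).2 ?_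
    ext i j; fin_cases i <;> fin_cases j <;> simp [S42mul_apply]
  · refine (prodSpace_one k).2 ?_
    ext i j; fin_cases i <;> fin_cases j <;> simp [S42mul_apply]
  · refine (prodSpace_zero k).2 ?_
    ext i; fin_cases i <;> simp [S42mul_apply]

lemma S42_even (x y z : B42 k) (hx : x.2 = 0) :
    B42b k (S42mul k x y) (S42mul k x z) = x.1.det * B42b k y z ∧
    B42b k (S42mul k y x) (S42mul k z x) = x.1.det * B42b k y z := by
  simp [Matrix.det_fin_two, S42mul_apply, B42b_apply, hx]
  constructor <;> ring

lemma S42_super [CharP k 3] (i j l m : ZMod 2) (x y z t : B42 k)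
    (hx : (i = 0 ∧ x.2 = 0) ∨ (i = 1 ∧ x.1 = 0)) (hy : (j = 0 ∧ y.2 = 0) ∨ (j = 1 ∧ y.1 = 0))
    (hz : (l = 0 ∧ z.2 = 0) ∨ (l = 1 ∧ z.1 = 0)) (ht : (m = 0 ∧ t.2 = 0) ∨ (m = 1 ∧ t.1 = 0)) :
    B42b k (S42mul k x y) (S42mul k z t)
        + sgn k (i * j + i * l + j * l) * B42b k (S42mul k z y) (S42mul k x t)
      = sgn k (j * l) * (B42b k x z * B42b k y t) := by
  have h3 : (3 : k) = 0 := by exact_mod_cast CharP.cast_eq_zero k 3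
  obtain ⟨f, u⟩ := x
  obtain ⟨g, v⟩ := y
  obtain ⟨f', u'⟩ := z
  obtain ⟨g', v'⟩ := t
  simp only at hx hy hz ht
  simp only [S42mul_apply, B42b_apply, Matrix.of_apply, Matrix.cons_val', Matrix.cons_val_zero,
    Matrix.cons_val_one, Matrix.cons_val_fin_one]
  rcases hx with ⟨rfl, rfl⟩ | ⟨rfl, rfl⟩ <;> rcases hy with ⟨rfl, rfl⟩ | ⟨rfl, rfl⟩ <;>
    rcases hz with ⟨rfl, rfl⟩ | ⟨rfl, rfl⟩ <;> rcases ht with ⟨rfl, rfl⟩ | ⟨rfl, rfl⟩ <;>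
    simp only [sgn_zero, sgn_one, one_add_one_parity, mul_zero, zero_mul, mul_one, add_zero,
      zero_add, Pi.zero_apply, Matrix.zero_apply]
  all_goals first
    | ring1
    | linear_combination (u 0 * u' 1 - u 1 * u' 0) * (v 0 * v' 1 - v 1 * v' 0) * h3

/-- The norm `q(f) = det f` on the even part `End(V)`. -/
def S42q : QuadraticForm k ((prodSpace k (Matrix (Fin 2) (Fin 2) k) (Fin 2 → k)).gr 0) where
  toFun x := x.1.1.det
  toFun_smul c x := by
    change (c • x.1.1).det = _
    rw [Matrix.det_smul, Fintype.card_fin, sq, smul_eq_mul]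
  exists_companion' := ⟨(B42b k).compl₁₂ (Submodule.subtype _) (Submodule.subtype _), by
    intro x y
    have hx := (prodSpace_zero k).1 x.2
    have hy := (prodSpace_zero k).1 y.2
    simp [Matrix.det_fin_two, B42b_apply, hx, hy]
    ring⟩

/-- The symmetric composition superalgebra `S_{4,2}`: the para-Hurwitz superalgebra of `B(4,2)`,
over a field of characteristic `3`. -/
def S42 [CharP k 3] : SymComp k (B42 k) where
  toSuperSpace := prodSpace k (Matrix (Fin 2) (Fin 2) k) (Fin 2 → k)
  mul := S42mul k
  mul_mem := S42mul_mem k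
  q := S42q k
  b := B42b k
  b_even i j hij x hx y hy := by
    rcases prodSpace_gr k hx with ⟨rfl, h1⟩ | ⟨rfl, h1⟩ <;>
      rcases prodSpace_gr k hy with ⟨rfl, h2⟩ | ⟨rfl, h2⟩ <;>
      simp [B42b_apply, h1, h2] at hij ⊢
  b_alt x hx := by
    simp [B42b_apply, (prodSpace_one k).1 hx]
    ring
  b_polar x y := by
    have hx := (prodSpace_zero k).1 x.2
    have hy := (prodSpace_zero k).1 y.2
    change B42b k x y = (x.1.1 + y.1.1).det - x.1.1.det - y.1.1.det
    simp [Matrix.det_fin_two, B42b_apply, hx, hy]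
    ring
  regular x h := by
    have h1 := h (!![1, 0; 0, 0], 0)
    have h2 := h (!![0, 1; 0, 0], 0)
    have h3 := h (!![0, 0; 1, 0], 0)
    have h4 := h (!![0, 0; 0, 1], 0)
    have h5 := h (0, ![1, 0])
    have h6 := h (0, ![0, 1])
    simp [B42b_apply] at h1 h2 h3 h4 h5 h6
    ext i j
    · fin_cases i <;> fin_cases j <;> simp [h1, h2, h3, h4]
    · fin_cases i <;> simp [h5, h6]
  norm_mul x y := by
    have hx := (prodSpace_zero k).1 x.2
    have hy := (prodSpace_zero k).1 y.2
    change (S42mul k x y).1.det = x.1.1.det * y.1.1.det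
    simp [Matrix.det_fin_two, S42mul_apply, hx, hy]
    ring
  norm_left x y z := (S42_even k x y z ((prodSpace_zero k).1 x.2)).1
  norm_right x y z := (S42_even k x y z ((prodSpace_zero k).1 x.2)).2
  norm_super i j l m x hx y hy z hz t ht :=
    S42_super k i j l m x y z t (prodSpace_gr k hx) (prodSpace_gr k hy) (prodSpace_gr k hz)
      (prodSpace_gr k ht)
  assoc x y z := by
    simp [S42mul_apply, B42b_apply]
    ring

end Examples

/-! ### Contragredient Lie superalgebras -/

section Contragredient

variable {k : Type*} [Field k] {n : ℕ} {H : Type*} [AddCommGroup H] [Module k H]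

/-- A realization `(𝔥, Π, Π^∨)` of a square matrix `A`: `Π = {α_1, …, α_n}` is `root` and
`Π^∨ = {h_1, …, h_n}` is `coroot`. -/
structure Realization (A : Matrix (Fin n) (Fin n) k) (H : Type*) [AddCommGroup H] [Module k H] where
  root : Fin n → Module.Dual k H
  coroot : Fin n → H
  root_indep : LinearIndependent k root
  coroot_indep : LinearIndependent k coroot
  root_coroot : ∀ i j, root j (coroot i) = A i j
  finite : FiniteDimensional k H
  dim : Module.finrank k H + A.rank = 2 * n

/-- The generators: the elements of `𝔥` and `e_1, …, e_n, f_1, …, f_n`. -/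
inductive Gen (n : ℕ) (H : Type*)
  | h (x : H)
  | e (i : Fin n)
  | f (i : Fin n)

/-- The parity of the generators: `e_i` and `f_i` are odd if and only if `i ∈ τ`. -/
def Gen.parity (τ : Finset (Fin n)) : Gen n H → ZMod 2
  | .h _ => 0
  | .e i => if i ∈ τ then 1 else 0
  | .f i => if i ∈ τ then 1 else 0

/-- The `ℤ`-degree of the generators. -/
def Gen.deg : Gen n H → ℤ
  | .h _ => 0
  | .e _ => 1
  | .f _ => -1

/-- The degree of a nonassociative word, given the degrees of the letters. -/
def wordDeg {X G : Type*} [Add G] (d : X → G) : FreeMagma X → G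
  | .of x => d x
  | .mul a b => wordDeg d a + wordDeg d b

/-- The homogeneous components of the free nonassociative algebra, for given degrees of the
generators. -/
def freeGr (k : Type*) [Field k] {X G : Type*} [Add G] (d : X → G) (g : G) :
    Submodule k (FreeNonUnitalNonAssocAlgebra k X) :=
  Submodule.span k {m | ∃ a, wordDeg d a = g ∧ MonoidAlgebra.ofMagma k (FreeMagma X) a = m}

/-- The free superalgebra on the generators above. -/
def freeAlg (k : Type*) [Field k] {n : ℕ} (H : Type*) (τ : Finset (Fin n)) :
    SuperAlg k (FreeNonUnitalNonAssocAlgebra k (Gen n H)) where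
  br := LinearMap.mul k _
  gr := freeGr k (Gen.parity τ)

namespace Realization

variable {A : Matrix (Fin n) (Fin n) k} (R : Realization A H) (τ : Finset (Fin n))

/-- A generator, as an element of the free superalgebra. -/
local notation "gen" => FreeNonUnitalNonAssocAlgebra.of k (X := Gen n H)

/-- The relations of the Lie superalgebra `𝔤̃(A, τ)`: the defining identities of Lie
superalgebras, the linearity of `𝔥 → 𝔤̃(A, τ)`, and `[e_i, f_j] = δ_ij h_i`, `[h, h'] = 0`,
`[h, e_i] = α_i(h) e_i`, `[h, f_i] = -α_i(h) f_i`. -/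
inductive Rel : FreeNonUnitalNonAssocAlgebra k (Gen n H) → Prop
  | skew (i j : ZMod 2) (a b : FreeNonUnitalNonAssocAlgebra k (Gen n H))
      (ha : a ∈ (freeAlg k H τ).gr i) (hb : b ∈ (freeAlg k H τ).gr j) :
      Rel (a * b + sgn k (i * j) • (b * a))
  | jacobi (i j : ZMod 2) (a b c : FreeNonUnitalNonAssocAlgebra k (Gen n H))
      (ha : a ∈ (freeAlg k H τ).gr i) (hb : b ∈ (freeAlg k H τ).gr j) :
      Rel ((a * b) * c - (a * (b * c) - sgn k (i * j) • (b * (a * c))))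
  | odd_cube (a : FreeNonUnitalNonAssocAlgebra k (Gen n H)) (ha : a ∈ (freeAlg k H τ).gr 1) :
      Rel (a * (a * a))
  | h_add (x y : H) : Rel (gen (.h (x + y)) - (gen (.h x) + gen (.h y)))
  | h_smul (c : k) (x : H) : Rel (gen (.h (c • x)) - c • gen (.h x))
  | e_f (i j : Fin n) :
      Rel (gen (.e i) * gen (.f j) - if i = j then gen (.h (R.coroot i)) else 0)
  | h_h (x y : H) : Rel (gen (.h x) * gen (.h y))
  | h_e (x : H) (i : Fin n) : Rel (gen (.h x) * gen (.e i) - R.root i x • gen (.e i))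
  | h_f (x : H) (i : Fin n) : Rel (gen (.h x) * gen (.f i) + R.root i x • gen (.f i))

/-- The ideal generated by the relations. -/
def relIdeal : Submodule k (FreeNonUnitalNonAssocAlgebra k (Gen n H)) :=
  sInf {I | (freeAlg k H τ).IsIdeal I ∧ ∀ x, R.Rel τ x → x ∈ I}

lemma isIdeal_relIdeal : (freeAlg k H τ).IsIdeal (R.relIdeal τ) :=
  SuperAlg.isIdeal_sInf _ _ fun _ hI => hI.1

/-- The Lie superalgebra `𝔤̃(A, τ)` with the generators and relations above. -/
def tilde : SuperAlg k (FreeNonUnitalNonAssocAlgebra k (Gen n H) ⧸ R.relIdeal τ) :=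
  (freeAlg k H τ).quotient (R.relIdeal τ) (R.isIdeal_relIdeal τ)

/-- The `ℤ`-grading of `𝔤̃(A, τ)`, with `𝔥`, `e_i` and `f_i` in degrees `0`, `1` and `-1`. -/
def tildeDeg (m : ℤ) : Submodule k (FreeNonUnitalNonAssocAlgebra k (Gen n H) ⧸ R.relIdeal τ) :=
  (freeGr k Gen.deg m).map (R.relIdeal τ).mkQ

/-- The image of `𝔥` in `𝔤̃(A, τ)`. -/
def cartan : Submodule k (FreeNonUnitalNonAssocAlgebra k (Gen n H) ⧸ R.relIdeal τ) :=
  (Submodule.span k (Set.range fun x : H => gen (.h x))).map (R.relIdeal τ).mkQ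

/-- The largest homogeneous ideal of `𝔤̃(A, τ)` that intersects `𝔥` trivially. -/
def maxIdeal : Submodule k (FreeNonUnitalNonAssocAlgebra k (Gen n H) ⧸ R.relIdeal τ) :=
  sSup {I | (R.tilde τ).IsGradedIdeal I ∧ SuperAlg.IsHomogeneous (R.tildeDeg τ) I ∧
    I ⊓ R.cartan τ = ⊥}

lemma isIdeal_maxIdeal : (R.tilde τ).IsIdeal (R.maxIdeal τ) :=
  SuperAlg.isIdeal_sSup _ _ fun _ hI => hI.1.1

/-- The contragredient Lie superalgebra `𝔤(A, τ)`. -/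
def contragredient : SuperAlg k
    ((FreeNonUnitalNonAssocAlgebra k (Gen n H) ⧸ R.relIdeal τ) ⧸ R.maxIdeal τ) :=
  (R.tilde τ).quotient (R.maxIdeal τ) (R.isIdeal_maxIdeal τ)

/-- The centerless contragredient Lie superalgebra `𝔤(A, τ)/𝔠`, where `𝔠` is the center. -/
def centerless : SuperAlg k
    (((FreeNonUnitalNonAssocAlgebra k (Gen n H) ⧸ R.relIdeal τ) ⧸ R.maxIdeal τ) ⧸
      (R.contragredient τ).center) :=
  (R.contragredient τ).quotient (R.contragredient τ).center
    (R.contragredient τ).isIdeal_center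

end Realization

end Contragredient

/-- The matrix `A_{S₂,S_{4,2}}`. -/
def cartanMatrix (k : Type*) [Field k] : Matrix (Fin 5) (Fin 5) k :=
  !![2, -1, 0, 0, 0;
    -1, 2, -1, 0, 0;
    0, -1, 0, -1, 1;
    0, 0, -1, 2, 0;
    0, 0, 1, 0, 0]

/-! ### The projective general Lie algebra -/

section PGL

attribute [local instance] LieRing.ofAssociativeRing

/-- The ideal `k 1` of `gl_n`. -/
def scalars (k : Type*) [Field k] (n : ℕ) : LieIdeal k (Matrix (Fin n) (Fin n) k) where
  __ := Submodule.span k {(1 : Matrix (Fin n) (Fin n) k)}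
  lie_mem := by
    intro x m hm
    obtain ⟨c, rfl⟩ := Submodule.mem_span_singleton.1 hm
    have : ⁅x, c • (1 : Matrix (Fin n) (Fin n) k)⁆ = 0 := by simp [Ring.lie_def]
    rw [this]
    exact zero_mem (Submodule.span k {(1 : Matrix (Fin n) (Fin n) k)})

/-- The projective general Lie algebra `pgl_n = gl_n / k 1`. -/
def PGL (k : Type*) [Field k] (n : ℕ) : Type _ := Matrix (Fin n) (Fin n) k ⧸ scalars k n

instance (k : Type*) [Field k] (n : ℕ) : LieRing (PGL k n) :=
  LieSubmodule.Quotient.lieQuotientLieRing (I := scalars k n)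

instance (k : Type*) [Field k] (n : ℕ) : LieAlgebra k (PGL k n) :=
  LieSubmodule.Quotient.lieQuotientLieAlgebra (I := scalars k n)

/-- The class in `pgl_n` of a matrix. -/
def toPGL {k : Type*} [Field k] {n : ℕ} (X : Matrix (Fin n) (Fin n) k) : PGL k n :=
  LieSubmodule.Quotient.mk (N := scalars k n) X

end PGL

end SuperSquare

end

/-!
The whole proof rests on an explicit model of `𝔤(S₂, S₄,₂)` before division by the center: the
superalgebra `model k` on `gl₆ ⊕ ⋀³k⁶`. A matrix acts on trivectors in the natural way plus its
trace, and the product of two trivectors is the matrix `[u, v]` determined by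
`tr([u, v] Y) = ⟨Y u, v⟩`, where `⟨·, ·⟩` is the exterior product with values in `⋀⁶ = k`. With
this twist `⟨·, ·⟩` is invariant in characteristic `3`, and the scalar matrices act trivially. The
Jacobi identity for three trivectors is multilinear and `gl₆`-invariant, so by irreducibility of
`⋀³` (`trivec_irreducible`) it has to be verified for `u = e₀ ∧ e₁ ∧ e₂` only
(`jacobiator_basisVec`); it holds because `3 = 0`. This gives `model_isLieSuperalgebra`. As
`sl₆ ⊕ ⋀³` is the derived superalgebra, and a graded subspace stable under it either consists of
scalar matrices or contains it (`model_stable`), the ideals of the model are under control. Note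
that `tr 1 = 6 = 0`, so that the scalar matrices, which form the center, lie in `sl₆`.

The comparison with `𝔤(S₂, S₄,₂)` decomposes `k⁶` as `V ⊕ V ⊕ V`. The diagonal blocks of a
matrix correspond to `tri(S₂)`, which consists of the multiples `aₙ diag(1, -1)` with
`a₀ + a₁ + a₂ = 0`, and to the even part `sl₂³` of `tri(S₄,₂)`; the off-diagonal blocks correspond
to `e⁺ ⊗ End V` and `e⁻ ⊗ End V` in the three copies of `S₂ ⊗ S₄,₂`. In `⋀³(V ⊕ V ⊕ V)` the
summand `V ⊗ V ⊗ V` is the odd part of `tri(S₄,₂)`, and the summands `⋀²V ⊗ V` are the spaces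
`e^± ⊗ V`. The resulting linear map is a homomorphism `toMagic` (`psi_br`, `toMagic_br`), it is
surjective because the triality superalgebras are no larger than stated (`exists_evenEnd`,
`exists_oddEnd`), and its kernel is the center `k 1` (`ker_toMagic`).

Contragredient Lie superalgebras are recognized by `ChevalleyData`: a `ℤ`-graded Lie superalgebra
that is generated by elements satisfying the defining relations, such that no nonzero graded ideal
has zero component in degree `0`, is isomorphic to `𝔤(A, τ)`. The homomorphism from `𝔤̃(A, τ)`
is given by the presentation. Its kernel is the largest homogeneous ideal that intersects `𝔥`
trivially, as the triangular decomposition shows that `𝔤̃(A, τ)` has no elements of degree `0`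
outside `𝔥` (`tildeDeg_zero_le`). The model carries such data for every realization of the matrix
(`nonempty_chevalleyData`), with `𝔥` the diagonal matrices, and division by the center gives the
first claim. The remaining claims pass from the model to its quotient by the scalar matrices; see
the lemmas about `IsModelQuotient`.
-/

open scoped TensorProduct

noncomputable section

namespace SuperSquare

/-! ### Trivectors of a six-dimensional space -/

section Trivector

variable (k : Type*) [Field k]

/-- Trivectors of `k⁶`, encoded as the totally antisymmetric arrays of their coordinates
(over a field of characteristic `≠ 2`). -/
def Trivec : Submodule k (Fin 6 → Fin 6 → Fin 6 → k) where
  carrier := {u | (∀ a b c, u b a c = -u a b c) ∧ ∀ a b c, u a c b = -u a b c}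
  add_mem' := by
    rintro u v ⟨h1, h2⟩ ⟨h3, h4⟩
    refine ⟨fun a b c => ?_, fun a b c => ?_⟩
    · simp only [Pi.add_apply, h1 a b c, h3 a b c]; ring
    · simp only [Pi.add_apply, h2 a b c, h4 a b c]; ring
  zero_mem' := by simp
  smul_mem' := by
    rintro r u ⟨h1, h2⟩
    refine ⟨fun a b c => ?_, fun a b c => ?_⟩
    · simp only [Pi.smul_apply, h1 a b c, smul_neg]
    · simp only [Pi.smul_apply, h2 a b c, smul_neg]

variable {k}

/-- The action of a matrix on the index in position `s` of an array. -/
def slotAct (s : Fin 3) (X : Matrix (Fin 6) (Fin 6) k) :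
    Module.End k (Fin 6 → Fin 6 → Fin 6 → k) where
  toFun u a b c := match s with
    | 0 => ∑ l, X a l * u l b c
    | 1 => ∑ l, X b l * u a l c
    | 2 => ∑ l, X c l * u a b l
  map_add' u v := by
    fin_cases s <;> ext a b c <;> simp [mul_add, Finset.sum_add_distrib]
  map_smul' r u := by
    fin_cases s <;> ext a b c <;> simp [Finset.mul_sum, mul_left_comm]

lemma slotAct_mul (s : Fin 3) (X Y : Matrix (Fin 6) (Fin 6) k) :
    slotAct s (X * Y) = slotAct s X * slotAct s Y := by
  refine LinearMap.ext fun u => ?_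
  funext a b c
  fin_cases s <;>
    simp only [slotAct, LinearMap.coe_mk, AddHom.coe_mk, Module.End.mul_apply, Matrix.mul_apply,
      Finset.sum_mul, Finset.mul_sum, mul_assoc] <;> exact Finset.sum_comm

lemma slotAct_comm {s t : Fin 3} (h : s ≠ t) (X Y : Matrix (Fin 6) (Fin 6) k) :
    slotAct s X * slotAct t Y = slotAct t Y * slotAct s X := by
  refine LinearMap.ext fun u => ?_
  funext a b c
  fin_cases s <;> fin_cases t <;> first | exact absurd rfl h | skip
  all_goals
    simp only [slotAct, LinearMap.coe_mk, AddHom.coe_mk, Module.End.mul_apply, Finset.mul_sum]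
    rw [Finset.sum_comm]
    exact Finset.sum_congr rfl fun i _ => Finset.sum_congr rfl fun j _ => by ring

lemma slotAct_sub (s : Fin 3) (X Y : Matrix (Fin 6) (Fin 6) k) :
    slotAct s (X - Y) = slotAct s X - slotAct s Y := by
  refine LinearMap.ext fun u => ?_
  funext a b c
  fin_cases s <;> simp [slotAct, sub_mul, Finset.sum_sub_distrib]

/-- The action of `gl₆` on trivectors twisted by the trace, on all arrays. -/
def arrayAct (X : Matrix (Fin 6) (Fin 6) k) : Module.End k (Fin 6 → Fin 6 → Fin 6 → k) :=
  slotAct 0 X + slotAct 1 X + slotAct 2 X + X.trace • 1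

lemma arrayAct_apply (X : Matrix (Fin 6) (Fin 6) k) (u : Fin 6 → Fin 6 → Fin 6 → k)
    (a b c : Fin 6) : arrayAct X u a b c = ∑ l, X a l * u l b c + ∑ l, X b l * u a l c
      + ∑ l, X c l * u a b l + X.trace * u a b c := rfl

lemma arrayAct_comm (X Y : Matrix (Fin 6) (Fin 6) k) :
    arrayAct (X * Y - Y * X) = arrayAct X * arrayAct Y - arrayAct Y * arrayAct X := by
  have h01 := slotAct_comm (show (0 : Fin 3) ≠ 1 by decide) X Y
  have h02 := slotAct_comm (show (0 : Fin 3) ≠ 2 by decide) X Y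
  have h12 := slotAct_comm (show (1 : Fin 3) ≠ 2 by decide) X Y
  have h10 := slotAct_comm (show (1 : Fin 3) ≠ 0 by decide) X Y
  have h20 := slotAct_comm (show (2 : Fin 3) ≠ 0 by decide) X Y
  have h21 := slotAct_comm (show (2 : Fin 3) ≠ 1 by decide) X Y
  simp only [arrayAct, slotAct_sub, slotAct_mul, Matrix.trace_sub, Matrix.trace_mul_comm X Y,
    sub_self, zero_smul, add_mul, mul_add, smul_mul_assoc, mul_smul_comm, one_mul, mul_one,
    h01, h02, h12, h10, h20, h21]
  module

lemma arrayAct_mem (X : Matrix (Fin 6) (Fin 6) k) {u : Fin 6 → Fin 6 → Fin 6 → k}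
    (hu : u ∈ Trivec k) : arrayAct X u ∈ Trivec k := by
  obtain ⟨h1, h2⟩ := hu
  refine ⟨fun a b c => ?_, fun a b c => ?_⟩
  · simp only [arrayAct_apply, h1 a b c, h1 _ b c, h1 a _ c]
    rw [show ∑ l, X c l * u b a l = -∑ l, X c l * u a b l by
      simp [h1 a b, Finset.sum_neg_distrib]]
    simp only [mul_neg, Finset.sum_neg_distrib]
    ring
  · simp only [arrayAct_apply, h2 a b c, h2 a _ c, h2 a b _]
    rw [show ∑ l, X a l * u l c b = -∑ l, X a l * u l b c by
      simp [h2 _ b c, Finset.sum_neg_distrib]]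
    simp only [mul_neg, Finset.sum_neg_distrib]
    ring

/-- The module of trivectors, twisted by the trace: `X` acts as
`u ∧ v ∧ w ↦ X u ∧ v ∧ w + u ∧ X v ∧ w + u ∧ v ∧ X w + tr X • u ∧ v ∧ w`. -/
def act : Matrix (Fin 6) (Fin 6) k →ₗ[k] Trivec k →ₗ[k] Trivec k :=
  LinearMap.mk₂ k (fun X u => ⟨arrayAct X u, arrayAct_mem X u.2⟩)
    (fun X Y u => by
      ext a b c
      simp [arrayAct_apply, add_mul, Finset.sum_add_distrib]; ring)
    (fun r X u => by
      ext a b c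
      simp [arrayAct_apply, mul_assoc, Finset.mul_sum, mul_add])
    (fun X u v => by ext; simp)
    (fun r X u => by ext; simp)

lemma act_apply (X : Matrix (Fin 6) (Fin 6) k) (u : Trivec k) (a b c : Fin 6) :
    (act X u).1 a b c = ∑ l, X a l * u.1 l b c + ∑ l, X b l * u.1 a l c
      + ∑ l, X c l * u.1 a b l + X.trace * u.1 a b c := rfl

lemma act_comm (X Y : Matrix (Fin 6) (Fin 6) k) (u : Trivec k) :
    act (X * Y - Y * X) u = act X (act Y u) - act Y (act X u) :=
  Subtype.ext (LinearMap.congr_fun (arrayAct_comm X Y) u.1)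

lemma swap₁₂ (u : Trivec k) (a b c : Fin 6) : u.1 b a c = -u.1 a b c := u.2.1 a b c

lemma swap₂₃ (u : Trivec k) (a b c : Fin 6) : u.1 a c b = -u.1 a b c := u.2.2 a b c

lemma swap₁₃ (u : Trivec k) (a b c : Fin 6) : u.1 c b a = -u.1 a b c := by
  rw [swap₁₂ u b c a, swap₂₃ u b a c, swap₁₂ u a b c, neg_neg]

/-- Together with `sort₂₃`, a terminating rewriting system that sorts the indices of a
coordinate. -/
lemma sort₁₂ (u : Trivec k) {a b c : Fin 6} (_ : b < a) : u.1 a b c = -u.1 b a c :=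
  swap₁₂ u b a c

lemma sort₂₃ (u : Trivec k) {a b c : Fin 6} (_ : c < b) : u.1 a b c = -u.1 a c b :=
  swap₂₃ u a c b

/-- The exterior product `⋀³ × ⋀³ → ⋀⁶ = k`. -/
def pairing : Trivec k →ₗ[k] Trivec k →ₗ[k] k :=
  LinearMap.mk₂ k (fun u v =>
    u.1 0 1 2 * v.1 3 4 5 - u.1 0 1 3 * v.1 2 4 5 + u.1 0 1 4 * v.1 2 3 5 - u.1 0 1 5 * v.1 2 3 4
    + u.1 0 2 3 * v.1 1 4 5 - u.1 0 2 4 * v.1 1 3 5 + u.1 0 2 5 * v.1 1 3 4 + u.1 0 3 4 * v.1 1 2 5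
    - u.1 0 3 5 * v.1 1 2 4 + u.1 0 4 5 * v.1 1 2 3
    - (v.1 0 1 2 * u.1 3 4 5 - v.1 0 1 3 * u.1 2 4 5 + v.1 0 1 4 * u.1 2 3 5
      - v.1 0 1 5 * u.1 2 3 4 + v.1 0 2 3 * u.1 1 4 5 - v.1 0 2 4 * u.1 1 3 5
      + v.1 0 2 5 * u.1 1 3 4 + v.1 0 3 4 * u.1 1 2 5 - v.1 0 3 5 * u.1 1 2 4
      + v.1 0 4 5 * u.1 1 2 3))
    (fun u u' v => by simp; ring) (fun r u v => by simp; ring)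
    (fun u v v' => by simp; ring) (fun r u v => by simp; ring)

lemma pairing_apply (u v : Trivec k) : pairing u v =
    u.1 0 1 2 * v.1 3 4 5 - u.1 0 1 3 * v.1 2 4 5 + u.1 0 1 4 * v.1 2 3 5 - u.1 0 1 5 * v.1 2 3 4
    + u.1 0 2 3 * v.1 1 4 5 - u.1 0 2 4 * v.1 1 3 5 + u.1 0 2 5 * v.1 1 3 4 + u.1 0 3 4 * v.1 1 2 5
    - u.1 0 3 5 * v.1 1 2 4 + u.1 0 4 5 * v.1 1 2 3
    - (v.1 0 1 2 * u.1 3 4 5 - v.1 0 1 3 * u.1 2 4 5 + v.1 0 1 4 * u.1 2 3 5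
      - v.1 0 1 5 * u.1 2 3 4 + v.1 0 2 3 * u.1 1 4 5 - v.1 0 2 4 * u.1 1 3 5
      + v.1 0 2 5 * u.1 1 3 4 + v.1 0 3 4 * u.1 1 2 5 - v.1 0 3 5 * u.1 1 2 4
      + v.1 0 4 5 * u.1 1 2 3) := rfl

lemma pairing_neg (u v : Trivec k) : pairing u v = -pairing v u := by
  rw [pairing_apply, pairing_apply]; ring

lemma act_single_apply {i j : Fin 6} (h : i ≠ j) (u : Trivec k) (a b c : Fin 6) :
    (act (Matrix.single i j (1 : k)) u).1 a b c = (Pi.single i 1 : Fin 6 → k) a * u.1 j b c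
      + (Pi.single i 1 : Fin 6 → k) b * u.1 a j c + (Pi.single i 1 : Fin 6 → k) c * u.1 a b j := by
  have e : ∀ (p : Fin 6) (f : Fin 6 → k),
      ∑ l, Matrix.single i j (1 : k) p l * f l = (Pi.single i 1 : Fin 6 → k) p * f j := by
    intro p f
    rw [Finset.sum_eq_single j]
    · simp [Matrix.single_apply, Pi.single_apply, eq_comm]
    · intro l _ hl
      simp [Ne.symm hl]
    · simp
  rw [act_apply, e a fun l => u.1 l b c, e b fun l => u.1 a l c, e c fun l => u.1 a b l,
    Matrix.trace_single_eq_of_ne _ _ _ h, zero_mul, add_zero]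

/-- The trivector `p ∧ q ∧ r`. -/
def wedge (p q r : Fin 6 → k) : Trivec k :=
  ⟨fun a b c => p a * q b * r c - p a * q c * r b + p b * q c * r a - p b * q a * r c
      + p c * q a * r b - p c * q b * r a,
    fun a b c => by ring, fun a b c => by ring⟩

lemma wedge_apply (p q r : Fin 6 → k) (a b c : Fin 6) : (wedge p q r).1 a b c =
    p a * q b * r c - p a * q c * r b + p b * q c * r a - p b * q a * r c
      + p c * q a * r b - p c * q b * r a := rfl

lemma act_wedge (X : Matrix (Fin 6) (Fin 6) k) (p q r : Fin 6 → k) :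
    act X (wedge p q r) = wedge (X.mulVec p) q r + wedge p (X.mulVec q) r
      + wedge p q (X.mulVec r) + X.trace • wedge p q r := by
  ext a b c
  simp only [act_apply, wedge_apply, Submodule.coe_add, Submodule.coe_smul, Pi.add_apply,
    Pi.smul_apply, smul_eq_mul, Matrix.mulVec, dotProduct, Fin.sum_univ_six]
  ring

variable [CharP k 3]

lemma three_eq_zero : (3 : k) = 0 := by exact_mod_cast CharP.cast_eq_zero k 3

/-- In characteristic `3`, `x = -x` only for `x = 0`. -/
lemma eq_zero_of_eq_neg {x : k} (h : x = -x) : x = 0 := by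
  linear_combination (-1) * h + x * three_eq_zero (k := k)

lemma eq₁₂ (u : Trivec k) (a c : Fin 6) : u.1 a a c = 0 := eq_zero_of_eq_neg (swap₁₂ u a a c)

lemma eq₂₃ (u : Trivec k) (a c : Fin 6) : u.1 a c c = 0 := eq_zero_of_eq_neg (swap₂₃ u a c c)

/-- Invariance of the pairing: on `⋀⁶` a matrix acts by its trace, and the two twists add
twice the trace. -/
lemma pairing_act (X : Matrix (Fin 6) (Fin 6) k) (u v : Trivec k) :
    pairing (act X u) v + pairing u (act X v) = 0 := by
  have h : X.trace * pairing u v * 3 = 0 := by rw [three_eq_zero, mul_zero]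
  simp only [pairing_apply, act_apply, Matrix.trace, Matrix.diag, Fin.sum_univ_six] at h ⊢
  simp (decide := true) only [sort₁₂, sort₂₃, eq₁₂, eq₂₃]
  linear_combination h

lemma trivec_ext {u v : Trivec k} (h : ∀ a b c, a < b → b < c → u.1 a b c = v.1 a b c) :
    u = v := by
  have h1 : ∀ a b c, a < b → u.1 a b c = v.1 a b c := by
    intro a b c hab
    rcases lt_trichotomy b c with hbc | rfl | hbc
    · exact h a b c hab hbc
    · rw [eq₂₃, eq₂₃]
    · rw [sort₂₃ u hbc, sort₂₃ v hbc]
      rcases lt_trichotomy a c with hac | rfl | hac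
      · rw [h a c b hac hbc]
      · rw [eq₁₂, eq₁₂]
      · rw [sort₁₂ u hac, sort₁₂ v hac, h c a b hac hab]
  ext a b c
  rcases lt_trichotomy a b with hab | rfl | hab
  · exact h1 a b c hab
  · rw [eq₁₂, eq₁₂]
  · rw [sort₁₂ u hab, sort₁₂ v hab, h1 b a c hab]

/-- The trivectors `e_a ∧ e_b ∧ e_c`. -/
def basisVec (k : Type*) [Field k] [CharP k 3] (a b c : Fin 6) : Trivec k :=
  wedge (Pi.single a 1) (Pi.single b 1) (Pi.single c 1)

lemma basisVec_swap₁₂ (a b c : Fin 6) : basisVec k b a c = -basisVec k a b c := by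
  ext x y z
  simp only [basisVec, wedge_apply, Submodule.coe_neg, Pi.neg_apply]
  ring

lemma basisVec_swap₂₃ (a b c : Fin 6) : basisVec k a c b = -basisVec k a b c := by
  ext x y z
  simp only [basisVec, wedge_apply, Submodule.coe_neg, Pi.neg_apply]
  ring

lemma act_single_basisVec {i a b c : Fin 6} (hb : a ≠ b) (hc : a ≠ c) (hi : i ≠ a) :
    act (Matrix.single i a (1 : k)) (basisVec k a b c) = basisVec k i b c := by
  have e : ∀ j l m : Fin 6, (Matrix.single i j (1 : k)).mulVec (Pi.single l 1) m =
      if j = l then (Pi.single i 1 : Fin 6 → k) m else 0 := by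
    intro j l m
    simp [Matrix.mulVec_single, Matrix.single_apply, Pi.single_apply, ite_and, eq_comm]
    split_ifs <;> simp_all
  ext x y z
  simp only [basisVec, act_wedge, wedge_apply, e, Submodule.coe_add,
    Pi.add_apply, Matrix.trace_single_eq_of_ne _ _ _ hi, if_neg hb, if_neg hc, zero_smul, if_true,
    Submodule.coe_zero, Pi.zero_apply]
  ring

lemma basisVec_apply {a b c x y z : Fin 6} (h1 : a < b) (h2 : b < c) (hxy : x < y) (hyz : y < z) :
    (basisVec k a b c).1 x y z = if a = x ∧ b = y ∧ c = z then 1 else 0 := by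
  have e3 : ∀ (P Q R : Prop) [Decidable P] [Decidable Q] [Decidable R],
      (if P then (1 : k) else 0) * (if Q then 1 else 0) * (if R then 1 else 0) =
        if P ∧ Q ∧ R then 1 else 0 := by
    intro P Q R _ _ _
    by_cases P <;> by_cases Q <;> by_cases R <;> simp [*]
  have f1 : ¬ (y = a ∧ z = b ∧ x = c) := by omega
  have f2 : ¬ (y = a ∧ x = b ∧ z = c) := by omega
  have f3 : ¬ (z = a ∧ x = b ∧ y = c) := by omega
  have f4 : ¬ (z = a ∧ y = b ∧ x = c) := by omega
  have f5 : ¬ (x = a ∧ z = b ∧ y = c) := by omega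
  simp only [basisVec, wedge_apply, Pi.single_apply, e3, if_neg f1, if_neg f2, if_neg f3,
    if_neg f4, if_neg f5, sub_zero, add_zero]
  simp only [eq_comm]

lemma eq_sum_basisVec (u : Trivec k) : u = ∑ a, ∑ b, ∑ c,
    if a < b ∧ b < c then u.1 a b c • basisVec k a b c else 0 := by
  refine trivec_ext fun x y z hxy hyz => ?_
  have e : ∀ a b c : Fin 6, ((if a < b ∧ b < c then u.1 a b c • basisVec k a b c else 0 :
      Trivec k)).1 x y z = if a = x then if b = y then if c = z then u.1 a b c else 0 else 0
        else 0 := by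
    intro a b c
    by_cases h : a < b ∧ b < c
    · simp only [if_pos h, Submodule.coe_smul, Pi.smul_apply, smul_eq_mul,
        basisVec_apply h.1 h.2 hxy hyz, ite_and, mul_ite, mul_one, mul_zero]
    · rw [if_neg h]
      split_ifs with h1 h2 h3
      · subst h1 h2 h3; exact absurd ⟨hxy, hyz⟩ h
      all_goals simp
  simp only [Submodule.coe_sum, Finset.sum_apply, e]
  simp

/-- A subspace of the trivectors that contains every `e_a ∧ e_b ∧ e_c` is everything. -/
lemma eq_top_of_basisVec_mem {N : Submodule k (Trivec k)}
    (h : ∀ a b c : Fin 6, a ≠ b → a ≠ c → b ≠ c → basisVec k a b c ∈ N) : N = ⊤ := by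
  refine eq_top_iff.2 fun u _ => ?_
  rw [eq_sum_basisVec u]
  refine Submodule.sum_mem _ fun a _ => Submodule.sum_mem _ fun b _ => Submodule.sum_mem _
    fun c _ => ?_
  split_ifs with h1
  · exact Submodule.smul_mem _ _ (h a b c h1.1.ne (h1.1.trans h1.2).ne h1.2.ne)
  · exact zero_mem _

/-- `sl₆` acts transitively on the lines spanned by the trivectors `e_a ∧ e_b ∧ e_c`. -/
lemma basisVec_mem_of_stable {N : Submodule k (Trivec k)}
    (hN : ∀ i j, i ≠ j → ∀ u ∈ N, act (Matrix.single i j (1 : k)) u ∈ N) {a b c : Fin 6}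
    (hab : a ≠ b) (hac : a ≠ c) (hbc : b ≠ c) (h : basisVec k a b c ∈ N)
    (d e f : Fin 6) : basisVec k d e f ∈ N := by
  have s12 : ∀ {a b c}, basisVec k a b c ∈ N → basisVec k b a c ∈ N := fun {a b c} h => by
    rw [basisVec_swap₁₂]; exact neg_mem h
  have s23 : ∀ {a b c}, basisVec k a b c ∈ N → basisVec k a c b ∈ N := fun {a b c} h => by
    rw [basisVec_swap₂₃]; exact neg_mem h
  have move : ∀ {a b c} (i : Fin 6), a ≠ b → a ≠ c → basisVec k a b c ∈ N →
      basisVec k i b c ∈ N := by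
    intro a b c i hb hc h
    by_cases hi : i = a
    · rwa [hi]
    · rw [← act_single_basisVec hb hc hi]
      exact hN _ _ hi _ h
  -- The three positions are filled by `d`, `e`, `f` in turn.
  have h1 : ∃ p q, d ≠ p ∧ d ≠ q ∧ p ≠ q ∧ basisVec k d p q ∈ N := by
    by_cases hb : d = b
    · subst hb; exact ⟨a, c, hab.symm, hbc, hac, s12 h⟩
    by_cases hc : d = c
    · subst hc; exact ⟨a, b, hac.symm, hbc.symm, hab, s12 (s23 h)⟩
    exact ⟨b, c, hb, hc, hbc, move d hab hac h⟩
  obtain ⟨p, q, hp, hq, hpq, h1⟩ := h1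
  have h2 : ∃ r, d ≠ r ∧ e ≠ r ∧ basisVec k d e r ∈ N := by
    by_cases he : e = q
    · subst he; exact ⟨p, hp, hpq.symm, s23 h1⟩
    exact ⟨q, hq, he, s12 (move e hp.symm hpq (s12 h1))⟩
  obtain ⟨r, hr, her, h2⟩ := h2
  exact s23 (s12 (move f hr.symm her.symm (s12 (s23 h2))))

/-- Irreducibility of the trivectors as a module for `sl₆`. If the coordinate of `u` at
`(a, b, c)` is not zero and `{a', b', c'}` is the complement of `{a, b, c}`, then
`E_{a'a} E_{b'b} E_{c'c}` sends `u` to a nonzero multiple of `e_{a'} ∧ e_{b'} ∧ e_{c'}`. -/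
theorem trivec_irreducible {N : Submodule k (Trivec k)}
    (hN : ∀ i j, i ≠ j → ∀ u ∈ N, act (Matrix.single i j (1 : k)) u ∈ N)
    {u : Trivec k} (hu : u ∈ N) (h0 : u ≠ 0) : N = ⊤ := by
  obtain ⟨a, b, c, hab, hbc, h1⟩ : ∃ a b c, a < b ∧ b < c ∧ u.1 a b c ≠ 0 := by
    by_contra h
    push Not at h
    exact h0 (trivec_ext fun a b c hab hbc => h a b c hab hbc)
  obtain ⟨a', b', c', hab', hbc', hac', ha, hb, hc⟩ : ∃ a' b' c' : Fin 6, a' ≠ b' ∧ b' ≠ c' ∧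
      a' ≠ c' ∧ (a' ≠ a ∧ a' ≠ b ∧ a' ≠ c) ∧ (b' ≠ a ∧ b' ≠ b ∧ b' ≠ c) ∧
      (c' ≠ a ∧ c' ≠ b ∧ c' ≠ c) := by
    clear hu h1
    decide +revert
  have h2 := hN a' a ha.1 _ (hN b' b hb.2.1 _ (hN c' c hc.2.2 _ hu))
  have h3 : act (Matrix.single a' a (1 : k)) (act (Matrix.single b' b 1)
      (act (Matrix.single c' c 1) u)) = u.1 a b c • basisVec k a' b' c' := by
    ext x y z
    simp only [act_single_apply ha.1, act_single_apply hb.2.1, act_single_apply hc.2.2,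
      Submodule.coe_smul, Pi.smul_apply, smul_eq_mul, basisVec, wedge_apply,
      Pi.single_eq_of_ne hb.1.symm, Pi.single_eq_of_ne hc.1.symm, Pi.single_eq_of_ne hc.2.1.symm,
      zero_mul, zero_add, add_zero, swap₂₃ u a b c, swap₁₂ u a b c, swap₁₃ u a b c,
      (swap₁₂ u a c b).trans (congrArg _ (swap₂₃ u a b c)),
      (swap₂₃ u b a c).trans (congrArg _ (swap₁₂ u a b c))]
    ring
  rw [h3] at h2
  have h4 : basisVec k a' b' c' ∈ N := (N.smul_mem_iff h1).1 h2
  exact eq_top_of_basisVec_mem fun d e f _ _ _ =>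
    basisVec_mem_of_stable hN hab' hac' hbc' h4 d e f

end Trivector

/-! ### The Lie superalgebra structure on `gl₆ ⊕ ⋀³` -/

section Model

variable {k : Type*} [Field k]

/-- The product of two trivectors: the matrix that represents `Y ↦ ⟨Y u, v⟩` with respect to the
trace form. -/
def oddBr : Trivec k →ₗ[k] Trivec k →ₗ[k] Matrix (Fin 6) (Fin 6) k :=
  LinearMap.mk₂ k (fun u v => Matrix.of fun i j => pairing (act (Matrix.single j i 1) u) v)
    (fun u u' v => by ext; simp) (fun r u v => by ext; simp)
    (fun u v v' => by ext; simp) (fun r u v => by ext; simp)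

lemma oddBr_apply (u v : Trivec k) (i j : Fin 6) :
    oddBr u v i j = pairing (act (Matrix.single j i 1) u) v := rfl

lemma trace_oddBr_mul (u v : Trivec k) (Y : Matrix (Fin 6) (Fin 6) k) :
    (oddBr u v * Y).trace = pairing (act Y u) v := by
  conv_rhs => rw [Matrix.matrix_eq_sum_single Y]
  simp only [Matrix.trace, Matrix.diag, Matrix.mul_apply, oddBr_apply, map_sum,
    LinearMap.sum_apply]
  rw [Finset.sum_comm]
  refine Finset.sum_congr rfl fun i _ => Finset.sum_congr rfl fun j _ => ?_
  rw [show Matrix.single i j (Y i j) = Y i j • Matrix.single i j (1 : k) by simp, map_smul,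
    LinearMap.smul_apply, map_smul, LinearMap.smul_apply, smul_eq_mul, mul_comm]

/-- The trace form is nondegenerate. -/
lemma eq_of_trace_mul {X X' : Matrix (Fin 6) (Fin 6) k}
    (h : ∀ Y, (X * Y).trace = (X' * Y).trace) : X = X' := by
  ext i j
  simpa [Matrix.trace_mul_single] using h (Matrix.single j i 1)

variable [CharP k 3]

lemma act_one (u : Trivec k) : act (1 : Matrix (Fin 6) (Fin 6) k) u = 0 := by
  ext a b c
  simp only [act_apply, Matrix.one_apply, ite_mul, one_mul, zero_mul, Finset.sum_ite_eq,
    Finset.mem_univ, if_true, Matrix.trace_one, Fintype.card_fin, Submodule.coe_zero, Pi.zero_apply]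
  push_cast
  linear_combination (3 * u.1 a b c) * three_eq_zero (k := k)

lemma trace_oddBr (u v : Trivec k) : (oddBr u v).trace = 0 := by
  have h := trace_oddBr_mul u v 1
  rwa [mul_one, act_one, map_zero, LinearMap.zero_apply] at h

lemma oddBr_comm (u v : Trivec k) : oddBr u v = oddBr v u := by
  refine eq_of_trace_mul fun Y => ?_
  rw [trace_oddBr_mul, trace_oddBr_mul, pairing_neg (act Y v) u]
  linear_combination pairing_act Y u v

lemma oddBr_act (X : Matrix (Fin 6) (Fin 6) k) (u v : Trivec k) :
    X * oddBr u v - oddBr u v * X = oddBr (act X u) v + oddBr u (act X v) := by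
  refine eq_of_trace_mul fun Y => ?_
  have h1 := pairing_act X (act Y u) v
  have h2 := trace_oddBr_mul u v (Y * X - X * Y)
  rw [act_comm] at h2
  simp only [map_sub, LinearMap.sub_apply] at h2
  rw [sub_mul, add_mul, Matrix.trace_sub, Matrix.trace_add, trace_oddBr_mul, trace_oddBr_mul,
    mul_assoc X, Matrix.trace_mul_comm X, mul_assoc, mul_assoc, ← Matrix.trace_sub, ← mul_sub,
    trace_oddBr_mul, act_comm, map_sub, LinearMap.sub_apply]
  linear_combination -h1

/-- The trilinear map that has to vanish in order that the Jacobi identity holds for trivectors. -/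
def jacobiator (u v w : Trivec k) : Trivec k :=
  act (oddBr u v) w + act (oddBr v w) u + act (oddBr w u) v

omit [CharP k 3] in
lemma jacobiator_add (u u' v w : Trivec k) :
    jacobiator (u + u') v w = jacobiator u v w + jacobiator u' v w := by
  simp only [jacobiator, map_add, LinearMap.add_apply]; abel

lemma jacobiator_act (X : Matrix (Fin 6) (Fin 6) k) (u v w : Trivec k) :
    jacobiator (act X u) v w = act X (jacobiator u v w) - jacobiator u (act X v) w
      - jacobiator u v (act X w) := by
  have key : ∀ u v w : Trivec k, act X (act (oddBr u v) w) = act (oddBr (act X u) v) w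
      + act (oddBr u (act X v)) w + act (oddBr u v) (act X w) := by
    intro u v w
    have h := act_comm X (oddBr u v) w
    rw [oddBr_act, map_add, LinearMap.add_apply] at h
    rw [h]; abel
  simp only [jacobiator, map_add, key]
  abel

lemma pairing_basisVec (v : Trivec k) : pairing (basisVec k 0 1 2) v = v.1 3 4 5 := by
  simp [pairing_apply, basisVec, wedge_apply]

omit [CharP k 3] in
lemma act_single_apply' (i j : Fin 6) (u : Trivec k) (a b c : Fin 6) :
    (act (Matrix.single i j (1 : k)) u).1 a b c = (if a = i then u.1 j b c else 0)
      + (if b = i then u.1 a j c else 0) + (if c = i then u.1 a b j else 0)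
      + (if i = j then u.1 a b c else 0) := by
  by_cases h : i = j
  · subst h
    have e : ∀ (p : Fin 6) (f : Fin 6 → k),
        ∑ l, Matrix.single i i (1 : k) p l * f l = if p = i then f i else 0 := by
      intro p f
      rw [Finset.sum_eq_single i]
      · simp [Matrix.single_apply, eq_comm]
      · intro l _ hl
        simp [Ne.symm hl]
      · simp
    rw [act_apply, e a fun l => u.1 l b c, e b fun l => u.1 a l c, e c fun l => u.1 a b l,
      Matrix.trace_single_eq_same, one_mul, if_pos rfl]
  · rw [act_single_apply h, if_neg h]
    simp [Pi.single_apply]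

/-- The increasing triples of indices. -/
lemma sorted_cases {P : Fin 6 → Fin 6 → Fin 6 → Prop}
    (h : ∀ t ∈ [(0, 1, 2), (0, 1, 3), (0, 1, 4), (0, 1, 5), (0, 2, 3), (0, 2, 4), (0, 2, 5),
      (0, 3, 4), (0, 3, 5), (0, 4, 5), (1, 2, 3), (1, 2, 4), (1, 2, 5), (1, 3, 4), (1, 3, 5),
      (1, 4, 5), (2, 3, 4), (2, 3, 5), (2, 4, 5), (3, 4, 5)], P t.1 t.2.1 t.2.2) :
    ∀ a b c, a < b → b < c → P a b c := by
  have h1 : ∀ a b c : Fin 6, a < b → b < c → (a, b, c) ∈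
      ([(0, 1, 2), (0, 1, 3), (0, 1, 4), (0, 1, 5), (0, 2, 3), (0, 2, 4), (0, 2, 5),
       (0, 3, 4), (0, 3, 5), (0, 4, 5), (1, 2, 3), (1, 2, 4), (1, 2, 5), (1, 3, 4), (1, 3, 5),
       (1, 4, 5), (2, 3, 4), (2, 3, 5), (2, 4, 5), (3, 4, 5)] : List _) := by decide
  exact fun a b c hab hbc => h _ (h1 a b c hab hbc)

set_option maxHeartbeats 4000000 in
/-- The Jacobi identity for one particular trivector. The entries of `[e₀ ∧ e₁ ∧ e₂, v]` are single
coordinates of `E_{ji} v`, so that every coordinate is a short polynomial identity modulo `3`. -/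
lemma jacobiator_basisVec (v w : Trivec k) : jacobiator (basisVec k 0 1 2) v w = 0 := by
  have h1 : ∀ (v : Trivec k) (i j : Fin 6), oddBr (basisVec k 0 1 2) v i j =
      -(act (Matrix.single j i 1) v).1 3 4 5 := by
    intro v i j
    rw [oddBr_apply, ← pairing_basisVec]
    linear_combination pairing_act (Matrix.single j i 1) (basisVec k 0 1 2) v
  have h2 : ∀ x y z : Fin 6, x < y → y < z → (basisVec k 0 1 2).1 x y z =
      if 0 = x ∧ 1 = y ∧ 2 = z then 1 else 0 := fun x y z =>
    basisVec_apply (by decide) (by decide)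
  have e3 := three_eq_zero (k := k)
  have e6 : (6 : k) = 0 := by linear_combination 2 * e3
  have e12 : (12 : k) = 0 := by linear_combination 4 * e3
  generalize basisVec k 0 1 2 = e at h1 h2 ⊢
  refine trivec_ext (sorted_cases fun t ht => ?_)
  simp only [List.mem_cons, List.not_mem_nil, or_false] at ht
  rcases ht with rfl | rfl | rfl | rfl | rfl | rfl | rfl | rfl | rfl | rfl | rfl | rfl | rfl | rfl
    | rfl | rfl | rfl | rfl | rfl | rfl
  all_goals
    simp only [jacobiator, oddBr_comm w, Submodule.coe_add, Pi.add_apply, act_apply, trace_oddBr,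
      Fin.sum_univ_six]
    simp (decide := true) only [sort₁₂, sort₂₃, eq₁₂, eq₂₃, h2, if_true, if_false, mul_zero,
      zero_mul, add_zero, zero_add, mul_one, mul_neg, neg_zero]
    simp only [h1, oddBr_apply v w, pairing_apply, act_single_apply']
    simp (decide := true) only [sort₁₂, sort₂₃, eq₁₂, eq₂₃, if_true, if_false, add_zero,
      zero_add, neg_zero, mul_zero, zero_mul, sub_zero]
    ring_nf
    first
    | rfl
    | (simp only [e3, e6, e12, mul_zero, neg_zero, add_zero, sub_zero]; rfl)

end Model

section Model

variable {k : Type*} [Field k] [CharP k 3]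

/-- The Jacobi identity for trivectors. The `u` for which it holds form a submodule for `gl₆`, so
by irreducibility it is enough to treat one `u ≠ 0`. -/
lemma jacobiator_eq_zero (u v w : Trivec k) : jacobiator u v w = 0 := by
  let N : Submodule k (Trivec k) :=
    { carrier := {u | ∀ v w, jacobiator u v w = 0}
      add_mem' := fun {u u'} h h' v w => by rw [jacobiator_add, h, h', add_zero]
      zero_mem' := fun v w => by simp [jacobiator]
      smul_mem' := fun c u h v w => by
        have : jacobiator (c • u) v w = c • jacobiator u v w := by simp [jacobiator]
        rw [this, h, smul_zero] }
  have hN : N = ⊤ := eq_top_of_basisVec_mem fun a b c _ _ _ =>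
    basisVec_mem_of_stable (N := N) (fun i j _ u (hu : ∀ v w, jacobiator u v w = 0) v w => by
      rw [jacobiator_act, hu, hu, hu, map_zero, sub_zero, sub_zero])
      (show (0 : Fin 6) ≠ 1 by decide) (show (0 : Fin 6) ≠ 2 by decide)
      (show (1 : Fin 6) ≠ 2 by decide) jacobiator_basisVec a b c
  have : u ∈ N := hN ▸ Submodule.mem_top
  exact this v w

omit [CharP k 3] in
lemma wedge_rotate (p q r : Fin 6 → k) : wedge p q r = wedge q r p := by
  ext a b c
  simp only [wedge_apply]
  ring

omit [CharP k 3] in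
/-- `p ∧ q ∧ r ∧ s ∧ t ∧ r = 0`. -/
lemma pairing_wedge (p q r s t : Fin 6 → k) : pairing (wedge p q r) (wedge s t r) = 0 := by
  simp only [pairing_apply, wedge_apply]
  ring

/-- The axiom `[x, [x, x]] = 0` for trivectors. By the Jacobi identity the map
`u ↦ [u, [u, u]]` is additive, and it vanishes on decomposable trivectors. -/
lemma act_oddBr_self (u : Trivec k) : act (oddBr u u) u = 0 := by
  let N : Submodule k (Trivec k) :=
    { carrier := {u | act (oddBr u u) u = 0}
      add_mem' := fun {u v} hu hv => by
        have h1 := jacobiator_eq_zero u u v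
        have h2 := jacobiator_eq_zero u v v
        simp only [jacobiator, oddBr_comm v u] at h1 h2
        simp only [Set.mem_ofPred_eq] at hu hv ⊢
        simp only [map_add, LinearMap.add_apply, oddBr_comm v u]
        linear_combination (norm := module) hu + hv + h1 + h2
      zero_mem' := by simp
      smul_mem' := fun c u hu => by
        simp only [Set.mem_ofPred_eq] at hu ⊢
        simp [hu] }
  have hN : N = ⊤ := by
    refine eq_top_of_basisVec_mem fun a b c _ _ _ => ?_
    change act (oddBr (basisVec k a b c) (basisVec k a b c)) (basisVec k a b c) = 0
    have h : oddBr (basisVec k a b c) (basisVec k a b c) = 0 := by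
      ext i j
      rw [oddBr_apply, basisVec, act_wedge]
      simp only [map_add, map_smul, LinearMap.add_apply, LinearMap.smul_apply, pairing_wedge]
      rw [wedge_rotate _ _ (Matrix.mulVec _ _), wedge_rotate (Pi.single a 1) (Pi.single b 1)
        (Pi.single c 1), pairing_wedge]
      simp
    rw [h, map_zero, LinearMap.zero_apply]
  have : u ∈ N := hN ▸ Submodule.mem_top
  exact this

omit [CharP k 3] in
/-- The superalgebra `gl₆ ⊕ ⋀³`. -/
def model (k : Type*) [Field k] : SuperAlg k (Matrix (Fin 6) (Fin 6) k × Trivec k) where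
  br := LinearMap.mk₂ k
    (fun x y => (x.1 * y.1 - y.1 * x.1 + oddBr x.2 y.2, act x.1 y.2 - act y.1 x.2))
    (fun x x' y => by
      ext1
      · simp only [Prod.fst_add, Prod.snd_add, map_add, LinearMap.add_apply, add_mul, mul_add]; abel
      · simp only [Prod.fst_add, Prod.snd_add, map_add, LinearMap.add_apply]; abel)
    (fun c x y => by ext1 <;> simp [smul_sub])
    (fun x y y' => by
      ext1
      · simp only [Prod.fst_add, Prod.snd_add, map_add, add_mul, mul_add]; abel
      · simp only [Prod.fst_add, Prod.snd_add, map_add, LinearMap.add_apply]; abel)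
    (fun c x y => by ext1 <;> simp [smul_sub])
  gr := (prodSpace k _ _).gr

omit [CharP k 3] in
lemma model_br (x y : Matrix (Fin 6) (Fin 6) k × Trivec k) : (model k).br x y =
    (x.1 * y.1 - y.1 * x.1 + oddBr x.2 y.2, act x.1 y.2 - act y.1 x.2) := rfl

theorem model_isLieSuperalgebra : (model k).IsLieSuperalgebra where
  isCompl := by
    refine IsCompl.of_eq (eq_bot_iff.2 fun x hx => ?_) (eq_top_iff.2 fun x _ => ?_)
    · exact Prod.ext ((prodSpace_one k).1 hx.2) ((prodSpace_zero k).1 hx.1)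
    · rw [← (prodSpace k _ _).proj_add x]
      exact add_mem (Submodule.mem_sup_left ((prodSpace k _ _).proj_mem 0 x))
        (Submodule.mem_sup_right ((prodSpace k _ _).proj_mem 1 x))
  br_mem i j x hx y hy := by
    rcases prodSpace_gr k hx with ⟨rfl, h1⟩ | ⟨rfl, h1⟩ <;>
      rcases prodSpace_gr k hy with ⟨rfl, h2⟩ | ⟨rfl, h2⟩
    · exact (prodSpace_zero k).2 (by simp [model_br, h1, h2])
    · exact (prodSpace_one k).2 (by simp [model_br, h1, h2])
    · exact (prodSpace_one k).2 (by simp [model_br, h1, h2])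
    · exact (prodSpace_zero k).2 (by simp [model_br, h1, h2])
  skew i j x hx y hy := by
    rcases prodSpace_gr k hx with ⟨rfl, h1⟩ | ⟨rfl, h1⟩ <;>
      rcases prodSpace_gr k hy with ⟨rfl, h2⟩ | ⟨rfl, h2⟩ <;>
      simp [model_br, h1, h2, sgn_zero, sgn_one, oddBr_comm y.2 x.2]
  jacobi i j l x hx y hy z hz := by
    rcases prodSpace_gr k hx with ⟨rfl, h1⟩ | ⟨rfl, h1⟩ <;>
      rcases prodSpace_gr k hy with ⟨rfl, h2⟩ | ⟨rfl, h2⟩ <;>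
      rcases prodSpace_gr k hz with ⟨rfl, h3⟩ | ⟨rfl, h3⟩ <;>
      refine Prod.ext ?_ ?_ <;>
      simp only [model_br, h1, h2, h3, map_zero, LinearMap.zero_apply, sub_zero, zero_sub,
        add_zero, zero_add, mul_zero, zero_mul, mul_one, sgn_zero, sgn_one, one_smul, neg_smul,
        Prod.fst_sub, Prod.snd_sub, map_neg, neg_zero, sub_neg_eq_add,
        LinearMap.neg_apply, sub_self]
    · noncomm_ring
    · exact act_comm _ _ _
    · rw [act_comm]; abel
    · rw [oddBr_act]; abel
    · rw [act_comm]; abel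
    · rw [oddBr_act]; abel
    · have h := oddBr_act z.1 x.2 y.2
      rw [oddBr_comm (act z.1 x.2)] at h
      simp only [Prod.fst_add]
      linear_combination (norm := abel) -h
    · simp
    · simp
    · have h := jacobiator_eq_zero x.2 y.2 z.2
      rw [jacobiator, oddBr_comm z.2] at h
      simp only [Prod.snd_add]
      linear_combination (norm := abel) h
  odd_cube x hx := by
    have h1 := (prodSpace_one k).1 hx
    have h2 := act_oddBr_self x.2
    refine Prod.ext ?_ ?_ <;> simp [model_br, h1, h2]

/-! ### Graded subspaces that are stable under the derived algebra -/

lemma basisVec_apply_of_ne {i j b c : Fin 6} (hij : i ≠ j) (hb : i ≠ b) (hc : i ≠ c)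
    (x y : Fin 6) : (basisVec k j b c).1 i x y = 0 := by
  simp [basisVec, wedge_apply, Pi.single_eq_of_ne hij, Pi.single_eq_of_ne hb,
    Pi.single_eq_of_ne hc]

/-- Only the scalar matrices act trivially on all trivectors. -/
lemma eq_smul_one_of_act_eq_zero {Y : Matrix (Fin 6) (Fin 6) k} (h : ∀ u, act Y u = 0) :
    ∃ c : k, Y = c • 1 := by
  have h1 : ∀ i j b c : Fin 6, i ≠ b → i ≠ c → j ≠ b → j ≠ c → b ≠ c →
      Y i j + (if i = j then Y b b + Y c c + Y.trace else 0) = 0 := by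
    intro i j b c hib hic hjb hjc hbc
    have h2 := congrFun (congrFun (congrFun (congrArg Subtype.val (h (basisVec k j b c))) i) b) c
    rw [act_apply] at h2
    have e1 : ∀ l, (basisVec k j b c).1 l b c = if l = j then 1 else 0 := by
      intro l
      simp [basisVec, wedge_apply, Pi.single_apply, hbc, hbc.symm, hjb.symm, hjc.symm]
    by_cases hij : i = j
    · subst hij
      have e2 : ∀ l, (basisVec k i b c).1 i l c = if l = b then 1 else 0 := by
        intro l
        simp [basisVec, wedge_apply, Pi.single_apply, hib, hic, hbc.symm, hic.symm]
      have e3 : ∀ l, (basisVec k i b c).1 i b l = if l = c then 1 else 0 := by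
        intro l
        simp [basisVec, wedge_apply, Pi.single_apply, hib, hic, hbc, hib.symm]
      simp only [e1, e2, e3, mul_ite, mul_one, mul_zero, Finset.sum_ite_eq', Finset.mem_univ,
        if_true] at h2 ⊢
      simpa [add_assoc] using h2
    · simpa [e1, basisVec_apply_of_ne hij hib hic, hij] using h2
  have h3 : ∀ i j, i ≠ j → Y i j = 0 := by
    intro i j hij
    obtain ⟨b, c, hb⟩ : ∃ b c : Fin 6, i ≠ b ∧ i ≠ c ∧ j ≠ b ∧ j ≠ c ∧ b ≠ c := by
      decide +revert
    simpa [hij] using h1 i j b c hb.1 hb.2.1 hb.2.2.1 hb.2.2.2.1 hb.2.2.2.2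
  have h4 : ∀ i, Y i i = Y 0 0 := by
    intro i
    obtain ⟨b, c, hb⟩ : ∃ b c : Fin 6, i ≠ b ∧ i ≠ c ∧ 0 ≠ b ∧ 0 ≠ c ∧ b ≠ c := by
      decide +revert
    have e1 := h1 i i b c hb.1 hb.2.1 hb.1 hb.2.1 hb.2.2.2.2
    have e2 := h1 0 0 b c hb.2.2.1 hb.2.2.2.1 hb.2.2.1 hb.2.2.2.1 hb.2.2.2.2
    simp only [if_true] at e1 e2
    linear_combination e1 - e2
  refine ⟨Y 0 0, ?_⟩
  ext i j
  by_cases hij : i = j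
  · subst hij; simp [h4 i]
  · simp [h3 i j hij, hij]

lemma pairing_nondegenerate {u : Trivec k} (h : ∀ v, pairing u v = 0) : u = 0 := by
  by_contra h0
  let N : Submodule k (Trivec k) := LinearMap.ker pairing
  have hN : N = ⊤ := by
    refine trivec_irreducible (N := N) (fun i j _ w hw => ?_) (u := u)
      (LinearMap.ext h) h0
    refine LinearMap.ext fun v => ?_
    have := pairing_act (Matrix.single i j 1) w v
    rw [show pairing w = 0 from hw, LinearMap.zero_apply, add_zero] at this
    exact this
  have h1 : pairing (basisVec k 0 1 2) = 0 := by
    have : basisVec k 0 1 2 ∈ N := hN ▸ Submodule.mem_top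
    exact this
  have h2 := pairing_basisVec (basisVec k 3 4 5)
  rw [h1, basisVec_apply (by decide) (by decide) (by decide) (by decide)] at h2
  simp at h2

/-- The matrices `[u, v]` span `sl₆`: a linear form that vanishes on them is given by a matrix
which acts trivially on all trivectors, and is a multiple of the trace. -/
lemma mem_of_oddBr_mem {J : Submodule k (Matrix (Fin 6) (Fin 6) k)}
    (h : ∀ u v, oddBr u v ∈ J) {X : Matrix (Fin 6) (Fin 6) k} (hX : X.trace = 0) : X ∈ J := by
  by_contra hXJ
  obtain ⟨f, hf, hJ⟩ := Submodule.exists_le_ker_of_notMem hXJ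
  have e : ∀ Z, f Z = (Z * Matrix.of fun i j => f (Matrix.single j i 1)).trace := by
    intro Z
    conv_lhs => rw [Matrix.matrix_eq_sum_single Z]
    simp only [Matrix.trace, Matrix.diag, Matrix.mul_apply, map_sum, Matrix.of_apply]
    refine Finset.sum_congr rfl fun i _ => Finset.sum_congr rfl fun j _ => ?_
    rw [show Matrix.single i j (Z i j) = Z i j • Matrix.single i j (1 : k) by simp, map_smul,
      smul_eq_mul]
  obtain ⟨c, hc⟩ := eq_smul_one_of_act_eq_zero
    (Y := Matrix.of fun i j => f (Matrix.single j i 1)) fun u => pairing_nondegenerate fun v => by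
      rw [← trace_oddBr_mul, ← e]
      exact hJ (h u v)
  rw [e X, hc] at hf
  simp [hX] at hf

omit [CharP k 3] in
lemma iSup_parity {M : Type*} [AddCommGroup M] [Module k M] (f : ZMod 2 → Submodule k M) :
    ⨆ i, f i = f 0 ⊔ f 1 := by
  refine le_antisymm (iSup_le fun i => ?_) (sup_le (le_iSup f 0) (le_iSup f 1))
  rcases parity_cases i with rfl | rfl
  · exact le_sup_left
  · exact le_sup_right

/-- A graded subspace that is stable under `sl₆ ⊕ ⋀³` consists of scalar matrices, or contains
`sl₆ ⊕ ⋀³`. -/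
theorem model_stable {J : Submodule k (Matrix (Fin 6) (Fin 6) k × Trivec k)}
    (hJ : SuperAlg.IsHomogeneous (model k).gr J)
    (h : ∀ d : Matrix (Fin 6) (Fin 6) k × Trivec k, d.1.trace = 0 → ∀ x ∈ J, (model k).br d x ∈ J) :
    (∀ x ∈ J, ∃ c : k, x = (c • 1, 0)) ∨ ∀ x : Matrix (Fin 6) (Fin 6) k × Trivec k,
      x.1.trace = 0 → x ∈ J := by
  have hs : ∀ x ∈ J, (x.1, 0) ∈ J ∧ (0, x.2) ∈ J := by
    intro x hx
    have h1 := hJ hx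
    rw [iSup_parity] at h1
    obtain ⟨y, hy, z, hz, rfl⟩ := Submodule.mem_sup.1 h1
    have h2 : y.2 = 0 := (prodSpace_zero k).1 hy.2
    have h3 : z.1 = 0 := (prodSpace_one k).1 hz.2
    constructor
    · rw [show ((y + z).1, (0 : Trivec k)) = y from Prod.ext (by simp [h3]) (by simp [h2])]
      exact hy.1
    · rw [show ((0 : Matrix (Fin 6) (Fin 6) k), (y + z).2) = z from
        Prod.ext (by simp [h3]) (by simp [h2])]
      exact hz.1
  by_cases h0 : ∃ x ∈ J, x.2 ≠ 0
  · right
    obtain ⟨x, hx, hx0⟩ := h0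
    have h1 : J.comap (LinearMap.inr k _ _) = ⊤ := by
      refine trivec_irreducible (fun i j hij u hu => ?_) (u := x.2) (hs x hx).2 hx0
      have := h (Matrix.single i j 1, 0) (Matrix.trace_single_eq_of_ne _ _ _ hij) _ hu
      simpa [model_br] using this
    have h2 : ∀ u : Trivec k, ((0, u) : Matrix (Fin 6) (Fin 6) k × Trivec k) ∈ J := by
      intro u
      have : u ∈ J.comap (LinearMap.inr k (Matrix (Fin 6) (Fin 6) k) (Trivec k)) :=
        h1 ▸ Submodule.mem_top
      exact this
    intro y hy
    have h3 : y.1 ∈ J.comap (LinearMap.inl k _ (Trivec k)) := by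
      refine mem_of_oddBr_mem (fun u v => ?_) hy
      have := h (0, u) (by simp) _ (h2 v)
      simpa [model_br] using this
    have := add_mem (Submodule.mem_comap.1 h3) (h2 y.2)
    simpa using this
  · left
    push Not at h0
    intro x hx
    obtain ⟨c, hc⟩ := eq_smul_one_of_act_eq_zero (Y := x.1) fun u => by
      have := h0 _ (h (0, u) (by simp) _ (hs x hx).1)
      simpa [model_br] using this
    exact ⟨c, Prod.ext hc (h0 x hx)⟩

lemma trace_model_br (x y : Matrix (Fin 6) (Fin 6) k × Trivec k) :
    ((model k).br x y).1.trace = 0 := by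
  simp [model_br, trace_oddBr, Matrix.trace_mul_comm x.1]

theorem mem_derived_model {x : Matrix (Fin 6) (Fin 6) k × Trivec k} :
    x ∈ (model k).derived ↔ x.1.trace = 0 := by
  constructor
  · intro hx
    have h : (model k).derived ≤ LinearMap.ker
        (Matrix.traceLinearMap (Fin 6) k k ∘ₗ LinearMap.fst k _ (Trivec k)) :=
      Submodule.span_le.2 fun z ⟨x, y, hz⟩ => hz ▸ trace_model_br x y
    exact h hx
  · have hg : SuperAlg.IsHomogeneous (model k).gr (model k).derived := by
      refine Submodule.span_le.2 ?_
      rintro z ⟨x, y, rfl⟩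
      rw [iSup_parity, SetLike.mem_coe, Submodule.mem_sup]
      refine ⟨(model k).br (x.1, 0) (y.1, 0) + (model k).br (0, x.2) (0, y.2),
        ⟨add_mem (Submodule.subset_span ⟨_, _, rfl⟩) (Submodule.subset_span ⟨_, _, rfl⟩),
          (prodSpace_zero k).2 (by simp [model_br])⟩,
        (model k).br (x.1, 0) (0, y.2) + (model k).br (0, x.2) (y.1, 0),
        ⟨add_mem (Submodule.subset_span ⟨_, _, rfl⟩) (Submodule.subset_span ⟨_, _, rfl⟩),
          (prodSpace_one k).2 (by simp [model_br])⟩, ?_⟩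
      ext1
      · simp [model_br]
      · simp [model_br]; abel
    rcases model_stable hg fun d _ x _ => Submodule.subset_span ⟨d, x, rfl⟩ with h | h
    · exfalso
      obtain ⟨c, hc⟩ := h _ (Submodule.subset_span
        ⟨(Matrix.single 0 3 1, 0), (0, basisVec k 3 1 2), rfl⟩)
      have h1 := congrArg Prod.snd hc
      rw [model_br] at h1
      simp only [map_zero, sub_zero] at h1
      rw [act_single_basisVec (by decide) (by decide) (by decide)] at h1
      have h2 := congrFun (congrFun (congrFun (congrArg Subtype.val h1) 0) 1) 2
      rw [basisVec_apply (by decide) (by decide) (by decide) (by decide)] at h2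
      simp at h2
    · exact h x

end Model

/-! ### The product of `g(S₂, S₄,₂)` in coordinates -/

section Homogeneous

variable {k S S' : Type*} [Field k] [AddCommGroup S] [Module k S] [AddCommGroup S'] [Module k S']

lemma sum_parity {M : Type*} [AddCommMonoid M] (f : ZMod 2 → M) : ∑ i, f i = f 0 + f 1 :=
  Fin.sum_univ_two f

lemma theta_pow_apply (i n : Fin 3)
    (d : Fin 3 → Module.End k S) : (SymComp.theta k S ^ i.val) d n = d (n - i) := by
  fin_cases i
  · simp
  · simp [SymComp.theta, LinearMap.funLeft]
  · simp only [pow_two, SymComp.theta, LinearMap.funLeft, Module.End.mul_apply, LinearMap.coe_mk,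
      AddHom.coe_mk, Function.comp]
    congr 1
    fin_cases n <;> rfl

variable (C : SymComp k S) (C' : SymComp k S')

/-- Homogeneous elements of the ambient space. -/
def IsHomog (i : ZMod 2) (u : Amb k S S') : Prop :=
  ∀ j, ambProj C C' j u = if j = i then u else 0

variable {C C'}

lemma ambBr_of_isHomog {i j : ZMod 2} {u w : Amb k S S'} (hu : IsHomog C C' i u)
    (hw : IsHomog C C' j w) : ambBr C C' u w = diagBr C C' u w
      + (halfBr C C' u w - sgn k (i * j) • halfBr C C' w u) := by
  simp only [ambBr, sum_parity, LinearMap.sub_apply, LinearMap.add_apply, LinearMap.smul_apply,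
    LinearMap.compl₁₂_apply, LinearMap.flip_apply, hu _, hw _]
  rcases parity_cases i with rfl | rfl <;> rcases parity_cases j with rfl | rfl <;>
    simp [add_sub_assoc]

variable (C C')

lemma diagBr_fst (u w : Amb k S S') (n : Fin 3) : (diagBr C C' u w).1 n =
    C.superComm (u.1 n) (w.1 n) + ∑ l, tensorT C C' (u.2.2 l) (w.2.2 l) (n - l) := by
  simp [diagBr, SymComp.tripleComm, theta_pow_apply]

lemma diagBr_snd (u w : Amb k S S') (n : Fin 3) : (diagBr C C' u w).2.1 n =
    C'.superComm (u.2.1 n) (w.2.1 n) + ∑ l, tensorT' C C' (u.2.2 l) (w.2.2 l) (n - l) := by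
  simp [diagBr, SymComp.tripleComm, theta_pow_apply]

end Homogeneous

section Coordinates

variable {k : Type*} [Field k] [CharP k 3]

/-- The endomorphism `diag(1, -1)` of `S₂`. -/
def diagEnd (k : Type*) [Field k] : Module.End k (Fin 2 → k) :=
  Matrix.toLin' !![1, 0; 0, -1]

omit [CharP k 3] in
lemma diagEnd_apply (x : Fin 2 → k) : diagEnd k x = ![x 0, -x 1] := by
  ext i; fin_cases i <;> simp [diagEnd, Matrix.vecHead, Matrix.vecTail]

/-- The element of the ambient space with components `a n • diag(1, -1)`, `d n` and
`e⁺ ⊗ p n + e⁻ ⊗ m n`. -/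
def amb (a : Fin 3 → k) (d : Fin 3 → Module.End k (B42 k)) (p m : Fin 3 → B42 k) :
    Amb k (Fin 2 → k) (B42 k) :=
  (fun n => a n • diagEnd k, d, fun n => ![1, 0] ⊗ₜ p n + ![0, 1] ⊗ₜ m n)

lemma signedMap₂_S2 {P P' : Type*} [AddCommGroup P] [Module k P] [AddCommGroup P'] [Module k P']
    {s : ZMod 2 → ZMod 2 → ZMod 2 → ZMod 2 → k} (hs : ∀ a' c', s 0 a' 0 c' = 1)
    (B : (Fin 2 → k) →ₗ[k] (Fin 2 → k) →ₗ[k] P) (B' : B42 k →ₗ[k] B42 k →ₗ[k] P')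
    (x y : Fin 2 → k) (x' y' : B42 k) :
    (S2 k).signedMap₂ (S42 k).toSuperSpace s B B' (x ⊗ₜ x') (y ⊗ₜ y') = B x y ⊗ₜ B' x' y' := by
  have h0 : (S2 k).proj 0 = LinearMap.id := rfl
  have h1 : (S2 k).proj 1 = 0 := rfl
  simp only [SuperSpace.signedMap₂, sum_parity, h0, h1, hs, one_smul, LinearMap.add_apply,
    LinearMap.smul_apply, LinearMap.compl₁₂_apply, TensorProduct.map_tmul, LinearMap.zero_apply,
    TensorProduct.zero_tmul, map_zero, smul_zero, add_zero, LinearMap.id_apply,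
    TensorProduct.map₂_apply_tmul]
  conv_rhs => rw [← (S42 k).proj_add x', ← (S42 k).proj_add y']
  simp only [map_add, LinearMap.add_apply, TensorProduct.tmul_add]
  abel

lemma tensorMul_S2 (x y : Fin 2 → k) (x' y' : B42 k) :
    tensorMul (S2 k) (S42 k) (x ⊗ₜ x') (y ⊗ₜ y') = (S2 k).mul x y ⊗ₜ (S42 k).mul x' y' :=
  signedMap₂_S2 (fun _ _ => by simp [sgn]) _ _ _ _ _ _

lemma tensorT_S2 (x y : Fin 2 → k) (x' y' : B42 k) :
    tensorT (S2 k) (S42 k) (x ⊗ₜ x') (y ⊗ₜ y') = (S42 k).b x' y' • (S2 k).t x y := by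
  rw [tensorT, LinearMap.compr₂_apply, signedMap₂_S2 (fun _ _ => by simp [sgn])]
  simp

lemma tensorT'_S2 (x y : Fin 2 → k) (x' y' : B42 k) :
    tensorT' (S2 k) (S42 k) (x ⊗ₜ x') (y ⊗ₜ y') = (S2 k).b x y • (S42 k).t x' y' := by
  rw [tensorT', LinearMap.compr₂_apply, signedMap₂_S2 (fun _ _ => by simp [sgn])]
  simp

lemma endProj_add_S42 (d : Module.End k (B42 k)) :
    (S42 k).endProj 0 d + (S42 k).endProj 1 d = d := by
  refine LinearMap.ext fun x => ?_
  simp only [SuperSpace.endProj, LinearMap.coe_mk, AddHom.coe_mk, sum_parity, LinearMap.add_apply,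
    LinearMap.comp_apply, zero_add, add_zero, one_add_one_parity]
  have h0 := (S42 k).proj_add (d ((S42 k).proj 0 x))
  have h1 := (S42 k).proj_add (d ((S42 k).proj 1 x))
  have h := congrArg d ((S42 k).proj_add x)
  rw [map_add] at h
  linear_combination (norm := abel) h0 + h1 + h

lemma tensorAct'_S2 (d : Module.End k (B42 k)) (x : Fin 2 → k) (x' : B42 k) :
    tensorAct' (S2 k) (S42 k) d (x ⊗ₜ x') = x ⊗ₜ d x' := by
  have h0 : (S2 k).proj 0 = LinearMap.id := rfl
  have h1 : (S2 k).proj 1 = 0 := rfl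
  simp only [tensorAct', sum_parity, h0, h1, mul_zero, zero_mul, sgn_zero, one_smul,
    LinearMap.add_apply, LinearMap.smul_apply, TensorProduct.map_tmul, LinearMap.zero_apply,
    TensorProduct.zero_tmul, smul_zero, add_zero, LinearMap.id_apply, ← TensorProduct.tmul_add]
  rw [← LinearMap.add_apply, endProj_add_S42]

lemma halfBr_amb (a a' : Fin 3 → k) (d d' : Fin 3 → Module.End k (B42 k))
    (p m p' m' : Fin 3 → B42 k) :
    halfBr (S2 k) (S42 k) (amb a d p m) (amb a' d' p' m') = amb 0 0
      (fun n => a n • p' n + d n (p' n) + (S42 k).mul (m (n + 1)) (m' (n + 2)))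
      (fun n => -a n • m' n + d n (m' n) + (S42 k).mul (p (n + 1)) (p' (n + 2))) := by
  have e1 : (S2 k).mul ![1, 0] ![1, 0] = ![0, 1] := by ext i; fin_cases i <;> simp [S2]
  have e2 : (S2 k).mul ![1, 0] ![0, 1] = 0 := by ext i; fin_cases i <;> simp [S2]
  have e3 : (S2 k).mul ![0, 1] ![1, 0] = 0 := by ext i; fin_cases i <;> simp [S2]
  have e4 : (S2 k).mul ![0, 1] ![0, 1] = ![1, 0] := by ext i; fin_cases i <;> simp [S2]
  have e5 : diagEnd k ![0, 1] = -![0, 1] := by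
    rw [diagEnd_apply]; ext i; fin_cases i <;> simp
  have e6 : diagEnd k ![1, 0] = ![1, 0] := by
    rw [diagEnd_apply]; ext i; fin_cases i <;> simp
  refine Prod.ext ?_ (Prod.ext ?_ ?_)
  · funext n; simp [halfBr, amb]
  · funext n; simp [halfBr, amb]
  · funext n
    simp only [halfBr, amb, LinearMap.mk₂_apply, map_add, TensorProduct.map_tmul,
      LinearMap.add_apply, LinearMap.smul_apply, LinearMap.id_apply, tensorAct'_S2, tensorMul_S2,
      e1, e2, e3, e4, e5, e6, TensorProduct.zero_tmul, TensorProduct.tmul_add, add_zero, zero_add]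
    simp only [smul_neg, TensorProduct.neg_tmul, TensorProduct.smul_tmul, neg_smul,
      TensorProduct.tmul_neg]
    abel

lemma diagEnd_mem (k : Type*) [Field k] (l : ZMod 2) (x : Fin 2 → k) (hx : x ∈ (S2 k).gr l) :
    diagEnd k x ∈ (S2 k).gr (0 + l) := by
  rcases evenSpace_one k hx with rfl | rfl
  · exact ⟨diagEnd k x, rfl⟩
  · rw [map_zero]; exact zero_mem _

/-- `d` maps the component of parity `j` to that of parity `i + j`. -/
def HasParity (i : ZMod 2) (d : Module.End k (B42 k)) : Prop :=
  ∀ j, ∀ x ∈ (S42 k).gr j, d x ∈ (S42 k).gr (i + j)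

lemma isHomog_amb {i : ZMod 2} {a : Fin 3 → k} {d : Fin 3 → Module.End k (B42 k)}
    {p m : Fin 3 → B42 k} (ha : i = 1 → a = 0) (hd : ∀ n, HasParity i (d n))
    (hp : ∀ n, p n ∈ (S42 k).gr i) (hm : ∀ n, m n ∈ (S42 k).gr i) :
    IsHomog (S2 k) (S42 k) i (amb a d p m) := by
  have h0 : (S2 k).proj 0 = LinearMap.id := rfl
  have h1 : (S2 k).proj 1 = 0 := rfl
  intro j
  refine Prod.ext ?_ (Prod.ext ?_ ?_)
  · funext n
    change (S2 k).endProj j (a n • diagEnd k) = _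
    rw [map_smul, SymComp.endProj_of_mem _ (diagEnd_mem k)]
    rcases parity_cases i with rfl | rfl
    · split_ifs <;> simp [amb]
    · rw [ha rfl]; split_ifs <;> simp [amb]
  · funext n
    change (S42 k).endProj j (d n) = _
    rw [SymComp.endProj_of_mem _ (hd n)]
    split_ifs <;> simp [amb]
  · funext n
    change (S2 k).tensorProj (S42 k).toSuperSpace j (_ ⊗ₜ p n + _ ⊗ₜ m n) = _
    simp only [SuperSpace.tensorProj, sum_parity, h0, h1, LinearMap.add_apply, map_add,
      TensorProduct.map_tmul, LinearMap.zero_apply, TensorProduct.zero_tmul, sub_zero, add_zero,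
      LinearMap.id_apply, (S42 k).proj_of_mem (hp n), (S42 k).proj_of_mem (hm n)]
    split_ifs <;> simp [amb]

lemma inv_two : (2 : k)⁻¹ = -1 := by
  rw [inv_eq_iff_eq_inv, inv_neg, inv_one]
  linear_combination three_eq_zero (k := k)

/-- In characteristic `3` the three components of `t_{e⁺,e⁻}` are equal. -/
lemma t_S2 : (S2 k).t ![1, 0] ![1, 0] = 0 ∧ (S2 k).t ![0, 1] ![0, 1] = 0 ∧
    (S2 k).t ![1, 0] ![0, 1] = (fun _ => -diagEnd k) ∧
    (S2 k).t ![0, 1] ![1, 0] = (fun _ => diagEnd k) := by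
  have hm : ∀ x : Fin 2 → k, x ∈ (S2 k).gr 0 := fun x => ⟨x, rfl⟩
  have h0 : ∀ x y z : Fin 2 → k, (S2 k).t x y 0 z = (S2 k).b x z • y - (S2 k).b y z • x := by
    intro x y z
    rw [show (S2 k).t x y 0 = (S2 k).sigma x y from rfl,
      (S2 k).sigma_of_mem (hm x) (hm y) (hm z)]
    simp [sgn_zero]
  have h1 : ∀ x y z : Fin 2 → k, (S2 k).t x y 1 z =
      (-(S2 k).b x y) • z - (S2 k).mul ((S2 k).mul y z) x := by
    intro x y z
    have := (S2 k).rmul_of_mem (hm x) (hm ((S2 k).mul y z))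
    simp only [mul_zero, sgn_zero, one_smul] at this
    rw [← this]
    change ((2 : k)⁻¹ * (S2 k).b x y) • z - _ = _
    rw [inv_two, neg_one_mul]; rfl
  have h2 : ∀ x y z : Fin 2 → k, (S2 k).t x y 2 z =
      (-(S2 k).b x y) • z - (S2 k).mul x ((S2 k).mul z y) := by
    intro x y z
    have := (S2 k).rmul_of_mem (hm y) (hm z)
    simp only [mul_zero, sgn_zero, one_smul] at this
    rw [← this]
    change ((2 : k)⁻¹ * (S2 k).b x y) • z - _ = _
    rw [inv_two, neg_one_mul]; rfl
  refine ⟨?_, ?_, ?_, ?_⟩ <;> funext n <;> refine LinearMap.ext fun z => ?_ <;>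
    fin_cases n <;>
    simp only [h0, h1, h2, diagEnd_apply, LinearMap.neg_apply, Fin.zero_eta, Fin.mk_one,
      Fin.reduceFinMk, Pi.zero_apply, LinearMap.zero_apply] <;>
    ext i <;> fin_cases i <;> simp [S2] <;>
    first
    | linear_combination (-z 0) * three_eq_zero (k := k)
    | linear_combination (-z 1) * three_eq_zero (k := k)

lemma diagBr_amb {i j : ZMod 2} (a a' : Fin 3 → k) {d d' : Fin 3 → Module.End k (B42 k)}
    (hd : ∀ n, HasParity i (d n)) (hd' : ∀ n, HasParity j (d' n)) (p m p' m' : Fin 3 → B42 k) :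
    diagBr (S2 k) (S42 k) (amb a d p m) (amb a' d' p' m') = amb
      (fun _ => ∑ l, ((S42 k).b (m l) (p' l) - (S42 k).b (p l) (m' l)))
      (fun n => d n * d' n - sgn k (i * j) • (d' n * d n)
        + ∑ l, ((S42 k).t (p l) (m' l) (n - l) + (S42 k).t (m l) (p' l) (n - l))) 0 0 := by
  have e1 : (S2 k).b ![1, 0] ![1, 0] = 0 := by simp [S2]
  have e2 : (S2 k).b ![1, 0] ![0, 1] = 1 := by simp [S2]
  have e3 : (S2 k).b ![0, 1] ![1, 0] = 1 := by simp [S2]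
  have e4 : (S2 k).b ![0, 1] ![0, 1] = 0 := by simp [S2]
  obtain ⟨t1, t2, t3, t4⟩ := t_S2 (k := k)
  have hc : (S2 k).superComm (diagEnd k) (diagEnd k) = 0 := by
    rw [SymComp.superComm_of_mem (S2 k).toSuperSpace (i := 0) (j := 0) (diagEnd_mem k)
      (diagEnd_mem k)]
    simp [sgn_zero]
  have hs : ∀ n, (S42 k).superComm (d n) (d' n) =
      d n * d' n - sgn k (i * j) • (d' n * d n) := fun n =>
    SymComp.superComm_of_mem (S42 k).toSuperSpace (hd n) (hd' n)
  refine Prod.ext ?_ (Prod.ext ?_ ?_)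
  · funext n
    rw [diagBr_fst]
    have h1 : (S2 k).superComm (a n • diagEnd k) (a' n • diagEnd k) = 0 := by
      rw [map_smul, map_smul, LinearMap.smul_apply, hc, smul_zero, smul_zero]
    refine (congrArg (· + _) h1).trans ((zero_add _).trans ?_)
    refine Eq.trans ?_ (Finset.sum_smul).symm
    refine Finset.sum_congr rfl fun l _ => ?_
    simp only [amb, map_add, LinearMap.add_apply, tensorT_S2, t1, t2, t3, t4, smul_zero,
      Pi.smul_apply, Pi.add_apply, Pi.zero_apply]
    module
  · funext n
    rw [diagBr_snd]
    refine congrArg₂ (· + ·) (hs n) (Finset.sum_congr rfl fun l _ => ?_)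
    simp only [amb, map_add, LinearMap.add_apply, tensorT'_S2, e1, e2, e3, e4, zero_smul,
      one_smul, zero_add, add_zero, Pi.add_apply]
    exact add_comm _ _
  · funext n; simp [diagBr, amb]

omit [CharP k 3] in
lemma amb_add (a a' : Fin 3 → k) (d d' : Fin 3 → Module.End k (B42 k))
    (p m p' m' : Fin 3 → B42 k) :
    amb a d p m + amb a' d' p' m' = amb (a + a') (d + d') (p + p') (m + m') := by
  refine Prod.ext ?_ (Prod.ext rfl ?_)
  · funext n; simp [amb, add_smul]
  · funext n; simp only [amb, Prod.snd_add, Pi.add_apply, TensorProduct.tmul_add]; abel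

omit [CharP k 3] in
lemma amb_sub (a a' : Fin 3 → k) (d d' : Fin 3 → Module.End k (B42 k))
    (p m p' m' : Fin 3 → B42 k) :
    amb a d p m - amb a' d' p' m' = amb (a - a') (d - d') (p - p') (m - m') := by
  refine Prod.ext ?_ (Prod.ext rfl ?_)
  · funext n; exact (sub_smul _ _ _).symm
  · funext n; simp only [amb, Prod.snd_sub, Pi.sub_apply, TensorProduct.tmul_sub]; abel

omit [CharP k 3] in
lemma amb_smul (c : k) (a : Fin 3 → k) (d : Fin 3 → Module.End k (B42 k)) (p m : Fin 3 → B42 k) :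
    c • amb a d p m = amb (c • a) (c • d) (c • p) (c • m) := by
  refine Prod.ext ?_ (Prod.ext rfl ?_)
  · funext n; simp [amb, mul_smul]
  · funext n; simp [amb]

/-- The product of homogeneous elements in coordinates. -/
theorem ambBr_amb {i j : ZMod 2} {a a' : Fin 3 → k} {d d' : Fin 3 → Module.End k (B42 k)}
    {p m p' m' : Fin 3 → B42 k} (ha : i = 1 → a = 0) (hd : ∀ n, HasParity i (d n))
    (hp : ∀ n, p n ∈ (S42 k).gr i) (hm : ∀ n, m n ∈ (S42 k).gr i) (ha' : j = 1 → a' = 0)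
    (hd' : ∀ n, HasParity j (d' n)) (hp' : ∀ n, p' n ∈ (S42 k).gr j)
    (hm' : ∀ n, m' n ∈ (S42 k).gr j) :
    ambBr (S2 k) (S42 k) (amb a d p m) (amb a' d' p' m') = amb
      (fun _ => ∑ l, ((S42 k).b (m l) (p' l) - (S42 k).b (p l) (m' l)))
      (fun n => d n * d' n - sgn k (i * j) • (d' n * d n)
        + ∑ l, ((S42 k).t (p l) (m' l) (n - l) + (S42 k).t (m l) (p' l) (n - l)))
      (fun n => a n • p' n + d n (p' n) + (S42 k).mul (m (n + 1)) (m' (n + 2))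
        - sgn k (i * j) • (a' n • p n + d' n (p n) + (S42 k).mul (m' (n + 1)) (m (n + 2))))
      (fun n => -a n • m' n + d n (m' n) + (S42 k).mul (p (n + 1)) (p' (n + 2))
        - sgn k (i * j) • (-a' n • m n + d' n (m n) + (S42 k).mul (p' (n + 1)) (p (n + 2)))) := by
  rw [ambBr_of_isHomog (isHomog_amb ha hd hp hm) (isHomog_amb ha' hd' hp' hm'),
    diagBr_amb a a' hd hd', halfBr_amb, halfBr_amb, amb_smul, amb_sub, amb_add]
  congr 1
  · simp
  · simp
  · funext n
    simp
  · funext n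
    simp

end Coordinates

/-! ### Coordinates of the model adapted to `k⁶ = V ⊕ V ⊕ V` -/

section Blocks

variable {k : Type*} [Field k]

/-- The index of the basis vector number `a` of the `i`-th summand of `k⁶ = V ⊕ V ⊕ V`. -/
def ix (i : Fin 3) (a : Fin 2) : Fin 6 := ![![0, 1], ![2, 3], ![4, 5]] i a

/-- The `2 × 2` blocks of a matrix. -/
def blk (X : Matrix (Fin 6) (Fin 6) k) (i j : Fin 3) : Matrix (Fin 2) (Fin 2) k :=
  !![X (ix i 0) (ix j 0), X (ix i 0) (ix j 1); X (ix i 1) (ix j 0), X (ix i 1) (ix j 1)]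

/-- In characteristic `3` the traceless part of `f` is `f + tr f`. -/
def traceless (f : Matrix (Fin 2) (Fin 2) k) : Matrix (Fin 2) (Fin 2) k :=
  !![f 1 1 - f 0 0, f 0 1; f 1 0, f 0 0 - f 1 1]

omit [Field k] in
lemma B42_ext {x y : B42 k} (h₁ : x.1 0 0 = y.1 0 0) (h₂ : x.1 0 1 = y.1 0 1)
    (h₃ : x.1 1 0 = y.1 1 0) (h₄ : x.1 1 1 = y.1 1 1) (h₅ : x.2 0 = y.2 0)
    (h₆ : x.2 1 = y.2 1) : x = y := by
  refine Prod.ext ?_ ?_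
  · ext i j; fin_cases i <;> fin_cases j <;> assumption
  · ext i; fin_cases i <;> assumption

/-- The endomorphism `(f, v) ↦ (B f - f C, A v)` of `B(4,2)`. -/
def evenEnd (A B C : Matrix (Fin 2) (Fin 2) k) : Module.End k (B42 k) where
  toFun x := (!![B 0 0 * x.1 0 0 + B 0 1 * x.1 1 0 - (x.1 0 0 * C 0 0 + x.1 0 1 * C 1 0),
      B 0 0 * x.1 0 1 + B 0 1 * x.1 1 1 - (x.1 0 0 * C 0 1 + x.1 0 1 * C 1 1);
      B 1 0 * x.1 0 0 + B 1 1 * x.1 1 0 - (x.1 1 0 * C 0 0 + x.1 1 1 * C 1 0),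
      B 1 0 * x.1 0 1 + B 1 1 * x.1 1 1 - (x.1 1 0 * C 0 1 + x.1 1 1 * C 1 1)],
    ![A 0 0 * x.2 0 + A 0 1 * x.2 1, A 1 0 * x.2 0 + A 1 1 * x.2 1])
  map_add' x y := by
    ext i j <;> fin_cases i <;> try fin_cases j
    all_goals simp; ring
  map_smul' c x := by
    ext i j <;> fin_cases i <;> try fin_cases j
    all_goals simp; ring

/-- The odd endomorphism of `B(4,2) = End V ⊕ V` given by a tensor in `V ⊗ V ⊗ V`. It sends `v` to
the contraction of the tensor with `v` in the first factor, read as an element of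
`V ⊗ V = End V`, and its values on `End V` are those which make it orthosymplectic. -/
def oddEnd (W : Fin 2 → Fin 2 → Fin 2 → k) : Module.End k (B42 k) where
  toFun x := (!![x.2 0 * W 1 1 0 - x.2 1 * W 0 1 0, x.2 1 * W 0 0 0 - x.2 0 * W 1 0 0;
      x.2 0 * W 1 1 1 - x.2 1 * W 0 1 1, x.2 1 * W 0 0 1 - x.2 0 * W 1 0 1],
    ![x.1 1 1 * W 0 1 0 + x.1 1 0 * W 0 0 0 - x.1 0 0 * W 0 0 1 - x.1 0 1 * W 0 1 1,
      x.1 1 1 * W 1 1 0 + x.1 1 0 * W 1 0 0 - x.1 0 0 * W 1 0 1 - x.1 0 1 * W 1 1 1])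
  map_add' x y := by
    ext i j <;> fin_cases i <;> try fin_cases j
    all_goals simp; ring
  map_smul' c x := by
    ext i j <;> fin_cases i <;> try fin_cases j
    all_goals simp; ring

lemma evenEnd_apply (A B C : Matrix (Fin 2) (Fin 2) k) (x : B42 k) : evenEnd A B C x =
    (!![B 0 0 * x.1 0 0 + B 0 1 * x.1 1 0 - (x.1 0 0 * C 0 0 + x.1 0 1 * C 1 0),
      B 0 0 * x.1 0 1 + B 0 1 * x.1 1 1 - (x.1 0 0 * C 0 1 + x.1 0 1 * C 1 1);
      B 1 0 * x.1 0 0 + B 1 1 * x.1 1 0 - (x.1 1 0 * C 0 0 + x.1 1 1 * C 1 0),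
      B 1 0 * x.1 0 1 + B 1 1 * x.1 1 1 - (x.1 1 0 * C 0 1 + x.1 1 1 * C 1 1)],
    ![A 0 0 * x.2 0 + A 0 1 * x.2 1, A 1 0 * x.2 0 + A 1 1 * x.2 1]) := rfl

lemma oddEnd_apply (W : Fin 2 → Fin 2 → Fin 2 → k) (x : B42 k) : oddEnd W x =
    (!![x.2 0 * W 1 1 0 - x.2 1 * W 0 1 0, x.2 1 * W 0 0 0 - x.2 0 * W 1 0 0;
      x.2 0 * W 1 1 1 - x.2 1 * W 0 1 1, x.2 1 * W 0 0 1 - x.2 0 * W 1 0 1],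
    ![x.1 1 1 * W 0 1 0 + x.1 1 0 * W 0 0 0 - x.1 0 0 * W 0 0 1 - x.1 0 1 * W 0 1 1,
      x.1 1 1 * W 1 1 0 + x.1 1 0 * W 1 0 0 - x.1 0 0 * W 1 0 1 - x.1 0 1 * W 1 1 1]) := rfl

/-- The coordinates on `tri(S₂)` of an even element of the model. -/
def evA (X : Matrix (Fin 6) (Fin 6) k) (n : Fin 3) : k :=
  X (ix (n + 1) 0) (ix (n + 1) 0) + X (ix (n + 1) 1) (ix (n + 1) 1)
    - (X (ix (n + 2) 0) (ix (n + 2) 0) + X (ix (n + 2) 1) (ix (n + 2) 1))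

/-- The triple in `tri(S₄,₂)` of an even element of the model. -/
def evD (X : Matrix (Fin 6) (Fin 6) k) (n : Fin 3) : Module.End k (B42 k) :=
  evenEnd (traceless (blk X n n)) (traceless (blk X (n + 2) (n + 2)))
    (traceless (blk X (n + 1) (n + 1)))

/-- The coefficients of `e⁺` of an even element of the model. -/
def evP (X : Matrix (Fin 6) (Fin 6) k) (n : Fin 3) : B42 k := (blk X (n + 2) (n + 1), 0)

/-- The coefficients of `e⁻` of an even element of the model: the negatives of the adjugates of
the blocks above the diagonal, in the cyclic order. -/
def evM (X : Matrix (Fin 6) (Fin 6) k) (n : Fin 3) : B42 k :=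
  (!![-X (ix (n + 1) 1) (ix (n + 2) 1), X (ix (n + 1) 0) (ix (n + 2) 1);
    X (ix (n + 1) 1) (ix (n + 2) 0), -X (ix (n + 1) 0) (ix (n + 2) 0)], 0)

/-- The triple in `tri(S₄,₂)` of an odd element of the model. -/
def odD (u : Trivec k) (n : Fin 3) : Module.End k (B42 k) :=
  oddEnd fun a r p => u.1 (ix n a) (ix (n + 1) r) (ix (n + 2) p)

/-- The coefficients of `e⁺` of an odd element of the model. -/
def odP (u : Trivec k) (n : Fin 3) : B42 k :=
  (0, ![u.1 (ix n 0) (ix (n + 2) 0) (ix (n + 2) 1), u.1 (ix n 1) (ix (n + 2) 0) (ix (n + 2) 1)])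

/-- The coefficients of `e⁻` of an odd element of the model. -/
def odM (u : Trivec k) (n : Fin 3) : B42 k :=
  (0, ![-u.1 (ix n 0) (ix (n + 1) 0) (ix (n + 1) 1), -u.1 (ix n 1) (ix (n + 1) 0) (ix (n + 1) 1)])

lemma evenEnd_add (A B C A' B' C' : Matrix (Fin 2) (Fin 2) k) :
    evenEnd A B C + evenEnd A' B' C' = evenEnd (A + A') (B + B') (C + C') := by
  refine LinearMap.ext fun z => ?_
  refine B42_ext ?_ ?_ ?_ ?_ ?_ ?_ <;> simp [evenEnd_apply] <;> ring

lemma smul_evenEnd (c : k) (A B C : Matrix (Fin 2) (Fin 2) k) :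
    c • evenEnd A B C = evenEnd (c • A) (c • B) (c • C) := by
  refine LinearMap.ext fun z => ?_
  refine B42_ext ?_ ?_ ?_ ?_ ?_ ?_ <;> simp [evenEnd_apply] <;> ring

lemma oddEnd_add (W W' : Fin 2 → Fin 2 → Fin 2 → k) :
    oddEnd W + oddEnd W' = oddEnd (W + W') := by
  refine LinearMap.ext fun z => ?_
  refine B42_ext ?_ ?_ ?_ ?_ ?_ ?_ <;> simp [oddEnd_apply] <;> ring

lemma smul_oddEnd (c : k) (W : Fin 2 → Fin 2 → Fin 2 → k) : c • oddEnd W = oddEnd (c • W) := by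
  refine LinearMap.ext fun z => ?_
  refine B42_ext ?_ ?_ ?_ ?_ ?_ ?_ <;> simp [oddEnd_apply] <;> ring

lemma traceless_blk_add (X Y : Matrix (Fin 6) (Fin 6) k) (i : Fin 3) :
    traceless (blk (X + Y) i i) = traceless (blk X i i) + traceless (blk Y i i) := by
  ext a b; fin_cases a <;> fin_cases b <;> simp [traceless, blk] <;> ring

lemma traceless_blk_smul (c : k) (X : Matrix (Fin 6) (Fin 6) k) (i : Fin 3) :
    traceless (blk (c • X) i i) = c • traceless (blk X i i) := by
  ext a b; fin_cases a <;> fin_cases b <;> simp [traceless, blk] <;> ring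

lemma evD_add (X Y : Matrix (Fin 6) (Fin 6) k) : evD (X + Y) = evD X + evD Y := by
  funext n
  simp only [evD, traceless_blk_add, Pi.add_apply, evenEnd_add]

lemma evD_smul (c : k) (X : Matrix (Fin 6) (Fin 6) k) : evD (c • X) = c • evD X := by
  funext n
  simp only [evD, traceless_blk_smul, Pi.smul_apply, smul_evenEnd]

lemma odD_add (u v : Trivec k) : odD (u + v) = odD u + odD v := by
  funext n
  exact (oddEnd_add _ _).symm

lemma odD_smul (c : k) (u : Trivec k) : odD (c • u) = c • odD u := by
  funext n
  exact (smul_oddEnd _ _).symm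

variable [CharP k 3]

/-- The linear map from the model to the ambient space of `g(S₂, S₄,₂)`. -/
def psi (k : Type*) [Field k] [CharP k 3] :
    Matrix (Fin 6) (Fin 6) k × Trivec k →ₗ[k] Amb k (Fin 2 → k) (B42 k) where
  toFun x := amb (evA x.1) (evD x.1 + odD x.2) (evP x.1 + odP x.2) (evM x.1 + odM x.2)
  map_add' x y := by
    rw [amb_add]
    congr 1
    · funext n; simp [evA]; ring
    · rw [Prod.fst_add, Prod.snd_add, evD_add, odD_add]; abel
    · funext n; refine B42_ext ?_ ?_ ?_ ?_ ?_ ?_ <;> simp [evP, odP, blk]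
    · funext n; refine B42_ext ?_ ?_ ?_ ?_ ?_ ?_ <;> simp [evM, odM] <;> ring
  map_smul' c x := by
    rw [RingHom.id_apply, amb_smul]
    congr 1
    · funext n; simp [evA]; ring
    · rw [Prod.smul_fst, Prod.smul_snd, evD_smul, odD_smul, smul_add]
    · funext n; refine B42_ext ?_ ?_ ?_ ?_ ?_ ?_ <;> simp [evP, odP, blk]
    · funext n; refine B42_ext ?_ ?_ ?_ ?_ ?_ ?_ <;> simp [evM, odM]

lemma psi_even (X : Matrix (Fin 6) (Fin 6) k) :
    psi k (X, 0) = amb (evA X) (evD X) (evP X) (evM X) := by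
  have h := odD_smul 0 (0 : Trivec k)
  rw [zero_smul, zero_smul] at h
  change amb _ _ _ _ = _
  rw [h, add_zero]
  congr 1 <;> funext n <;> refine B42_ext ?_ ?_ ?_ ?_ ?_ ?_ <;> simp [odP, odM]

lemma psi_odd (u : Trivec k) : psi k (0, u) = amb 0 (odD u) (odP u) (odM u) := by
  have h := evD_smul 0 (0 : Matrix (Fin 6) (Fin 6) k)
  rw [zero_smul, zero_smul] at h
  change amb _ _ _ _ = _
  rw [h, zero_add]
  congr 1 <;> funext n
  · simp [evA]
  · refine B42_ext ?_ ?_ ?_ ?_ ?_ ?_ <;> simp [evP, odP, blk]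
  · refine B42_ext ?_ ?_ ?_ ?_ ?_ ?_ <;> simp [evM, odM]

lemma mem_gr_zero {x : B42 k} (h : x.2 = 0) : x ∈ (S42 k).gr 0 := (prodSpace_zero k).2 h

lemma mem_gr_one {x : B42 k} (h : x.1 = 0) : x ∈ (S42 k).gr 1 := (prodSpace_one k).2 h

lemma hasParity_evD (X : Matrix (Fin 6) (Fin 6) k) (n : Fin 3) : HasParity 0 (evD X n) := by
  intro j x hx
  rcases prodSpace_gr k hx with ⟨rfl, h⟩ | ⟨rfl, h⟩
  · refine mem_gr_zero ?_
    ext i; fin_cases i <;> simp [evD, evenEnd_apply, h]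
  · refine mem_gr_one ?_
    ext i j; fin_cases i <;> fin_cases j <;> simp [evD, evenEnd_apply, h]

lemma hasParity_odD (u : Trivec k) (n : Fin 3) : HasParity 1 (odD u n) := by
  intro j x hx
  rcases prodSpace_gr k hx with ⟨rfl, h⟩ | ⟨rfl, h⟩
  · refine mem_gr_one ?_
    ext i j; fin_cases i <;> fin_cases j <;> simp [odD, oddEnd_apply, h]
  · refine mem_gr_zero ?_
    ext i; fin_cases i <;> simp [odD, oddEnd_apply, h]

omit [CharP k 3] in
lemma end_ext {d e : Module.End k (B42 k)} (h0 : ∀ f, d (f, 0) = e (f, 0))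
    (h1 : ∀ v, d (0, v) = e (0, v)) : d = e := by
  refine LinearMap.ext fun x => ?_
  rw [← Prod.fst_add_snd x, map_add, map_add]
  exact congrArg₂ _ (h0 _) (h1 _)

end Blocks

section TFormulas

variable {k S : Type*} [Field k] [AddCommGroup S] [Module k S] [CharP k 3]

omit [CharP k 3] in
lemma t_zero_of_mem (C : SymComp k S) {i j l : ZMod 2} {x y z : S} (hx : x ∈ C.gr i)
    (hy : y ∈ C.gr j) (hz : z ∈ C.gr l) :
    C.t x y 0 z = (sgn k (j * l) * C.b x z) • y - (sgn k (i * (j + l)) * C.b y z) • x := by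
  rw [mul_smul, mul_smul]
  exact C.sigma_of_mem hx hy hz

lemma t_one_of_mem (C : SymComp k S) {i j l : ZMod 2} {x y z : S} (hx : x ∈ C.gr i)
    (hy : y ∈ C.gr j) (hz : z ∈ C.gr l) :
    C.t x y 1 z = (-C.b x y) • z - sgn k (i * (j + l)) • C.mul (C.mul y z) x := by
  rw [← (C.mul_osp_aux hx hy hz).1, ← neg_one_mul, ← inv_two]
  rfl

lemma t_two_of_mem (C : SymComp k S) {i j l : ZMod 2} {x y z : S} (hx : x ∈ C.gr i)
    (hy : y ∈ C.gr j) (hz : z ∈ C.gr l) :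
    C.t x y 2 z = (-C.b x y) • z - sgn k (j * l) • C.mul x (C.mul z y) := by
  rw [← (C.mul_osp_aux hx hy hz).2, ← neg_one_mul, ← inv_two]
  rfl

end TFormulas

/-! ### The triality Lie superalgebra of `S₄,₂` as `sl₂³ ⊕ V ⊗ V ⊗ V` -/

section Hom

variable {k : Type*} [Field k]

/-- The cyclic permutation of the factors of `V ⊗ V ⊗ V`. -/
def rot (W : Fin 2 → Fin 2 → Fin 2 → k) : Fin 2 → Fin 2 → Fin 2 → k := fun a r p => W r p a

/-- The action of three matrices on `V ⊗ V ⊗ V`. -/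
def tensorAct₃ (A B C : Matrix (Fin 2) (Fin 2) k) (W : Fin 2 → Fin 2 → Fin 2 → k) :
    Fin 2 → Fin 2 → Fin 2 → k := fun a r p =>
  A a 0 * W 0 r p + A a 1 * W 1 r p + (C r 0 * W a 0 p + C r 1 * W a 1 p)
    + (B p 0 * W a r 0 + B p 1 * W a r 1)

/-- The contraction of two tensors in the second and the third factor, symmetrized. -/
def contract (W W' : Fin 2 → Fin 2 → Fin 2 → k) (a b : Fin 2) : k :=
  W a 1 0 * W' b 0 1 - W a 0 0 * W' b 1 1 + W a 0 1 * W' b 1 0 - W a 1 1 * W' b 0 0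
    + (W' a 1 0 * W b 0 1 - W' a 0 0 * W b 1 1 + W' a 0 1 * W b 1 0 - W' a 1 1 * W b 0 0)

/-- The matrix in `sl₂` of the symmetric tensor `contract W W'`. -/
def contractMatrix (W W' : Fin 2 → Fin 2 → Fin 2 → k) : Matrix (Fin 2) (Fin 2) k :=
  !![-contract W W' 0 1, contract W W' 0 0; -contract W W' 1 1, contract W W' 1 0]

lemma evenEnd_comm (A B C A' B' C' : Matrix (Fin 2) (Fin 2) k) :
    evenEnd A B C * evenEnd A' B' C' - evenEnd A' B' C' * evenEnd A B C
      = evenEnd (A * A' - A' * A) (B * B' - B' * B) (C * C' - C' * C) := by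
  refine LinearMap.ext fun z => ?_
  refine B42_ext ?_ ?_ ?_ ?_ ?_ ?_ <;>
    simp [evenEnd_apply, Matrix.mul_apply] <;> ring

lemma evenEnd_oddEnd_comm {A B C : Matrix (Fin 2) (Fin 2) k} (hA : A 1 1 = -A 0 0)
    (hB : B 1 1 = -B 0 0) (hC : C 1 1 = -C 0 0) (W : Fin 2 → Fin 2 → Fin 2 → k) :
    evenEnd A B C * oddEnd W - oddEnd W * evenEnd A B C = oddEnd (tensorAct₃ A B C W) := by
  refine LinearMap.ext fun z => ?_
  refine B42_ext ?_ ?_ ?_ ?_ ?_ ?_ <;>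
    simp [evenEnd_apply, oddEnd_apply, tensorAct₃, hA, hB, hC] <;> ring

lemma oddEnd_anticomm [CharP k 3] (W W' : Fin 2 → Fin 2 → Fin 2 → k) :
    oddEnd W * oddEnd W' - (-1 : k) • (oddEnd W' * oddEnd W) = evenEnd (contractMatrix W W')
      (contractMatrix (rot W) (rot W')) (contractMatrix (rot (rot W)) (rot (rot W'))) := by
  refine LinearMap.ext fun z => ?_
  refine B42_ext ?_ ?_ ?_ ?_ ?_ ?_ <;>
    simp [evenEnd_apply, oddEnd_apply, contractMatrix, contract, rot] <;> grind

lemma evenEnd_coord (A B C : Matrix (Fin 2) (Fin 2) k) (x : B42 k) :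
    (evenEnd A B C x).1 0 0 = B 0 0 * x.1 0 0 + B 0 1 * x.1 1 0
      - (x.1 0 0 * C 0 0 + x.1 0 1 * C 1 0) ∧
    (evenEnd A B C x).1 0 1 = B 0 0 * x.1 0 1 + B 0 1 * x.1 1 1
      - (x.1 0 0 * C 0 1 + x.1 0 1 * C 1 1) ∧
    (evenEnd A B C x).1 1 0 = B 1 0 * x.1 0 0 + B 1 1 * x.1 1 0
      - (x.1 1 0 * C 0 0 + x.1 1 1 * C 1 0) ∧
    (evenEnd A B C x).1 1 1 = B 1 0 * x.1 0 1 + B 1 1 * x.1 1 1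
      - (x.1 1 0 * C 0 1 + x.1 1 1 * C 1 1) ∧
    (evenEnd A B C x).2 0 = A 0 0 * x.2 0 + A 0 1 * x.2 1 ∧
    (evenEnd A B C x).2 1 = A 1 0 * x.2 0 + A 1 1 * x.2 1 :=
  ⟨rfl, rfl, rfl, rfl, rfl, rfl⟩

lemma oddEnd_coord (W : Fin 2 → Fin 2 → Fin 2 → k) (x : B42 k) :
    (oddEnd W x).1 0 0 = x.2 0 * W 1 1 0 - x.2 1 * W 0 1 0 ∧
    (oddEnd W x).1 0 1 = x.2 1 * W 0 0 0 - x.2 0 * W 1 0 0 ∧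
    (oddEnd W x).1 1 0 = x.2 0 * W 1 1 1 - x.2 1 * W 0 1 1 ∧
    (oddEnd W x).1 1 1 = x.2 1 * W 0 0 1 - x.2 0 * W 1 0 1 ∧
    (oddEnd W x).2 0 =
      x.1 1 1 * W 0 1 0 + x.1 1 0 * W 0 0 0 - x.1 0 0 * W 0 0 1 - x.1 0 1 * W 0 1 1 ∧
    (oddEnd W x).2 1 =
      x.1 1 1 * W 1 1 0 + x.1 1 0 * W 1 0 0 - x.1 0 0 * W 1 0 1 - x.1 0 1 * W 1 1 1 :=
  ⟨rfl, rfl, rfl, rfl, rfl, rfl⟩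

variable [CharP k 3]

lemma S42_mul_apply (x y : B42 k) : (S42 k).mul x y = S42mul k x y := rfl

lemma S42_b_apply (x y : B42 k) : (S42 k).b x y = B42b k x y := rfl

lemma S42_mul_coord (x y : B42 k) :
    ((S42 k).mul x y).1 0 0 = x.1 1 1 * y.1 1 1 + x.1 0 1 * y.1 1 0 + y.2 0 * x.2 1 ∧
    ((S42 k).mul x y).1 0 1 = -(x.1 1 1 * y.1 0 1) - x.1 0 1 * y.1 0 0 - y.2 0 * x.2 0 ∧
    ((S42 k).mul x y).1 1 0 = -(x.1 1 0 * y.1 1 1) - x.1 0 0 * y.1 1 0 + y.2 1 * x.2 1 ∧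
    ((S42 k).mul x y).1 1 1 = x.1 1 0 * y.1 0 1 + x.1 0 0 * y.1 0 0 - y.2 1 * x.2 0 ∧
    ((S42 k).mul x y).2 0 =
      -(y.1 1 1 * x.2 0) + y.1 0 1 * x.2 1 - x.1 0 0 * y.2 0 - x.1 0 1 * y.2 1 ∧
    ((S42 k).mul x y).2 1 =
      y.1 1 0 * x.2 0 - y.1 0 0 * x.2 1 - x.1 1 0 * y.2 0 - x.1 1 1 * y.2 1 := by
  rw [S42_mul_apply, S42mul_apply]
  exact ⟨rfl, rfl, rfl, rfl, rfl, rfl⟩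

lemma even_mem (f : Matrix (Fin 2) (Fin 2) k) : ((f, 0) : B42 k) ∈ (S42 k).gr 0 :=
  mem_gr_zero rfl

lemma odd_mem (v : Fin 2 → k) : ((0, v) : B42 k) ∈ (S42 k).gr 1 := mem_gr_one rfl

/-- The matrix `-b(f, g) - f̄ g`. -/
def tL (f g : Matrix (Fin 2) (Fin 2) k) : Matrix (Fin 2) (Fin 2) k :=
  !![-(f 0 0 * g 1 1 + f 1 1 * g 0 0 - f 0 1 * g 1 0 - f 1 0 * g 0 1)
      - (f 1 1 * g 0 0 - f 0 1 * g 1 0), f 0 1 * g 1 1 - f 1 1 * g 0 1;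
    f 1 0 * g 0 0 - f 0 0 * g 1 0, -(f 0 0 * g 1 1 + f 1 1 * g 0 0 - f 0 1 * g 1 0 - f 1 0 * g 0 1)
      - (f 0 0 * g 1 1 - f 1 0 * g 0 1)]

/-- The matrix `-b(f, g) - f ḡ`. -/
def tR (f g : Matrix (Fin 2) (Fin 2) k) : Matrix (Fin 2) (Fin 2) k :=
  !![-(f 0 0 * g 1 1 + f 1 1 * g 0 0 - f 0 1 * g 1 0 - f 1 0 * g 0 1)
      - (f 0 0 * g 1 1 - f 0 1 * g 1 0), f 0 0 * g 0 1 - f 0 1 * g 0 0;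
    f 1 1 * g 1 0 - f 1 0 * g 1 1, -(f 0 0 * g 1 1 + f 1 1 * g 0 0 - f 0 1 * g 1 0 - f 1 0 * g 0 1)
      - (f 1 1 * g 0 0 - f 1 0 * g 0 1)]

/-- The matrix of `w ↦ -⟨u|w⟩ v - ⟨v|w⟩ u`. -/
def tV (u v : Fin 2 → k) : Matrix (Fin 2) (Fin 2) k :=
  !![u 1 * v 0 + v 1 * u 0, -(u 0 * v 0 + v 0 * u 0);
    u 1 * v 1 + v 1 * u 1, -(u 0 * v 1 + v 0 * u 1)]

/-- The tensor of `h ↦ b(f, h) v`. -/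
def tW (f : Matrix (Fin 2) (Fin 2) k) (v : Fin 2 → k) : Fin 2 → Fin 2 → Fin 2 → k :=
  fun a => ![![-v a * f 0 1, -v a * f 1 1], ![v a * f 0 0, v a * f 1 0]]

lemma t_even_even (f g : Matrix (Fin 2) (Fin 2) k) : (S42 k).t (f, 0) (g, 0) =
    ![evenEnd 0 (tR f g) (tL f g), evenEnd (tL f g) 0 (tR f g), evenEnd (tR f g) (tL f g) 0] := by
  have key : (S42 k).t (f, 0) (g, 0) 0 = evenEnd 0 (tR f g) (tL f g) ∧
      (S42 k).t (f, 0) (g, 0) 1 = evenEnd (tL f g) 0 (tR f g) ∧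
      (S42 k).t (f, 0) (g, 0) 2 = evenEnd (tR f g) (tL f g) 0 := by
    refine ⟨end_ext (fun h => ?_) fun v => ?_, end_ext (fun h => ?_) fun v => ?_,
      end_ext (fun h => ?_) fun v => ?_⟩
    on_goal 1 => rw [t_zero_of_mem _ (even_mem f) (even_mem g) (even_mem h)]
    on_goal 2 => rw [t_zero_of_mem _ (even_mem f) (even_mem g) (odd_mem v)]
    on_goal 3 => rw [t_one_of_mem _ (even_mem f) (even_mem g) (even_mem h)]
    on_goal 4 => rw [t_one_of_mem _ (even_mem f) (even_mem g) (odd_mem v)]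
    on_goal 5 => rw [t_two_of_mem _ (even_mem f) (even_mem g) (even_mem h)]
    on_goal 6 => rw [t_two_of_mem _ (even_mem f) (even_mem g) (odd_mem v)]
    all_goals
      refine B42_ext ?_ ?_ ?_ ?_ ?_ ?_ <;>
        simp only [evenEnd_coord, tL, tR, S42_b_apply, B42b_apply, S42_mul_coord, sgn_zero,
            Matrix.of_apply, Matrix.cons_val',
          Matrix.cons_val_zero, Matrix.cons_val_one, Matrix.cons_val_fin_one,
          Prod.fst_sub, Prod.snd_sub, Prod.smul_fst,
          Prod.smul_snd, Pi.sub_apply, Pi.smul_apply, Matrix.sub_apply, Matrix.smul_apply,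
          Pi.zero_apply, Matrix.zero_apply, smul_eq_mul, mul_zero, zero_mul, add_zero,
          zero_add, sub_zero, zero_sub, mul_one, one_mul, neg_zero] <;>
        first | ring1 | grind
  funext n
  fin_cases n
  exacts [key.1, key.2.1, key.2.2]

lemma t_odd_odd (u w : Fin 2 → k) : (S42 k).t (0, u) (0, w) =
    ![evenEnd (tV u w) 0 0, evenEnd 0 (tV u w) 0, evenEnd 0 0 (tV u w)] := by
  have key : (S42 k).t (0, u) (0, w) 0 = evenEnd (tV u w) 0 0 ∧
      (S42 k).t (0, u) (0, w) 1 = evenEnd 0 (tV u w) 0 ∧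
      (S42 k).t (0, u) (0, w) 2 = evenEnd 0 0 (tV u w) := by
    refine ⟨end_ext (fun h => ?_) fun v => ?_, end_ext (fun h => ?_) fun v => ?_,
      end_ext (fun h => ?_) fun v => ?_⟩
    on_goal 1 => rw [t_zero_of_mem _ (odd_mem u) (odd_mem w) (even_mem h)]
    on_goal 2 => rw [t_zero_of_mem _ (odd_mem u) (odd_mem w) (odd_mem v)]
    on_goal 3 => rw [t_one_of_mem _ (odd_mem u) (odd_mem w) (even_mem h)]
    on_goal 4 => rw [t_one_of_mem _ (odd_mem u) (odd_mem w) (odd_mem v)]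
    on_goal 5 => rw [t_two_of_mem _ (odd_mem u) (odd_mem w) (even_mem h)]
    on_goal 6 => rw [t_two_of_mem _ (odd_mem u) (odd_mem w) (odd_mem v)]
    all_goals
      refine B42_ext ?_ ?_ ?_ ?_ ?_ ?_ <;>
        simp only [evenEnd_coord, tV, S42_b_apply, B42b_apply, S42_mul_coord, sgn_zero, sgn_one,
            one_add_one_parity, Matrix.of_apply, Matrix.cons_val',
          Matrix.cons_val_zero, Matrix.cons_val_one, Matrix.cons_val_fin_one,
          Prod.fst_sub, Prod.snd_sub, Prod.smul_fst,
          Prod.smul_snd, Pi.sub_apply, Pi.smul_apply, Matrix.sub_apply, Matrix.smul_apply,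
          Pi.zero_apply, Matrix.zero_apply, smul_eq_mul, mul_zero, zero_mul, add_zero,
          zero_add, sub_zero, zero_sub, mul_one, one_mul, neg_zero] <;>
        first | ring1 | grind
  funext n
  fin_cases n
  exacts [key.1, key.2.1, key.2.2]

lemma t_even_odd (f : Matrix (Fin 2) (Fin 2) k) (u : Fin 2 → k) : (S42 k).t (f, 0) (0, u) =
    ![oddEnd (tW f u), oddEnd (rot (rot (tW f u))), oddEnd (rot (tW f u))] := by
  have key : (S42 k).t (f, 0) (0, u) 0 = oddEnd (tW f u) ∧
      (S42 k).t (f, 0) (0, u) 1 = oddEnd (rot (rot (tW f u))) ∧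
      (S42 k).t (f, 0) (0, u) 2 = oddEnd (rot (tW f u)) := by
    refine ⟨end_ext (fun h => ?_) fun v => ?_, end_ext (fun h => ?_) fun v => ?_,
      end_ext (fun h => ?_) fun v => ?_⟩
    on_goal 1 => rw [t_zero_of_mem _ (even_mem f) (odd_mem u) (even_mem h)]
    on_goal 2 => rw [t_zero_of_mem _ (even_mem f) (odd_mem u) (odd_mem v)]
    on_goal 3 => rw [t_one_of_mem _ (even_mem f) (odd_mem u) (even_mem h)]
    on_goal 4 => rw [t_one_of_mem _ (even_mem f) (odd_mem u) (odd_mem v)]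
    on_goal 5 => rw [t_two_of_mem _ (even_mem f) (odd_mem u) (even_mem h)]
    on_goal 6 => rw [t_two_of_mem _ (even_mem f) (odd_mem u) (odd_mem v)]
    all_goals
      refine B42_ext ?_ ?_ ?_ ?_ ?_ ?_ <;>
        simp only [oddEnd_coord, tW, rot, S42_b_apply, B42b_apply, S42_mul_coord, sgn_zero,
            sgn_one, one_add_one_parity, Matrix.cons_val',
          Matrix.cons_val_zero, Matrix.cons_val_one, Matrix.cons_val_fin_one,
          Prod.fst_sub, Prod.snd_sub, Prod.smul_fst,
          Prod.smul_snd, Pi.sub_apply, Pi.smul_apply, Matrix.sub_apply, Matrix.smul_apply,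
          Pi.zero_apply, Matrix.zero_apply, smul_eq_mul, mul_zero, zero_mul, add_zero,
          zero_add, sub_zero, zero_sub, mul_one, one_mul, neg_zero] <;>
        ring1
  funext n
  fin_cases n
  exacts [key.1, key.2.1, key.2.2]

lemma t_odd_even (f : Matrix (Fin 2) (Fin 2) k) (u : Fin 2 → k) : (S42 k).t (0, u) (f, 0) =
    ![oddEnd (-tW f u), oddEnd (-rot (rot (tW f u))), oddEnd (-rot (tW f u))] := by
  have key : (S42 k).t (0, u) (f, 0) 0 = oddEnd (-tW f u) ∧
      (S42 k).t (0, u) (f, 0) 1 = oddEnd (-rot (rot (tW f u))) ∧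
      (S42 k).t (0, u) (f, 0) 2 = oddEnd (-rot (tW f u)) := by
    refine ⟨end_ext (fun h => ?_) fun v => ?_, end_ext (fun h => ?_) fun v => ?_,
      end_ext (fun h => ?_) fun v => ?_⟩
    on_goal 1 => rw [t_zero_of_mem _ (odd_mem u) (even_mem f) (even_mem h)]
    on_goal 2 => rw [t_zero_of_mem _ (odd_mem u) (even_mem f) (odd_mem v)]
    on_goal 3 => rw [t_one_of_mem _ (odd_mem u) (even_mem f) (even_mem h)]
    on_goal 4 => rw [t_one_of_mem _ (odd_mem u) (even_mem f) (odd_mem v)]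
    on_goal 5 => rw [t_two_of_mem _ (odd_mem u) (even_mem f) (even_mem h)]
    on_goal 6 => rw [t_two_of_mem _ (odd_mem u) (even_mem f) (odd_mem v)]
    all_goals
      refine B42_ext ?_ ?_ ?_ ?_ ?_ ?_ <;>
        simp only [oddEnd_coord, tW, rot, S42_b_apply, B42b_apply, S42_mul_coord, sgn_zero,
            sgn_one, Matrix.cons_val',
          Matrix.cons_val_zero, Matrix.cons_val_one, Matrix.cons_val_fin_one,
          Prod.fst_sub, Prod.snd_sub, Prod.smul_fst,
          Prod.smul_snd, Pi.sub_apply, Pi.smul_apply, Matrix.sub_apply, Matrix.smul_apply,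
          Pi.zero_apply, Matrix.zero_apply, smul_eq_mul, Pi.neg_apply, mul_zero, zero_mul, add_zero,
          zero_add, sub_zero, zero_sub, mul_one, one_mul, neg_zero] <;>
        ring1
  funext n
  fin_cases n
  exacts [key.1, key.2.1, key.2.2]

end Hom

/-! ### Compatibility of the coordinates with the products -/

section Hom

variable {k : Type*} [Field k] [CharP k 3]

lemma evP_mem (X : Matrix (Fin 6) (Fin 6) k) (n : Fin 3) : evP X n ∈ (S42 k).gr 0 :=
  mem_gr_zero rfl

lemma evM_mem (X : Matrix (Fin 6) (Fin 6) k) (n : Fin 3) : evM X n ∈ (S42 k).gr 0 :=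
  mem_gr_zero rfl

lemma odP_mem (u : Trivec k) (n : Fin 3) : odP u n ∈ (S42 k).gr 1 := mem_gr_one rfl

lemma odM_mem (u : Trivec k) (n : Fin 3) : odM u n ∈ (S42 k).gr 1 := mem_gr_one rfl

omit [CharP k 3] in
lemma traceless_neg (f : Matrix (Fin 2) (Fin 2) k) : traceless f 1 1 = -traceless f 0 0 := by
  simp [traceless]

omit [CharP k 3] in
lemma ix_table : ix 0 0 = 0 ∧ ix 0 1 = 1 ∧ ix 1 0 = 2 ∧ ix 1 1 = 3 ∧ ix 2 0 = 4 ∧ ix 2 1 = 5 :=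
  ⟨rfl, rfl, rfl, rfl, rfl, rfl⟩

lemma evP_commutator (X Y : Matrix (Fin 6) (Fin 6) k) (n : Fin 3) :
    evP (X * Y - Y * X) n = evA X n • evP Y n + evD X n (evP Y n)
        + (S42 k).mul (evM X (n + 1)) (evM Y (n + 2))
      - (evA Y n • evP X n + evD Y n (evP X n)
        + (S42 k).mul (evM Y (n + 1)) (evM X (n + 2))) := by
  refine B42_ext ?_ ?_ ?_ ?_ ?_ ?_ <;> fin_cases n
  all_goals
    simp only [evA, evP, evM, evD, evenEnd_coord, blk, traceless, S42_mul_coord,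
      Matrix.mul_apply, Fin.sum_univ_six, Fin.zero_eta, Fin.mk_one, Fin.reduceFinMk,
      Fin.reduceAdd, Matrix.of_apply, Matrix.cons_val', Matrix.cons_val_zero,
      Matrix.cons_val_one, Matrix.cons_val_fin_one, Prod.fst_sub, Prod.snd_sub, Prod.fst_add,
      Prod.snd_add, Prod.smul_fst, Prod.smul_snd, Pi.sub_apply, Pi.add_apply, Pi.smul_apply,
      Matrix.add_apply, Matrix.sub_apply, Matrix.smul_apply, Pi.zero_apply,
      smul_eq_mul, zero_add, ix_table]
    first | ring1 | grind

lemma evM_commutator (X Y : Matrix (Fin 6) (Fin 6) k) (n : Fin 3) :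
    evM (X * Y - Y * X) n = -evA X n • evM Y n + evD X n (evM Y n)
        + (S42 k).mul (evP X (n + 1)) (evP Y (n + 2))
      - (-evA Y n • evM X n + evD Y n (evM X n)
        + (S42 k).mul (evP Y (n + 1)) (evP X (n + 2))) := by
  refine B42_ext ?_ ?_ ?_ ?_ ?_ ?_ <;> fin_cases n
  all_goals
    simp only [evA, evP, evM, evD, evenEnd_coord, blk, traceless, S42_mul_coord,
      Matrix.mul_apply, Fin.sum_univ_six, Fin.zero_eta, Fin.mk_one, Fin.reduceFinMk,
      Fin.reduceAdd, Matrix.of_apply, Matrix.cons_val', Matrix.cons_val_zero,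
      Matrix.cons_val_one, Matrix.cons_val_fin_one, Prod.fst_sub, Prod.snd_sub, Prod.fst_add,
      Prod.snd_add, Prod.smul_fst, Prod.smul_snd, Pi.sub_apply, Pi.add_apply, Pi.smul_apply,
      Matrix.add_apply, Matrix.sub_apply, Matrix.smul_apply, Pi.zero_apply,
      smul_eq_mul, zero_add, ix_table]
    first | ring1 | grind

set_option maxHeartbeats 2000000 in
lemma psi_even_even (X Y : Matrix (Fin 6) (Fin 6) k) :
    psi k (X * Y - Y * X, 0) = ambBr (S2 k) (S42 k) (psi k (X, 0)) (psi k (Y, 0)) := by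
  rw [psi_even, psi_even, psi_even, ambBr_amb (by simp) (hasParity_evD X) (evP_mem X) (evM_mem X)
    (by simp) (hasParity_evD Y) (evP_mem Y) (evM_mem Y)]
  simp only [mul_zero, sgn_zero, one_smul, ← evP_commutator, ← evM_commutator]
  congr 1 <;> funext n
  · simp only [S42_b_apply, B42b_apply, Fin.sum_univ_three]
    fin_cases n
    all_goals
      simp only [evA, evP, evM, blk,
      Matrix.mul_apply, Fin.sum_univ_six, Fin.zero_eta, Fin.mk_one, Fin.reduceFinMk,
      Fin.reduceAdd, Matrix.of_apply, Matrix.cons_val', Matrix.cons_val_zero,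
      Matrix.cons_val_one, Matrix.cons_val_fin_one,
      Matrix.sub_apply, Pi.zero_apply,
      zero_add, ix_table]
      first | ring1 | grind
  · simp only [evD, evenEnd_comm, evP, evM, t_even_even, Fin.sum_univ_three]
    fin_cases n <;> simp only [Fin.zero_eta, Fin.mk_one, Fin.reduceFinMk, Fin.reduceSub,
      Fin.reduceAdd, Matrix.cons_val, evenEnd_add, zero_add, add_zero, sub_zero, sub_self] <;>
      congr 1 <;> ext a b <;> fin_cases a <;> fin_cases b
    all_goals
      simp only [traceless, tL, tR, blk, Matrix.mul_apply, Fin.sum_univ_six, Fin.sum_univ_two,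
          Fin.zero_eta, Fin.mk_one,
      Matrix.of_apply, Matrix.cons_val', Matrix.cons_val_zero,
      Matrix.cons_val_one, Matrix.cons_val_fin_one,
      Matrix.add_apply, Matrix.sub_apply,
      ix_table]
      first | ring1 | grind

set_option maxHeartbeats 2000000 in
lemma odP_act (X : Matrix (Fin 6) (Fin 6) k) (u : Trivec k) (n : Fin 3) :
    odP (act X u) n = evA X n • odP u n + evD X n (odP u n)
        + (S42 k).mul (evM X (n + 1)) (odM u (n + 2))
      - ((0 : Fin 3 → k) n • evP X n + odD u n (evP X n)
        + (S42 k).mul (odM u (n + 1)) (evM X (n + 2))) := by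
  refine B42_ext ?_ ?_ ?_ ?_ ?_ ?_ <;> fin_cases n
  all_goals
    simp only [evA, evP, evM, evD, odP, odM, odD, evenEnd_coord, oddEnd_coord, blk, traceless,
      S42_mul_coord, act_apply, Matrix.trace, Matrix.diag, Fin.sum_univ_six, Fin.zero_eta,
          Fin.mk_one, Fin.reduceFinMk,
      Fin.reduceAdd, Matrix.of_apply, Matrix.cons_val', Matrix.cons_val_zero,
      Matrix.cons_val_one, Matrix.cons_val_fin_one, Prod.fst_sub, Prod.snd_sub, Prod.fst_add,
      Prod.snd_add, Prod.smul_fst, Prod.smul_snd, Pi.sub_apply, Pi.add_apply, Pi.smul_apply,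
      Matrix.add_apply, Matrix.sub_apply, Matrix.smul_apply, Pi.zero_apply, Matrix.zero_apply,
      smul_eq_mul, zero_add, ix_table]
    try simp (decide := true) only [sort₁₂, sort₂₃, eq₁₂, eq₂₃]
    first | ring1 | grind

set_option maxHeartbeats 2000000 in
lemma odM_act (X : Matrix (Fin 6) (Fin 6) k) (u : Trivec k) (n : Fin 3) :
    odM (act X u) n = -evA X n • odM u n + evD X n (odM u n)
        + (S42 k).mul (evP X (n + 1)) (odP u (n + 2))
      - (-(0 : Fin 3 → k) n • evM X n + odD u n (evM X n)
        + (S42 k).mul (odP u (n + 1)) (evP X (n + 2))) := by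
  refine B42_ext ?_ ?_ ?_ ?_ ?_ ?_ <;> fin_cases n
  all_goals
    simp only [evA, evP, evM, evD, odP, odM, odD, evenEnd_coord, oddEnd_coord, blk, traceless,
      S42_mul_coord, act_apply, Matrix.trace, Matrix.diag, Fin.sum_univ_six, Fin.zero_eta,
          Fin.mk_one, Fin.reduceFinMk,
      Fin.reduceAdd, Matrix.of_apply, Matrix.cons_val', Matrix.cons_val_zero,
      Matrix.cons_val_one, Matrix.cons_val_fin_one, Prod.fst_sub, Prod.snd_sub, Prod.fst_add,
      Prod.snd_add, Prod.smul_fst, Prod.smul_snd, Pi.sub_apply, Pi.add_apply, Pi.smul_apply,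
      Matrix.add_apply, Matrix.sub_apply, Matrix.smul_apply, Pi.zero_apply, Matrix.zero_apply,
      smul_eq_mul, zero_add, ix_table]
    try simp (decide := true) only [sort₁₂, sort₂₃, eq₁₂, eq₂₃]
    first | ring1 | grind

set_option maxHeartbeats 2000000 in
lemma psi_even_odd (X : Matrix (Fin 6) (Fin 6) k) (u : Trivec k) :
    psi k (0, act X u) = ambBr (S2 k) (S42 k) (psi k (X, 0)) (psi k (0, u)) := by
  rw [psi_even, psi_odd, psi_odd, ambBr_amb (by simp) (hasParity_evD X) (evP_mem X) (evM_mem X)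
    (by simp) (hasParity_odD u) (odP_mem u) (odM_mem u)]
  simp only [zero_mul, sgn_zero, one_smul, ← odP_act, ← odM_act]
  congr 1 <;> funext n
  · simp [evP, evM, odP, odM, S42_b_apply, B42b_apply]
  · simp only [evD, odD, evP, evM, odP, odM, t_even_odd, Fin.sum_univ_three,
      evenEnd_oddEnd_comm (traceless_neg _) (traceless_neg _) (traceless_neg _)]
    fin_cases n <;> simp only [Fin.zero_eta, Fin.mk_one, Fin.reduceFinMk, Fin.reduceSub,
      Fin.reduceAdd, Matrix.cons_val, oddEnd_add, zero_add, sub_zero, sub_self] <;>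
      congr 1 <;> funext a b c <;> simp only [Pi.add_apply, rot, tensorAct₃, tW] <;>
      fin_cases a <;> fin_cases b <;> fin_cases c
    all_goals
      simp only [traceless, blk, act_apply, Matrix.trace, Matrix.diag, Fin.sum_univ_six,
          Fin.zero_eta, Fin.mk_one,
      Matrix.of_apply, Matrix.cons_val', Matrix.cons_val_zero,
      Matrix.cons_val_one, Matrix.cons_val_fin_one,
      ix_table]
      try simp (decide := true) only [sort₁₂, sort₂₃, eq₁₂, eq₂₃]
      first | ring1 | grind

set_option maxHeartbeats 2000000 in
lemma evP_oddBr (u v : Trivec k) (n : Fin 3) :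
    evP (oddBr u v) n = (0 : Fin 3 → k) n • odP v n + odD u n (odP v n)
        + (S42 k).mul (odM u (n + 1)) (odM v (n + 2))
      - (-1 : k) • ((0 : Fin 3 → k) n • odP u n + odD v n (odP u n)
        + (S42 k).mul (odM v (n + 1)) (odM u (n + 2))) := by
  refine B42_ext ?_ ?_ ?_ ?_ ?_ ?_ <;> fin_cases n
  all_goals
    simp only [evP, odP, odM, odD, oddEnd_coord, blk, S42_mul_coord,
      oddBr_apply, pairing_apply, act_single_apply', Fin.zero_eta, Fin.mk_one, Fin.reduceFinMk,
        Fin.reduceAdd, Matrix.of_apply, Matrix.cons_val', Matrix.cons_val_zero,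
        Matrix.cons_val_one, Matrix.cons_val_fin_one, Prod.fst_sub, Prod.snd_sub, Prod.fst_add,
        Prod.snd_add, Prod.smul_fst, Prod.smul_snd, Pi.sub_apply, Pi.add_apply, Pi.smul_apply,
        Matrix.add_apply, Matrix.sub_apply, Matrix.smul_apply, Pi.zero_apply, Matrix.zero_apply,
        smul_eq_mul, zero_add, ix_table]
    simp (decide := true) only [if_true, if_false, zero_add, add_zero, sub_zero, mul_zero, zero_mul,
      zero_sub, sort₁₂, sort₂₃, eq₁₂, eq₂₃] <;>
    ring1

set_option maxHeartbeats 2000000 in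
lemma evM_oddBr (u v : Trivec k) (n : Fin 3) :
    evM (oddBr u v) n = -(0 : Fin 3 → k) n • odM v n + odD u n (odM v n)
        + (S42 k).mul (odP u (n + 1)) (odP v (n + 2))
      - (-1 : k) • (-(0 : Fin 3 → k) n • odM u n + odD v n (odM u n)
        + (S42 k).mul (odP v (n + 1)) (odP u (n + 2))) := by
  refine B42_ext ?_ ?_ ?_ ?_ ?_ ?_ <;> fin_cases n
  all_goals
    simp only [evM, odP, odM, odD, oddEnd_coord, S42_mul_coord,
      oddBr_apply, pairing_apply, act_single_apply', Fin.zero_eta, Fin.mk_one, Fin.reduceFinMk,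
        Fin.reduceAdd, Matrix.of_apply, Matrix.cons_val', Matrix.cons_val_zero,
        Matrix.cons_val_one, Matrix.cons_val_fin_one, Prod.fst_sub, Prod.snd_sub, Prod.fst_add,
        Prod.snd_add, Prod.smul_fst, Prod.smul_snd, Pi.sub_apply, Pi.add_apply, Pi.smul_apply,
        Matrix.add_apply, Matrix.sub_apply, Matrix.smul_apply, Pi.zero_apply, Matrix.zero_apply,
        smul_eq_mul, zero_add, ix_table]
    simp (decide := true) only [if_true, if_false, zero_add, add_zero, sub_zero, mul_zero, zero_mul,
      zero_sub, sort₁₂, sort₂₃, eq₁₂, eq₂₃]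
    ring1

set_option maxHeartbeats 2000000 in
lemma psi_odd_odd (u v : Trivec k) :
    psi k (oddBr u v, 0) = ambBr (S2 k) (S42 k) (psi k (0, u)) (psi k (0, v)) := by
  rw [psi_even, psi_odd, psi_odd, ambBr_amb (by simp) (hasParity_odD u) (odP_mem u) (odM_mem u)
    (by simp) (hasParity_odD v) (odP_mem v) (odM_mem v)]
  simp only [mul_one, sgn_one, ← evP_oddBr, ← evM_oddBr]
  congr 1 <;> funext n
  · simp only [S42_b_apply, B42b_apply, Fin.sum_univ_three]
    fin_cases n
    all_goals
      simp only [evA, odP, odM,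
        oddBr_apply, pairing_apply, act_single_apply', Fin.zero_eta, Fin.mk_one, Fin.reduceFinMk,
          Fin.reduceAdd, Matrix.cons_val_zero,
          Matrix.cons_val_one, Matrix.cons_val_fin_one,
          Matrix.zero_apply,
          zero_add, ix_table]
      simp (decide := true) only [if_true, if_false, zero_add, add_zero, sub_zero, mul_zero,
        sort₁₂, sort₂₃, eq₁₂, eq₂₃]
      first | ring1 | grind
  · simp only [evD, odD, oddEnd_anticomm, odP, odM, t_odd_odd,
      Fin.sum_univ_three]
    fin_cases n <;> simp only [Fin.zero_eta, Fin.mk_one, Fin.reduceFinMk, Fin.reduceSub,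
      Fin.reduceAdd, Matrix.cons_val, evenEnd_add, zero_add, add_zero, sub_zero, sub_self] <;>
      congr 1 <;> ext a b <;> fin_cases a <;> fin_cases b
    all_goals
      simp only [traceless, tV, blk, contractMatrix, contract, rot,
        oddBr_apply, pairing_apply, act_single_apply', Fin.zero_eta, Fin.mk_one,
          Matrix.of_apply, Matrix.cons_val', Matrix.cons_val_zero,
          Matrix.cons_val_one, Matrix.cons_val_fin_one,
          Matrix.add_apply,
          ix_table]
      simp (decide := true) only [if_true, if_false, zero_add, add_zero, sub_zero, mul_zero,
          zero_mul,
        zero_sub, sort₁₂, sort₂₃, eq₁₂, eq₂₃]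
      first | ring1 | grind

end Hom

/-! ### The triality Lie superalgebras of `S₂` and `S₄,₂` -/

section Triality

variable {k : Type*} [Field k] [CharP k 3]

omit [CharP k 3] in
lemma diag_mem_triHom {a : Fin 3 → k} (h : a 0 + a 1 + a 2 = 0) :
    (fun n => a n • diagEnd k) ∈ (S2 k).triHom 0 := by
  refine ⟨fun n => ⟨fun j x hx => Submodule.smul_mem _ _ (diagEnd_mem k j x hx),
    fun j x hx y => ?_⟩, fun j x hx y => ?_⟩
  · simp only [LinearMap.smul_apply, diagEnd_apply, zero_mul, sgn_zero]
    simp [S2]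
    ring
  · simp only [LinearMap.smul_apply, diagEnd_apply, zero_mul, sgn_zero]
    ext i
    fin_cases i <;> simp [S2]
    · linear_combination (x 1 * y 1) * h
    · linear_combination (-(x 0 * y 0)) * h

lemma exists_of_mem_triHom_S2 {d : Fin 3 → Module.End k (Fin 2 → k)}
    (hd : d ∈ (S2 k).triHom 0) :
    ∃ a : Fin 3 → k, a 0 + a 1 + a 2 = 0 ∧ d = fun n => a n • diagEnd k := by
  have hm : ∀ x : Fin 2 → k, x ∈ (S2 k).gr 0 := fun x => ⟨x, rfl⟩
  have h2 := two_ne_zero_of_charP k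
  have ho : ∀ n x y,
      (d n x) 0 * y 1 + (d n x) 1 * y 0 + (x 0 * (d n y) 1 + x 1 * (d n y) 0) = 0 := by
    intro n x y
    have := (hd.1 n).2 0 x (hm x) y
    rwa [zero_mul, sgn_zero, one_mul] at this
  have h10 : ∀ n, (d n ![1, 0]) 1 = 0 := by
    intro n
    have := ho n ![1, 0] ![1, 0]
    simp at this
    exact (mul_eq_zero.1 ((two_mul _).trans this)).resolve_left h2
  have h01 : ∀ n, (d n ![0, 1]) 0 = 0 := by
    intro n
    have := ho n ![0, 1] ![0, 1]
    simp at this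
    exact (mul_eq_zero.1 ((two_mul _).trans this)).resolve_left h2
  have h11 : ∀ n, (d n ![0, 1]) 1 = -(d n ![1, 0]) 0 := by
    intro n
    have := ho n ![1, 0] ![0, 1]
    simp at this
    linear_combination this
  refine ⟨fun n => (d n ![1, 0]) 0, ?_, ?_⟩
  · have := congrFun (hd.2 0 ![1, 0] (hm _) ![1, 0]) 1
    rw [zero_mul, sgn_zero, one_smul] at this
    have e1 : (S2 k).mul ![1, 0] ![1, 0] = ![0, 1] := by ext i; fin_cases i <;> simp [S2]
    have e2 : ∀ x y, ((S2 k).mul x y) 1 = x 0 * y 0 := fun _ _ => rfl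
    rw [e1, Pi.add_apply, e2, e2, h11] at this
    simp at this
    linear_combination -this
  · funext n
    refine LinearMap.ext fun x => ?_
    have hx : x = x 0 • ![1, 0] + x 1 • ![0, 1] := by ext i; fin_cases i <;> simp
    conv_lhs => rw [hx]
    rw [map_add, map_smul, map_smul, LinearMap.smul_apply, diagEnd_apply]
    ext i
    fin_cases i
    · simp [h01]; ring
    · simp [h10, h11]; ring

omit [CharP k 3] in
lemma eq_zero_of_mem_triHom_S2 {d : Fin 3 → Module.End k (Fin 2 → k)}
    (hd : d ∈ (S2 k).triHom 1) : d = 0 := by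
  funext n
  refine LinearMap.ext fun x => ?_
  rcases evenSpace_one k ((hd.1 n).1 0 x ⟨x, rfl⟩) with h | h
  · exact absurd h (by decide)
  · exact h

lemma evenEnd_mem_triHom {A : Fin 3 → Matrix (Fin 2) (Fin 2) k} (hA : ∀ n, A n 1 1 = -A n 0 0) :
    (fun n => evenEnd (A n) (A (n + 2)) (A (n + 1))) ∈ (S42 k).triHom 0 := by
  refine ⟨fun n => ⟨fun j x hx => ?_, fun j x hx y => ?_⟩, fun j x hx y => ?_⟩
  · rcases prodSpace_gr k hx with ⟨rfl, h⟩ | ⟨rfl, h⟩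
    · exact mem_gr_zero (by ext i; fin_cases i <;> simp [evenEnd_apply, h])
    · exact mem_gr_one (by ext i j; fin_cases i <;> fin_cases j <;> simp [evenEnd_apply, h])
  · rw [zero_mul, sgn_zero, one_mul]
    simp only [evenEnd_apply, S42_b_apply, B42b_apply, Matrix.of_apply, Matrix.cons_val',
      Matrix.cons_val_zero, Matrix.cons_val_one, Matrix.cons_val_fin_one, hA]
    ring
  · rw [zero_mul, sgn_zero, one_smul]
    refine B42_ext ?_ ?_ ?_ ?_ ?_ ?_ <;>
    simp only [evenEnd_apply, S42_mul_apply, S42mul_apply, Matrix.of_apply, Matrix.cons_val',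
      Matrix.cons_val_zero, Matrix.cons_val_one, Matrix.cons_val_fin_one, hA, Prod.fst_add,
      Prod.snd_add, Pi.add_apply, Matrix.add_apply, Fin.reduceAdd, zero_add] <;>
    ring

lemma oddEnd_mem_triHom (W : Fin 2 → Fin 2 → Fin 2 → k) :
    ![oddEnd W, oddEnd (rot (rot W)), oddEnd (rot W)] ∈ (S42 k).triHom 1 := by
  have h1 : ∀ W : Fin 2 → Fin 2 → Fin 2 → k, oddEnd W ∈ (S42 k).osp 1 := by
    refine fun W => ⟨fun j x hx => ?_, fun j x hx y => ?_⟩ <;>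
      rcases prodSpace_gr k hx with ⟨rfl, h⟩ | ⟨rfl, h⟩
    · exact mem_gr_one (by ext i j; fin_cases i <;> fin_cases j <;> simp [oddEnd_apply, h])
    · exact mem_gr_zero (by ext i; fin_cases i <;> simp [oddEnd_apply, h])
    all_goals
      simp only [oddEnd_apply, S42_b_apply, B42b_apply, Matrix.of_apply, Matrix.cons_val',
        Matrix.cons_val_zero, Matrix.cons_val_one, Matrix.cons_val_fin_one, h, Pi.zero_apply,
        Matrix.zero_apply, mul_zero, mul_one, sgn_zero, sgn_one]
      ring
  refine ⟨fun n => by fin_cases n <;> exact h1 _, fun j x hx y => ?_⟩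
  simp only [Matrix.cons_val]
  rcases prodSpace_gr k hx with ⟨rfl, h⟩ | ⟨rfl, h⟩ <;>
    refine B42_ext ?_ ?_ ?_ ?_ ?_ ?_ <;>
    simp only [oddEnd_apply, rot, S42_mul_apply, S42mul_apply, Matrix.of_apply, Matrix.cons_val',
      Matrix.cons_val_zero, Matrix.cons_val_one, Matrix.cons_val_fin_one, h, Prod.fst_add,
      Prod.snd_add, Pi.add_apply, Matrix.add_apply, Prod.smul_fst, Prod.smul_snd, Pi.smul_apply,
      Matrix.smul_apply, smul_eq_mul, Pi.zero_apply, Matrix.zero_apply, mul_zero, mul_one,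
      sgn_zero, sgn_one] <;>
    first | ring1 | grind

/-- The even part of `tri(S₄,₂)` is `sl₂³`: the action on the odd part of `S₄,₂` determines a
triple, because the products of odd elements span the even part. -/
lemma exists_evenEnd {d : Fin 3 → Module.End k (B42 k)} (hd : d ∈ (S42 k).triHom 0) :
    ∃ A : Fin 3 → Matrix (Fin 2) (Fin 2) k, (∀ n, A n 1 1 = -A n 0 0) ∧
      d = fun n => evenEnd (A n) (A (n + 2)) (A (n + 1)) := by
  -- The matrix of an even endomorphism on the odd part `V`.
  let A : Module.End k (B42 k) → Matrix (Fin 2) (Fin 2) k := fun d =>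
    !![(d (0, ![1, 0])).2 0, (d (0, ![0, 1])).2 0; (d (0, ![1, 0])).2 1, (d (0, ![0, 1])).2 1]
  have htr : ∀ {d : Module.End k (B42 k)}, d ∈ (S42 k).osp 0 →
      (d (0, ![0, 1])).2 1 = -(d (0, ![1, 0])).2 0 := by
    intro d hd
    have := hd.2 1 _ (odd_mem ![1, 0]) (0, ![0, 1])
    simp [S42_b_apply, B42b_apply, sgn_zero] at this
    linear_combination this
  have key : ∀ d : Fin 3 → Module.End k (B42 k), d ∈ (S42 k).triHom 0 →
      d 0 = evenEnd (A (d 0)) (A (d 2)) (A (d 1)) := by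
    intro d hd
    have ho : ∀ n v, (d n (0, v)).1 = 0 := fun n v =>
      (prodSpace_one k).1 ((hd.1 n).1 1 _ (odd_mem v))
    have hA : ∀ n, (d n (0, ![0, 1])).2 1 = -(d n (0, ![1, 0])).2 0 := fun n => htr (hd.1 n)
    have ht : ∀ u v, d 0 ((S42 k).mul (0, u) (0, v)) =
        (S42 k).mul (d 1 (0, u)) (0, v) + (S42 k).mul (0, u) (d 2 (0, v)) := by
      intro u v
      rw [hd.2 1 _ (odd_mem u), zero_mul, sgn_zero, one_smul]
    refine end_ext (fun f => ?_) (fun v => ?_)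
    · have hf : ((f, 0) : B42 k) = f 0 0 • (S42 k).mul (0, ![0, 1]) (0, ![1, 0])
          - f 0 1 • (S42 k).mul (0, ![1, 0]) (0, ![1, 0])
          + f 1 0 • (S42 k).mul (0, ![0, 1]) (0, ![0, 1])
          - f 1 1 • (S42 k).mul (0, ![1, 0]) (0, ![0, 1]) := by
        refine B42_ext ?_ ?_ ?_ ?_ ?_ ?_ <;> simp [S42_mul_apply, S42mul_apply]
      conv_lhs => rw [hf]
      simp only [map_sub, map_add, map_smul, ht]
      refine B42_ext ?_ ?_ ?_ ?_ ?_ ?_ <;>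
        simp [S42_mul_apply, S42mul_apply, evenEnd_apply, A, ho, hA] <;> ring
    · have hv : ((0, v) : B42 k) = v 0 • (0, ![1, 0]) + v 1 • (0, ![0, 1]) := by
        refine B42_ext ?_ ?_ ?_ ?_ ?_ ?_ <;> simp
      conv_lhs => rw [hv]
      simp only [map_add, map_smul]
      refine B42_ext ?_ ?_ ?_ ?_ ?_ ?_ <;> simp [evenEnd_apply, A, ho] <;> ring
  refine ⟨fun n => A (d n), fun n => htr (hd.1 n), ?_⟩
  · have k1 := key _ ((S42 k).theta_triHom hd)
    have k2 := key _ ((S42 k).theta_triHom ((S42 k).theta_triHom hd))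
    funext n
    fin_cases n
    · exact key d hd
    · exact k2
    · exact k1

/-- The odd part of `tri(S₄,₂)` is `V ⊗ V ⊗ V`. An odd orthosymplectic endomorphism is
given by a tensor, and the triality condition relates the three tensors by the cyclic permutation
of the factors. -/
lemma exists_oddEnd {d : Fin 3 → Module.End k (B42 k)} (hd : d ∈ (S42 k).triHom 1) :
    ∃ W, d = ![oddEnd W, oddEnd (rot (rot W)), oddEnd (rot W)] := by
  -- The tensor of an odd endomorphism, read off from its values on `V`.
  let G : Module.End k (B42 k) → Fin 2 → Fin 2 → Fin 2 → k := fun d =>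
    ![![![(d (0, ![0, 1])).1 0 1, (d (0, ![0, 1])).1 1 1],
        ![-(d (0, ![0, 1])).1 0 0, -(d (0, ![0, 1])).1 1 0]],
      ![![-(d (0, ![1, 0])).1 0 1, -(d (0, ![1, 0])).1 1 1],
        ![(d (0, ![1, 0])).1 0 0, (d (0, ![1, 0])).1 1 0]]]
  have h1 : ∀ d ∈ (S42 k).osp 1, d = oddEnd (G d) := by
    intro d hd
    refine end_ext (fun f => ?_) (fun v => ?_)
    · have h0 : (d (f, 0)).1 = 0 := (prodSpace_one k).1 (hd.1 0 _ (even_mem f))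
      have e1 := hd.2 0 _ (even_mem f) (0, ![1, 0])
      have e2 := hd.2 0 _ (even_mem f) (0, ![0, 1])
      simp [S42_b_apply, B42b_apply, sgn_zero, h0] at e1 e2
      refine B42_ext ?_ ?_ ?_ ?_ ?_ ?_ <;> simp [oddEnd_apply, G, h0]
      · linear_combination e2
      · linear_combination -e1
    · have h0 : ∀ v, (d (0, v)).2 = 0 := fun v => (prodSpace_zero k).1 (hd.1 1 _ (odd_mem v))
      have hv : ((0, v) : B42 k) = v 0 • (0, ![1, 0]) + v 1 • (0, ![0, 1]) := by
        refine B42_ext ?_ ?_ ?_ ?_ ?_ ?_ <;> simp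
      conv_lhs => rw [hv]
      simp only [map_add, map_smul]
      refine B42_ext ?_ ?_ ?_ ?_ ?_ ?_ <;> simp [oddEnd_apply, G, h0] <;> ring
  have h2 : ∀ d : Fin 3 → Module.End k (B42 k), d ∈ (S42 k).triHom 1 →
      G (d 2) = rot (G (d 0)) := by
    intro d hd
    have ht : ∀ f v, d 0 ((S42 k).mul (f, 0) (0, v)) =
        (S42 k).mul (d 1 (f, 0)) (0, v) + (S42 k).mul (f, 0) (d 2 (0, v)) := by
      intro f v
      rw [hd.2 0 _ (even_mem f), mul_zero, sgn_zero, one_smul]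
    have h0 : ∀ n f, (d n (f, 0)).1 = 0 := fun n f =>
      (prodSpace_one k).1 ((hd.1 n).1 0 _ (even_mem f))
    have hm : ∀ f v, (S42 k).mul (f, 0) (0, v) =
        -(f 0 0 * v 0 + f 0 1 * v 1) • (0, ![1, 0])
          - (f 1 0 * v 0 + f 1 1 * v 1) • (0, ![0, 1]) := by
      intro f v
      refine B42_ext ?_ ?_ ?_ ?_ ?_ ?_ <;> simp [S42_mul_apply, S42mul_apply] <;> ring
    have t1 := ht !![1, 0; 0, 0] ![1, 0]
    have t2 := ht !![0, 0; 1, 0] ![1, 0]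
    have t3 := ht !![0, 0; 0, 1] ![0, 1]
    have t4 := ht !![0, 1; 0, 0] ![0, 1]
    rw [hm, map_sub, map_smul, map_smul] at t1 t2 t3 t4
    have s1 := congrArg (fun x => x.1 1) t1
    have s2 := congrArg (fun x => x.1 1) t2
    have s3 := congrArg (fun x => x.1 0) t3
    have s4 := congrArg (fun x => x.1 0) t4
    funext a r p
    have r1 := congrFun s1
    have r2 := congrFun s2
    have r3 := congrFun s3
    have r4 := congrFun s4
    simp [S42_mul_apply, S42mul_apply, h0, Fin.forall_fin_two] at r1 r2 r3 r4
    fin_cases a <;> fin_cases r <;> fin_cases p <;> simp [G, rot]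
    · linear_combination -r3.2
    · linear_combination -r3.1
    · linear_combination -r4.2
    · linear_combination r4.1
    · linear_combination r2.2
    · linear_combination -r2.1
    · linear_combination -r1.2
    · linear_combination -r1.1
  refine ⟨G (d 0), ?_⟩
  have k1 := h2 d hd
  have k2 := h2 _ ((S42 k).theta_triHom hd)
  change G (d 1) = rot (G (d 2)) at k2
  funext n
  fin_cases n
  · exact h1 _ (hd.1 0)
  · exact (h1 _ (hd.1 1)).trans (by rw [k2, k1]; rfl)
  · exact (h1 _ (hd.1 2)).trans (by rw [k1]; rfl)

end Triality

/-! ### The projection of the model onto `g(S₂, S₄,₂)` -/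

section Surjective

variable {k : Type*} [Field k] [CharP k 3]

lemma t_odd_even_neg (u : Fin 2 → k) (f : Matrix (Fin 2) (Fin 2) k) (n : Fin 3) :
    (S42 k).t (0, u) (f, 0) n = -(S42 k).t (f, 0) (0, u) n := by
  have h : ∀ W : Fin 2 → Fin 2 → Fin 2 → k, oddEnd (-W) = -oddEnd W := fun W => by
    rw [← neg_one_smul k W, ← smul_oddEnd]
    exact neg_one_smul k (oddEnd W)
  rw [t_odd_even, t_even_odd]
  fin_cases n
  · exact h _
  · exact h _
  · exact h _

lemma psi_odd_even (X : Matrix (Fin 6) (Fin 6) k) (u : Trivec k) :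
    psi k (0, -act X u) = ambBr (S2 k) (S42 k) (psi k (0, u)) (psi k (X, 0)) := by
  have h : psi k (0, -act X u) = (-1 : k) • psi k (0, act X u) := by
    rw [← map_smul]
    exact congrArg _ (Prod.ext (by simp) (neg_one_smul k (act X u)).symm)
  rw [h, psi_even_odd, psi_even, psi_odd, ambBr_amb (by simp) (hasParity_evD X) (evP_mem X)
    (evM_mem X) (by simp) (hasParity_odD u) (odP_mem u) (odM_mem u),
    ambBr_amb (by simp) (hasParity_odD u) (odP_mem u) (odM_mem u)
    (by simp) (hasParity_evD X) (evP_mem X) (evM_mem X), amb_smul]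
  simp only [zero_mul, mul_zero, sgn_zero, one_smul]
  congr 1 <;> funext n
  · simp [evP, evM, odP, odM, S42_b_apply, B42b_apply]
  · simp only [evP, evM, odP, odM, t_odd_even_neg, Pi.smul_apply, Fin.sum_univ_three]
    refine (neg_one_smul k (_ : Module.End k (B42 k))).trans ?_
    abel
  · simp only [Pi.smul_apply]
    exact (neg_one_smul k _).trans (by abel)
  · simp only [Pi.smul_apply]
    exact (neg_one_smul k _).trans (by abel)

theorem psi_br (x y : Matrix (Fin 6) (Fin 6) k × Trivec k) :
    psi k ((model k).br x y) = ambBr (S2 k) (S42 k) (psi k x) (psi k y) := by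
  conv_rhs => rw [← Prod.fst_add_snd x, ← Prod.fst_add_snd y]
  simp only [map_add, LinearMap.add_apply, ← psi_even_even, ← psi_even_odd, ← psi_odd_odd,
    ← psi_odd_even]
  simp only [← map_add]
  congr 1
  rw [model_br]
  ext1
  · simp
  · simp; abel

omit [CharP k 3] in
lemma odD_eq (u : Trivec k) : odD u =
    let W := fun a r p => u.1 (ix 0 a) (ix 1 r) (ix 2 p)
    ![oddEnd W, oddEnd (rot (rot W)), oddEnd (rot W)] := by
  funext n
  fin_cases n
  · rfl
  · refine congrArg oddEnd (funext fun a => funext fun r => funext fun p => ?_)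
    change u.1 (ix 1 a) (ix 2 r) (ix 0 p) = u.1 (ix 0 p) (ix 1 a) (ix 2 r)
    rw [u.2.2, u.2.1, neg_neg]
  · refine congrArg oddEnd (funext fun a => funext fun r => funext fun p => ?_)
    change u.1 (ix 2 a) (ix 0 r) (ix 1 p) = u.1 (ix 0 r) (ix 1 p) (ix 2 a)
    rw [u.2.1, u.2.2, neg_neg]

lemma tensorProj_S2 (i : ZMod 2) (p m : B42 k) :
    (S2 k).tensorProj (S42 k).toSuperSpace i (![1, 0] ⊗ₜ p + ![0, 1] ⊗ₜ m) =
      ![1, 0] ⊗ₜ (S42 k).proj i p + ![0, 1] ⊗ₜ (S42 k).proj i m := by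
  have h0 : (S2 k).proj 0 = LinearMap.id := rfl
  have h1 : (S2 k).proj 1 = 0 := rfl
  simp only [SuperSpace.tensorProj, sum_parity, h0, h1, LinearMap.add_apply, map_add,
    TensorProduct.map_tmul, LinearMap.zero_apply, TensorProduct.zero_tmul, sub_zero, add_zero,
    LinearMap.id_apply]

omit [CharP k 3] in
lemma exists_tmul_S2 (x : (Fin 2 → k) ⊗[k] B42 k) :
    ∃ p m : B42 k, x = ![1, 0] ⊗ₜ p + ![0, 1] ⊗ₜ m := by
  induction x with
  | zero => exact ⟨0, 0, by simp⟩
  | tmul x y =>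
    refine ⟨x 0 • y, x 1 • y, ?_⟩
    rw [← TensorProduct.smul_tmul, ← TensorProduct.smul_tmul, ← TensorProduct.add_tmul]
    congr 1
    ext i; fin_cases i <;> simp
  | add x y hx hy =>
    obtain ⟨p, m, rfl⟩ := hx
    obtain ⟨p', m', rfl⟩ := hy
    refine ⟨p + p', m + m', ?_⟩
    simp only [TensorProduct.tmul_add]
    abel

omit [CharP k 3] in
lemma eq_of_tmul_S2_eq {p m p' m' : B42 k} (h : (![1, 0] ⊗ₜ p + ![0, 1] ⊗ₜ m :
    (Fin 2 → k) ⊗[k] B42 k) = ![1, 0] ⊗ₜ p' + ![0, 1] ⊗ₜ m') : p = p' ∧ m = m' := by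
  have h1 := fun i : Fin 2 => congrArg (fun z => TensorProduct.lid k (B42 k)
    (LinearMap.rTensor (B42 k) (LinearMap.proj (R := k) (φ := fun _ : Fin 2 => k) i) z)) h
  constructor
  · simpa using h1 0
  · simpa using h1 1

/-- `psi` maps the homogeneous components of the model to those of `g(S₂, S₄,₂)`. -/
lemma psi_mem {i : ZMod 2} {x : Matrix (Fin 6) (Fin 6) k × Trivec k} (hx : x ∈ (model k).gr i) :
    psi k x ∈ ((S2 k).triHom i).prod (((S42 k).triHom i).prod (Submodule.pi Set.univ fun _ =>
      LinearMap.range ((S2 k).tensorProj (S42 k).toSuperSpace i))) := by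
  obtain ⟨X, u⟩ := x
  have key : ∀ {p m : B42 k}, p ∈ (S42 k).gr i → m ∈ (S42 k).gr i →
      (![1, 0] ⊗ₜ p + ![0, 1] ⊗ₜ m : (Fin 2 → k) ⊗[k] B42 k) ∈
        LinearMap.range ((S2 k).tensorProj (S42 k).toSuperSpace i) := by
    rintro _ _ ⟨p, rfl⟩ ⟨m, rfl⟩
    exact ⟨_, tensorProj_S2 i p m⟩
  rcases prodSpace_gr k hx with ⟨rfl, h⟩ | ⟨rfl, h⟩ <;> simp only at h <;> subst h
  · rw [psi_even]
    refine ⟨diag_mem_triHom ?_, ?_, fun n _ => key (evP_mem X n) (evM_mem X n)⟩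
    · simp only [evA, Fin.reduceAdd, zero_add]; ring
    · exact evenEnd_mem_triHom (A := fun n => traceless (blk X n n)) fun n => traceless_neg _
  · rw [psi_odd]
    refine ⟨?_, ?_, fun n _ => key (odP_mem u n) (odM_mem u n)⟩
    · have e : (fun n => (0 : Fin 3 → k) n • diagEnd k) = 0 := by funext n; simp
      change (fun n => (0 : Fin 3 → k) n • diagEnd k) ∈ (S2 k).triHom 1
      rw [e]
      exact zero_mem _
    · change odD u ∈ _
      rw [odD_eq]
      exact oddEnd_mem_triHom _

/-- The coordinates of a trivector at increasing indices are arbitrary. -/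
lemma exists_trivec (g : Fin 6 → Fin 6 → Fin 6 → k) :
    ∃ u : Trivec k, ∀ x y z, x < y → y < z → u.1 x y z = g x y z := by
  refine ⟨∑ a, ∑ b, ∑ c, if a < b ∧ b < c then g a b c • basisVec k a b c else 0,
    fun x y z hxy hyz => ?_⟩
  have e : ∀ a b c : Fin 6, ((if a < b ∧ b < c then g a b c • basisVec k a b c else 0 :
      Trivec k)).1 x y z = if a = x then if b = y then if c = z then g a b c else 0 else 0
        else 0 := by
    intro a b c
    by_cases h : a < b ∧ b < c
    · simp only [if_pos h, Submodule.coe_smul, Pi.smul_apply, smul_eq_mul,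
        basisVec_apply h.1 h.2 hxy hyz, ite_and, mul_ite, mul_one, mul_zero]
    · rw [if_neg h]
      split_ifs with h1 h2 h3
      · subst h1 h2 h3; exact absurd ⟨hxy, hyz⟩ h
      all_goals simp
  simp only [Submodule.coe_sum, Finset.sum_apply, e]
  simp

lemma exists_of_mem_range_tensorProj {i : ZMod 2} {x : Fin 3 → (Fin 2 → k) ⊗[k] B42 k}
    (hx : ∀ n, x n ∈ LinearMap.range ((S2 k).tensorProj (S42 k).toSuperSpace i)) :
    ∃ p m : Fin 3 → B42 k, (∀ n, p n ∈ (S42 k).gr i) ∧ (∀ n, m n ∈ (S42 k).gr i) ∧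
      x = fun n => ![1, 0] ⊗ₜ p n + ![0, 1] ⊗ₜ m n := by
  have h : ∀ n, ∃ p m : B42 k, p ∈ (S42 k).gr i ∧ m ∈ (S42 k).gr i ∧
      x n = ![1, 0] ⊗ₜ p + ![0, 1] ⊗ₜ m := by
    intro n
    obtain ⟨y, hy⟩ := hx n
    obtain ⟨p, m, rfl⟩ := exists_tmul_S2 y
    rw [tensorProj_S2] at hy
    exact ⟨_, _, (S42 k).proj_mem _ _, (S42 k).proj_mem _ _, hy.symm⟩
  choose p m hp hm hpm using h
  exact ⟨p, m, hp, hm, funext hpm⟩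

/-- Every even element of `g(S₂, S₄,₂)` comes from the model. The trace of the upper left block of
the matrix is normalized to zero. -/
lemma exists_psi_even {w : Amb k (Fin 2 → k) (B42 k)}
    (hw : w ∈ ((S2 k).triHom 0).prod (((S42 k).triHom 0).prod (Submodule.pi Set.univ fun _ =>
      LinearMap.range ((S2 k).tensorProj (S42 k).toSuperSpace 0)))) :
    ∃ X, psi k (X, 0) = w := by
  obtain ⟨w₁, w₂, w₃⟩ := w
  obtain ⟨h1, h2, h3⟩ := hw
  simp only at h1 h2 h3
  obtain ⟨a, ha, rfl⟩ := exists_of_mem_triHom_S2 h1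
  obtain ⟨A, hA, rfl⟩ := exists_evenEnd h2
  obtain ⟨p, m, hp, hm, rfl⟩ := exists_of_mem_range_tensorProj fun n => h3 n trivial
  have hp' : ∀ n, (p n).2 = 0 := fun n => (prodSpace_zero k).1 (hp n)
  have hm' : ∀ n, (m n).2 = 0 := fun n => (prodSpace_zero k).1 (hm n)
  let X : Matrix (Fin 6) (Fin 6) k := !![A 0 0 0, A 0 0 1, -(m 2).1 1 1, (m 2).1 0 1, (p 1).1 0 0,
      (p 1).1 0 1;
    A 0 1 0, A 0 1 1, (m 2).1 1 0, -(m 2).1 0 0, (p 1).1 1 0, (p 1).1 1 1;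
    (p 2).1 0 0, (p 2).1 0 1, A 1 0 0 + a 2, A 1 0 1, -(m 0).1 1 1, (m 0).1 0 1;
    (p 2).1 1 0, (p 2).1 1 1, A 1 1 0, A 1 1 1 + a 2, (m 0).1 1 0, -(m 0).1 0 0;
    -(m 1).1 1 1, (m 1).1 0 1, (p 0).1 0 0, (p 0).1 0 1, A 2 0 0 - a 1, A 2 0 1;
    (m 1).1 1 0, -(m 1).1 0 0, (p 0).1 1 0, (p 0).1 1 1, A 2 1 0, A 2 1 1 - a 1]
  refine ⟨X, ?_⟩
  have h4 := three_eq_zero (k := k)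
  have hX : ∀ n, traceless (blk X n n) = A n := by
    intro n
    ext i j
    fin_cases n <;> fin_cases i <;> fin_cases j <;> simp [traceless, blk, ix, X, hA]
    · linear_combination (-A 0 0 0) * h4
    · linear_combination A 0 0 0 * h4
    · linear_combination (-A 1 0 0) * h4
    · linear_combination A 1 0 0 * h4
    · linear_combination (-A 2 0 0) * h4
    · linear_combination A 2 0 0 * h4
  rw [psi_even]
  change amb _ _ _ _ = amb a (fun n => evenEnd (A n) (A (n + 2)) (A (n + 1))) p m
  congr 1
  · funext n
    fin_cases n <;> simp [evA, ix, hA, X]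
    · linear_combination (a 1 + a 2) * h4 - ha
    · linear_combination (-a 1) * h4
    · linear_combination (-a 2) * h4
  · funext n
    simp only [evD, hX]
  · funext n
    refine B42_ext ?_ ?_ ?_ ?_ ?_ ?_ <;> fin_cases n <;> simp [evP, blk, ix, hp', X]
  · funext n
    refine B42_ext ?_ ?_ ?_ ?_ ?_ ?_ <;> fin_cases n <;> simp [evM, ix, hm', X]

/-- Every odd element of `g(S₂, S₄,₂)` comes from the model. -/
lemma exists_psi_odd {w : Amb k (Fin 2 → k) (B42 k)}
    (hw : w ∈ ((S2 k).triHom 1).prod (((S42 k).triHom 1).prod (Submodule.pi Set.univ fun _ =>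
      LinearMap.range ((S2 k).tensorProj (S42 k).toSuperSpace 1)))) :
    ∃ u, psi k (0, u) = w := by
  obtain ⟨w₁, w₂, w₃⟩ := w
  obtain ⟨h1, h2, h3⟩ := hw
  simp only at h1 h2 h3
  obtain rfl := eq_zero_of_mem_triHom_S2 h1
  obtain ⟨W, rfl⟩ := exists_oddEnd h2
  obtain ⟨p, m, hp, hm, rfl⟩ := exists_of_mem_range_tensorProj fun n => h3 n trivial
  have hp' : ∀ n, (p n).1 = 0 := fun n => (prodSpace_one k).1 (hp n)
  have hm' : ∀ n, (m n).1 = 0 := fun n => (prodSpace_one k).1 (hm n)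
  -- The coordinates of the trivector on the summands `⋀²Vᵢ ⊗ Vⱼ` and `V₀ ⊗ V₁ ⊗ V₂`.
  let g : Fin 3 → Fin 3 → Fin 3 → Fin 2 → Fin 2 → Fin 2 → k := fun
    | 0, 1, 2, r, s, t => W r s t
    | 0, 2, 2, r, _, _ => (p 0).2 r
    | 0, 0, 1, _, _, t => (p 1).2 t
    | 1, 1, 2, _, _, t => (p 2).2 t
    | 0, 1, 1, r, _, _ => -(m 0).2 r
    | 1, 2, 2, r, _, _ => -(m 1).2 r
    | 0, 0, 2, _, _, t => -(m 2).2 t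
    | _, _, _, _, _, _ => 0
  -- Index number `x` stands for the basis vector number `ci x` of the summand number `bi x`.
  let bi : Fin 6 → Fin 3 := ![0, 0, 1, 1, 2, 2]
  let ci : Fin 6 → Fin 2 := ![0, 1, 0, 1, 0, 1]
  obtain ⟨u, hu⟩ := exists_trivec fun x y z => g (bi x) (bi y) (bi z) (ci x) (ci y) (ci z)
  have hW : (fun a r p => u.1 (ix 0 a) (ix 1 r) (ix 2 p)) = W := by
    funext a r p
    fin_cases a <;> fin_cases r <;> fin_cases p <;> exact hu _ _ _ (by decide) (by decide)
  have c1 : ∀ a b c, u.1 a b c = u.1 b c a := fun a b c => by rw [u.2.2 b a c, u.2.1 a b c, neg_neg]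
  refine ⟨u, ?_⟩
  rw [psi_odd, odD_eq]
  simp only [hW]
  have e : (0 : Fin 3 → Module.End k (Fin 2 → k)) = fun n => (0 : Fin 3 → k) n • diagEnd k := by
    funext n; simp
  rw [e]
  change amb _ _ _ _ = amb 0 _ p m
  congr 1
  · funext n
    refine Prod.ext (hp' n).symm (funext fun i => ?_)
    fin_cases n <;> fin_cases i
    · exact hu 0 4 5 (by decide) (by decide)
    · exact hu 1 4 5 (by decide) (by decide)
    · exact (c1 _ _ _).trans (hu 0 1 2 (by decide) (by decide))
    · exact (c1 _ _ _).trans (hu 0 1 3 (by decide) (by decide))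
    · exact (c1 _ _ _).trans (hu 2 3 4 (by decide) (by decide))
    · exact (c1 _ _ _).trans (hu 2 3 5 (by decide) (by decide))
  · funext n
    refine Prod.ext (hm' n).symm (funext fun i => ?_)
    fin_cases n <;> fin_cases i <;> refine neg_eq_iff_eq_neg.2 ?_
    · exact hu 0 2 3 (by decide) (by decide)
    · exact hu 1 2 3 (by decide) (by decide)
    · exact hu 2 4 5 (by decide) (by decide)
    · exact hu 3 4 5 (by decide) (by decide)
    · exact (c1 _ _ _).trans (hu 0 1 4 (by decide) (by decide))
    · exact (c1 _ _ _).trans (hu 0 1 5 (by decide) (by decide))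

/-- The projection of the model onto `g(S₂, S₄,₂)`. -/
def toMagic (k : Type*) [Field k] [CharP k 3] :
    Matrix (Fin 6) (Fin 6) k × Trivec k →ₗ[k] Magic (S2 k) (S42 k) :=
  (psi k).codRestrict (magicSub (S2 k) (S42 k)) fun x => by
    have h0 := psi_mem ((prodSpace k _ _).proj_mem 0 x)
    have h1 := psi_mem ((prodSpace k _ _).proj_mem 1 x)
    rw [← (prodSpace k _ _).proj_add x, map_add]
    exact add_mem ⟨Submodule.mem_sup_left h0.1, Submodule.mem_sup_left h0.2.1, trivial⟩
      ⟨Submodule.mem_sup_right h1.1, Submodule.mem_sup_right h1.2.1, trivial⟩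

lemma incl_toMagic (x : Matrix (Fin 6) (Fin 6) k × Trivec k) :
    Magic.incl (S2 k) (S42 k) (toMagic k x) = psi k x := rfl

lemma incl_injective : Function.Injective (Magic.incl (S2 k) (S42 k)) :=
  Subtype.val_injective

theorem toMagic_br (x y : Matrix (Fin 6) (Fin 6) k × Trivec k) :
    toMagic k ((model k).br x y) =
      (magicAlg (S2 k) (S42 k)).br (toMagic k x) (toMagic k y) := by
  apply incl_injective
  change _ = Magic.incl _ _ (Magic.br _ _ _ _)
  rw [incl_toMagic, psi_br, Magic.incl_br, incl_toMagic, incl_toMagic]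

theorem map_toMagic_gr (i : ZMod 2) :
    ((model k).gr i).map (toMagic k) = (magicAlg (S2 k) (S42 k)).gr i := by
  refine le_antisymm (Submodule.map_le_iff_le_comap.2 fun x hx => psi_mem hx) fun w hw => ?_
  rcases parity_cases i with rfl | rfl
  · obtain ⟨X, hX⟩ := exists_psi_even hw
    exact ⟨(X, 0), (prodSpace_zero k).2 rfl, incl_injective hX⟩
  · obtain ⟨u, hu⟩ := exists_psi_odd hw
    exact ⟨(0, u), (prodSpace_one k).2 rfl, incl_injective hu⟩

lemma magic_mem_sup (w : Magic (S2 k) (S42 k)) :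
    w ∈ (magicAlg (S2 k) (S42 k)).gr 0 ⊔ (magicAlg (S2 k) (S42 k)).gr 1 := by
  obtain ⟨⟨w₁, w₂, w₃⟩, h1, h2, h3⟩ := w
  obtain ⟨a, ha, b, hb, rfl⟩ := Submodule.mem_sup.1 h1
  obtain ⟨c, hc, d, hd, rfl⟩ := Submodule.mem_sup.1 h2
  have ht : ∀ n, ∃ p m : B42 k, w₃ n = ![1, 0] ⊗ₜ p + ![0, 1] ⊗ₜ m := fun n => exists_tmul_S2 _
  choose p m hpm using ht
  obtain rfl := funext hpm
  refine Submodule.mem_sup.2 ⟨⟨(a, c, fun n => (S2 k).tensorProj (S42 k).toSuperSpace 0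
      (![1, 0] ⊗ₜ p n + ![0, 1] ⊗ₜ m n)), Submodule.mem_sup_left ha,
      Submodule.mem_sup_left hc, trivial⟩, ⟨ha, hc, fun n _ => ⟨_, rfl⟩⟩,
    ⟨(b, d, fun n => (S2 k).tensorProj (S42 k).toSuperSpace 1
      (![1, 0] ⊗ₜ p n + ![0, 1] ⊗ₜ m n)), Submodule.mem_sup_right hb,
      Submodule.mem_sup_right hd, trivial⟩, ⟨hb, hd, fun n _ => ⟨_, rfl⟩⟩, ?_⟩
  refine incl_injective (Prod.ext rfl (Prod.ext rfl (funext fun n => ?_)))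
  change (S2 k).tensorProj (S42 k).toSuperSpace 0 _ + (S2 k).tensorProj (S42 k).toSuperSpace 1 _ =
    (![1, 0] ⊗ₜ p n + ![0, 1] ⊗ₜ m n : (Fin 2 → k) ⊗[k] B42 k)
  rw [tensorProj_S2, tensorProj_S2]
  conv_rhs => rw [← (S42 k).proj_add (p n), ← (S42 k).proj_add (m n)]
  simp only [TensorProduct.tmul_add]
  abel

theorem toMagic_surjective : Function.Surjective (toMagic k) := by
  intro w
  have h := magic_mem_sup w
  rw [← map_toMagic_gr, ← map_toMagic_gr, ← Submodule.map_sup] at h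
  obtain ⟨x, -, hx⟩ := h
  exact ⟨x, hx⟩

lemma toMagic_one : toMagic k (1, 0) = 0 := by
  apply incl_injective
  have h : ∀ n, blk (1 : Matrix (Fin 6) (Fin 6) k) n n = 1 := by
    intro n; ext i j; fin_cases n <;> fin_cases i <;> fin_cases j <;> simp [blk, ix]
  have h0 : traceless (1 : Matrix (Fin 2) (Fin 2) k) = 0 := by
    ext i j; fin_cases i <;> fin_cases j <;> simp [traceless]
  have hA : evA (1 : Matrix (Fin 6) (Fin 6) k) = 0 := by funext n; simp [evA]
  have hD : evD (1 : Matrix (Fin 6) (Fin 6) k) = 0 := by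
    funext n
    simp only [evD, h, h0]
    refine LinearMap.ext fun z => ?_
    refine B42_ext ?_ ?_ ?_ ?_ ?_ ?_ <;> simp [evenEnd_apply]
  have hP : evP (1 : Matrix (Fin 6) (Fin 6) k) = 0 := by
    funext n
    refine B42_ext ?_ ?_ ?_ ?_ ?_ ?_ <;> fin_cases n <;> simp [evP, blk, ix]
  have hM : evM (1 : Matrix (Fin 6) (Fin 6) k) = 0 := by
    funext n
    refine B42_ext ?_ ?_ ?_ ?_ ?_ ?_ <;> fin_cases n <;> simp [evM, ix]
  rw [incl_toMagic, psi_even, map_zero, hA, hD, hP, hM]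
  refine Prod.ext ?_ (Prod.ext rfl ?_) <;> funext n <;> simp [amb]

lemma toMagic_eq_zero_of_even {X : Matrix (Fin 6) (Fin 6) k} (h : toMagic k (X, 0) = 0) :
    evP X = 0 := by
  have h1 := congrArg (Magic.incl (S2 k) (S42 k)) h
  rw [incl_toMagic, psi_even, map_zero] at h1
  funext n
  have h2 := congrFun (congrArg (fun w => w.2.2) h1) n
  refine (eq_of_tmul_S2_eq (p' := 0) (m' := 0) (h2.trans ?_)).1
  simp

lemma magic_gr_disjoint {x y : Magic (S2 k) (S42 k)} (hx : x ∈ (magicAlg (S2 k) (S42 k)).gr 0)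
    (hy : y ∈ (magicAlg (S2 k) (S42 k)).gr 1) (h : x = y) : x = 0 := by
  rw [← map_toMagic_gr] at hx hy
  obtain ⟨⟨X, u⟩, hX, rfl⟩ := hx
  obtain ⟨⟨Y, v⟩, hY, rfl⟩ := hy
  obtain rfl : u = 0 := (prodSpace_zero k).1 hX
  obtain rfl : Y = 0 := (prodSpace_one k).1 hY
  have h1 : psi k (X, 0) = psi k (0, v) := congrArg (Magic.incl _ _) h
  apply incl_injective
  have h2 : IsHomog (S2 k) (S42 k) 0 (psi k (X, 0)) := by
    rw [psi_even]
    exact isHomog_amb (by simp) (hasParity_evD X) (evP_mem X) (evM_mem X)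
  have h3 : IsHomog (S2 k) (S42 k) 1 (psi k (0, v)) := by
    rw [psi_odd]
    exact isHomog_amb (by simp) (hasParity_odD v) (odP_mem v) (odM_mem v)
  have h4 := h2 0
  have h5 := h3 0
  rw [← h1, h4] at h5
  rw [incl_toMagic, map_zero]
  simpa using h5

theorem toMagic_eq_zero {x : Matrix (Fin 6) (Fin 6) k × Trivec k} :
    toMagic k x = 0 ↔ ∃ c : k, x = (c • 1, 0) := by
  constructor
  · intro hx
    have hJ : SuperAlg.IsHomogeneous (model k).gr (LinearMap.ker (toMagic k)) := by
      intro x hx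
      have hp : ∀ i, (prodSpace k _ _).proj i x ∈ LinearMap.ker (toMagic k) := by
        obtain ⟨X, u⟩ := x
        have h1 : toMagic k (X, 0) + toMagic k (0, u) = 0 := by
          rw [← map_add]; simpa using hx
        have h2 := magic_gr_disjoint (map_toMagic_gr (k := k) 0 ▸
            Submodule.mem_map_of_mem ((prodSpace_zero k).2 rfl : (X, (0 : Trivec k)) ∈ _))
          (map_toMagic_gr (k := k) 1 ▸ Submodule.mem_map_of_mem (neg_mem
            ((prodSpace_one k).2 rfl : ((0 : Matrix (Fin 6) (Fin 6) k), u) ∈ _)))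
          (by rw [map_neg]; exact eq_neg_of_add_eq_zero_left h1)
        intro i
        rcases parity_cases i with rfl | rfl
        · exact h2
        · rw [h2, zero_add] at h1
          exact h1
      rw [iSup_parity, ← (prodSpace k _ _).proj_add x]
      exact add_mem (Submodule.mem_sup_left ⟨hp 0, (prodSpace k _ _).proj_mem 0 x⟩)
        (Submodule.mem_sup_right ⟨hp 1, (prodSpace k _ _).proj_mem 1 x⟩)
    rcases model_stable hJ (fun d _ x hx => by
      rw [LinearMap.mem_ker] at hx ⊢
      rw [toMagic_br, hx, map_zero]) with h | h
    · exact h x hx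
    · exfalso
      have h1 := congrFun (toMagic_eq_zero_of_even (h (Matrix.single 4 2 1, 0)
        (Matrix.trace_single_eq_of_ne _ _ _ (by decide)))) 0
      have h2 := congrArg (fun x => x.1 0 0) h1
      simp [evP, blk, ix] at h2
  · rintro ⟨c, rfl⟩
    have : ((c • 1, 0) : Matrix (Fin 6) (Fin 6) k × Trivec k) = c • (1, 0) := by simp
    rw [this, map_smul, toMagic_one, smul_zero]

end Surjective

/-! ### Homomorphisms of superalgebras -/

namespace SuperAlg

variable {k L M : Type*} [Field k] [AddCommGroup L] [Module k L] [AddCommGroup M] [Module k M]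

/-- The first isomorphism theorem for superalgebras. -/
lemma nonempty_iso_quotient {A : SuperAlg k L} {B : SuperAlg k M} (F : L →ₗ[k] M)
    (hs : Function.Surjective F) (hbr : ∀ x y, F (A.br x y) = B.br (F x) (F y))
    (hgr : ∀ i, (A.gr i).map F = B.gr i) {I : Submodule k L} (hI : A.IsIdeal I)
    (hker : LinearMap.ker F = I) : Nonempty (B.Iso (A.quotient I hI)) := by
  subst hker
  let e := F.quotKerEquivOfSurjective hs
  have he : ∀ x, e.symm (F x) = (LinearMap.ker F).mkQ x := fun x => by
    rw [LinearEquiv.symm_apply_eq]; rfl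
  refine ⟨⟨e.symm, fun x y => ?_, fun i x => ?_⟩⟩
  · obtain ⟨x, rfl⟩ := hs x
    obtain ⟨y, rfl⟩ := hs y
    rw [← hbr, he, he, he]
    rfl
  · constructor
    · rintro ⟨y, hy, h⟩
      rw [← he] at h
      rw [← e.symm.injective h, ← hgr]
      exact Submodule.mem_map_of_mem hy
    · rw [← hgr]
      rintro ⟨y, hy, rfl⟩
      rw [he]
      exact Submodule.mem_map_of_mem hy

/-- The kernel of a graded linear map is homogeneous. -/
lemma isHomogeneous_ker {ι : Type*} [DecidableEq ι] {T : ι → Submodule k L}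
    (hT : ⨆ i, T i = ⊤) (p : ι → M →ₗ[k] M) (π : L →ₗ[k] M)
    (hp : ∀ i j, ∀ x ∈ T j, p i (π x) = if i = j then π x else 0) :
    IsHomogeneous T (LinearMap.ker π) := by
  intro x hx
  have h1 : x ∈ ⨆ i, T i := hT ▸ Submodule.mem_top
  obtain ⟨f, hf, rfl⟩ := (Submodule.mem_iSup_iff_exists_finsupp _ _).1 h1
  rw [Finsupp.sum]
  refine Submodule.sum_mem _ fun i _ => Submodule.mem_iSup_of_mem i ⟨?_, hf i⟩
  by_cases hi : i ∈ f.support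
  · have h2 := congrArg (p i) (LinearMap.mem_ker.1 hx)
    rw [Finsupp.sum, map_sum, map_sum, map_zero] at h2
    simp only [fun j => hp i j _ (hf j)] at h2
    rwa [Finset.sum_ite_eq, if_pos hi] at h2
  · rw [Finsupp.notMem_support_iff.1 hi]
    exact zero_mem _

end SuperAlg

/-! ### Recognition of contragredient Lie superalgebras -/

section Recognition

variable {k : Type*} [Field k] {n : ℕ} {H : Type*} [AddCommGroup H] [Module k H]
  {M : Type*} [AddCommGroup M] [Module k M]

/-- The space of a superalgebra, as a nonassociative algebra. -/
def BrAlg (_ : SuperAlg k M) : Type _ := M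

instance (B : SuperAlg k M) : AddCommGroup (BrAlg B) := inferInstanceAs (AddCommGroup M)

instance (B : SuperAlg k M) : Module k (BrAlg B) := inferInstanceAs (Module k M)

instance (B : SuperAlg k M) : NonUnitalNonAssocRing (BrAlg B) where
  mul x y := (B.br x y : M)
  left_distrib x y z := map_add (B.br x) y z
  right_distrib x y z := LinearMap.map_add₂ B.br x y z
  zero_mul x := LinearMap.map_zero₂ B.br x
  mul_zero x := map_zero (B.br x)

instance (B : SuperAlg k M) : IsScalarTower k (BrAlg B) (BrAlg B) where
  smul_assoc c x y := LinearMap.map_smul₂ B.br c x y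

instance (B : SuperAlg k M) : SMulCommClass k (BrAlg B) (BrAlg B) where
  smul_comm c x y := ((B.br x).map_smul c y).symm

/-- Elements of a `ℤ`-graded Lie superalgebra that satisfy the relations of `𝔤̃(A, τ)`, together
with the properties that identify this superalgebra with `𝔤(A, τ)`: it is generated by these
elements, and no nonzero graded ideal has zero component in degree `0`. The grading is given by its
components and the projections onto them; that the components span the space follows from
`generate`. -/
structure ChevalleyData {A : Matrix (Fin n) (Fin n) k} (R : Realization A H) (τ : Finset (Fin n))
    (B : SuperAlg k M) where
  lie : B.IsLieSuperalgebra
  h : H →ₗ[k] M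
  e : Fin n → M
  f : Fin n → M
  h_even : ∀ x, h x ∈ B.gr 0
  e_parity : ∀ i, e i ∈ B.gr (if i ∈ τ then 1 else 0)
  f_parity : ∀ i, f i ∈ B.gr (if i ∈ τ then 1 else 0)
  e_f : ∀ i j, B.br (e i) (f j) = if i = j then h (R.coroot i) else 0
  h_h : ∀ x y, B.br (h x) (h y) = 0
  h_e : ∀ x i, B.br (h x) (e i) = R.root i x • e i
  h_f : ∀ x i, B.br (h x) (f i) = -(R.root i x • f i)
  deg : ℤ → Submodule k M
  degProj : ℤ → M →ₗ[k] M
  degProj_of_mem : ∀ i j, ∀ x ∈ deg j, degProj i x = if i = j then x else 0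
  br_deg : ∀ i j, ∀ x ∈ deg i, ∀ y ∈ deg j, B.br x y ∈ deg (i + j)
  h_deg : ∀ x, h x ∈ deg 0
  e_deg : ∀ i, e i ∈ deg 1
  f_deg : ∀ i, f i ∈ deg (-1)
  h_injective : Function.Injective h
  generate : ∀ N : Submodule k M, (∀ x ∈ N, ∀ y ∈ N, B.br x y ∈ N) → (∀ x, h x ∈ N) →
    (∀ i, e i ∈ N) → (∀ i, f i ∈ N) → N = ⊤
  ideal : ∀ J, B.IsGradedIdeal J → (∀ x ∈ J, degProj 0 x = 0) → J = ⊥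

/-- The free nonassociative algebra on the generators of `𝔤̃(A, τ)`. -/
abbrev FreeGen (k : Type*) [Field k] (n : ℕ) (H : Type*) : Type _ :=
  FreeNonUnitalNonAssocAlgebra k (Gen n H)

omit [AddCommGroup H] [Module k H] in
lemma word_mul (a b : FreeMagma (Gen n H)) :
    MonoidAlgebra.ofMagma k (FreeMagma (Gen n H)) (a * b) =
      MonoidAlgebra.ofMagma k (FreeMagma (Gen n H)) a *
        MonoidAlgebra.ofMagma k (FreeMagma (Gen n H)) b :=
  map_mul _ _ _

omit [AddCommGroup H] [Module k H] in
lemma iSup_freeGr {G : Type*} [Add G] (d : Gen n H → G) : ⨆ g, freeGr k d g = ⊤ := by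
  refine eq_top_iff.2 fun x _ => ?_
  induction x using MonoidAlgebra.induction_linear with
  | zero => exact zero_mem _
  | add x y hx hy => exact add_mem (hx trivial) (hy trivial)
  | single a c =>
    have : (MonoidAlgebra.single a c : FreeGen k n H) =
        c • MonoidAlgebra.ofMagma k (FreeMagma (Gen n H)) a := by
      simp [MonoidAlgebra.ofMagma]
    rw [this]
    exact Submodule.smul_mem _ _ (Submodule.mem_iSup_of_mem (wordDeg d a)
      (Submodule.subset_span ⟨a, rfl, rfl⟩))

namespace Realization

variable {A : Matrix (Fin n) (Fin n) k} (R : Realization A H) (τ : Finset (Fin n))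

lemma mkQ_rel {x : FreeGen k n H} (hx : R.Rel τ x) : (R.relIdeal τ).mkQ x = 0 := by
  rw [Submodule.mkQ_apply, Submodule.Quotient.mk_eq_zero]
  exact Submodule.mem_sInf.2 fun I hI => hI.2 x hx

lemma tilde_br_mkQ (x y : FreeGen k n H) : (R.tilde τ).br ((R.relIdeal τ).mkQ x)
    ((R.relIdeal τ).mkQ y) =
    (R.relIdeal τ).mkQ (x * y) := rfl

/-- The Jacobi identity in `𝔤̃(A, τ)`. -/
lemma tilde_jacobi {i j : ZMod 2} {x y : FreeGen k n H} (hx : x ∈ (freeAlg k H τ).gr i)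
    (hy : y ∈ (freeAlg k H τ).gr j) (z : FreeGen k n H ⧸ R.relIdeal τ) :
    (R.tilde τ).br ((R.tilde τ).br ((R.relIdeal τ).mkQ x) ((R.relIdeal τ).mkQ y)) z =
      (R.tilde τ).br ((R.relIdeal τ).mkQ x) ((R.tilde τ).br ((R.relIdeal τ).mkQ y) z)
      - sgn k (i * j) •
        (R.tilde τ).br ((R.relIdeal τ).mkQ y) ((R.tilde τ).br ((R.relIdeal τ).mkQ x) z) := by
  obtain ⟨z, rfl⟩ := (R.relIdeal τ).mkQ_surjective z
  have h := R.mkQ_rel τ (Rel.jacobi i j x y z hx hy)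
  rw [map_sub, map_sub, map_smul, sub_eq_zero] at h
  exact h

/-- The generators of `𝔤̃(A, τ)`. -/
def tgen (g : Gen n H) : FreeGen k n H ⧸ R.relIdeal τ :=
  (R.relIdeal τ).mkQ (FreeNonUnitalNonAssocAlgebra.of k g)

omit [AddCommGroup H] [Module k H] in
lemma of_mem_gr (g : Gen n H) :
    FreeNonUnitalNonAssocAlgebra.of k g ∈ (freeAlg k H τ).gr (g.parity τ) :=
  Submodule.subset_span ⟨FreeMagma.of g, rfl, rfl⟩

lemma tgen_jacobi (g g' : Gen n H) (z : FreeGen k n H ⧸ R.relIdeal τ) :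
    (R.tilde τ).br ((R.tilde τ).br (R.tgen τ g) (R.tgen τ g')) z =
      (R.tilde τ).br (R.tgen τ g) ((R.tilde τ).br (R.tgen τ g') z)
      - sgn k (g.parity τ * g'.parity τ) •
        (R.tilde τ).br (R.tgen τ g') ((R.tilde τ).br (R.tgen τ g) z) :=
  R.tilde_jacobi τ (of_mem_gr τ g) (of_mem_gr τ g') z

lemma tgen_skew (g g' : Gen n H) : (R.tilde τ).br (R.tgen τ g) (R.tgen τ g') =
    -(sgn k (g.parity τ * g'.parity τ) • (R.tilde τ).br (R.tgen τ g') (R.tgen τ g)) := by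
  have h := R.mkQ_rel τ (Rel.skew _ _ _ _ (of_mem_gr τ g) (of_mem_gr τ g'))
  rw [map_add, map_smul] at h
  exact eq_neg_of_add_eq_zero_left h

lemma tgen_h_add (x y : H) : R.tgen τ (.h (x + y)) = R.tgen τ (.h x) + R.tgen τ (.h y) := by
  have h := R.mkQ_rel τ (Rel.h_add x y)
  rw [map_sub, map_add, sub_eq_zero] at h
  exact h

lemma tgen_h_smul (c : k) (x : H) : R.tgen τ (.h (c • x)) = c • R.tgen τ (.h x) := by
  have h := R.mkQ_rel τ (Rel.h_smul c x)
  rw [map_sub, map_smul, sub_eq_zero] at h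
  exact h

lemma tgen_e_f (i j : Fin n) : (R.tilde τ).br (R.tgen τ (.e i)) (R.tgen τ (.f j)) =
    if i = j then R.tgen τ (.h (R.coroot i)) else 0 := by
  have h := R.mkQ_rel τ (Rel.e_f i j)
  rw [map_sub, sub_eq_zero] at h
  refine h.trans ?_
  split_ifs
  · rfl
  · exact map_zero _

lemma tgen_h_h (x y : H) : (R.tilde τ).br (R.tgen τ (.h x)) (R.tgen τ (.h y)) = 0 :=
  R.mkQ_rel τ (Rel.h_h x y)

lemma tgen_h_e (x : H) (i : Fin n) : (R.tilde τ).br (R.tgen τ (.h x)) (R.tgen τ (.e i)) =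
    R.root i x • R.tgen τ (.e i) := by
  have h := R.mkQ_rel τ (Rel.h_e x i)
  rw [map_sub, map_smul, sub_eq_zero] at h
  exact h

lemma tgen_h_f (x : H) (i : Fin n) : (R.tilde τ).br (R.tgen τ (.h x)) (R.tgen τ (.f i)) =
    -R.root i x • R.tgen τ (.f i) := by
  have h := R.mkQ_rel τ (Rel.h_f x i)
  rw [map_add, map_smul] at h
  rw [neg_smul]
  exact eq_neg_of_add_eq_zero_left h

/-- The map `𝔥 → 𝔤̃(A, τ)`. -/
def tildeH : H →ₗ[k] FreeGen k n H ⧸ R.relIdeal τ where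
  toFun x := R.tgen τ (.h x)
  map_add' := R.tgen_h_add τ
  map_smul' := R.tgen_h_smul τ

lemma cartan_eq : R.cartan τ = LinearMap.range (R.tildeH τ) := by
  refine le_antisymm (Submodule.map_le_iff_le_comap.2 (Submodule.span_le.2 ?_)) ?_
  · rintro _ ⟨x, rfl⟩
    exact ⟨x, rfl⟩
  · rintro _ ⟨x, rfl⟩
    exact Submodule.mem_map_of_mem (Submodule.subset_span ⟨x, rfl⟩)

end Realization

/-! ### The triangular decomposition -/

/-- The sums of the elements `E_{i₁} ⋯ E_{i_m} c` with `c ∈ C`. -/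
def iter {V : Type*} [AddCommGroup V] [Module k V] (E : Fin n → Module.End k V)
    (C : Submodule k V) : ℕ → Submodule k V
  | 0 => C
  | m + 1 => ⨆ i, (iter E C m).map (E i)

section Iter

variable {V : Type*} [AddCommGroup V] [Module k V] {E F : Fin n → Module.End k V}
  {D : H → Module.End k V} {C : Submodule k V}

lemma mem_iter_succ (i : Fin n) {m : ℕ} {x : V} (hx : x ∈ iter E C m) :
    E i x ∈ iter E C (m + 1) :=
  Submodule.mem_iSup_of_mem i (Submodule.mem_map_of_mem hx)

lemma iter_succ_le {m : ℕ} {N : Submodule k V} (h : ∀ i, ∀ x ∈ iter E C m, E i x ∈ N) :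
    iter E C (m + 1) ≤ N :=
  iSup_le fun i => Submodule.map_le_iff_le_comap.2 (h i)

omit [AddCommGroup H] [Module k H] in
lemma iter_h_mem (hC : ∀ h, ∀ x ∈ C, D h x ∈ C)
    (hDE : ∀ h i, ∃ c : k, ∀ z, D h (E i z) = c • E i z + E i (D h z)) (h : H) (m : ℕ) :
    ∀ x ∈ iter E C m, D h x ∈ iter E C m := by
  induction m with
  | zero => exact hC h
  | succ m ih =>
    refine iter_succ_le (N := (iter E C (m + 1)).comap (D h)) fun i x hx => ?_
    obtain ⟨c, hc⟩ := hDE h i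
    rw [Submodule.mem_comap, hc]
    exact add_mem (Submodule.smul_mem _ _ (mem_iter_succ i hx)) (mem_iter_succ i (ih x hx))

omit [AddCommGroup H] [Module k H] in
lemma iter_f_mem (hC : ∀ h, ∀ x ∈ C, D h x ∈ C)
    (hDE : ∀ h i, ∃ c : k, ∀ z, D h (E i z) = c • E i z + E i (D h z))
    (hFE : ∀ j i, ∃ (c s : k) (h : H), ∀ z, F j (E i z) = c • D h z + s • E i (F j z))
    (hFE₀ : ∀ j i, ∀ z ∈ C, F j (E i z) ∈ C) (j : Fin n) (m : ℕ) :
    ∀ x ∈ iter E C (m + 1), F j x ∈ iter E C m := by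
  induction m with
  | zero => exact iter_succ_le (N := C.comap (F j)) (hFE₀ j)
  | succ m ih =>
    refine iter_succ_le (N := (iter E C (m + 1)).comap (F j)) fun i x hx => ?_
    obtain ⟨c, s, h, hc⟩ := hFE j i
    rw [Submodule.mem_comap, hc]
    exact add_mem (Submodule.smul_mem _ _ (iter_h_mem hC hDE h _ x hx))
      (Submodule.smul_mem _ _ (mem_iter_succ i (ih x hx)))

end Iter

namespace Realization

variable {A : Matrix (Fin n) (Fin n) k} (R : Realization A H) (τ : Finset (Fin n))

/-- The operator `ad x` on `𝔤̃(A, τ)`, for a generator `x`. -/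
abbrev adGen (g : Gen n H) : Module.End k (FreeGen k n H ⧸ R.relIdeal τ) :=
  (R.tilde τ).br (R.tgen τ g)

/-- The candidate for the component of degree `m` of `𝔤̃(A, τ)`: the iterated brackets of `m`
generators `e_i`, or `-m` generators `f_i`, with elements of `𝔥`. -/
def tri (m : ℤ) : Submodule k (FreeGen k n H ⧸ R.relIdeal τ) :=
  if 0 ≤ m then iter (fun i => R.adGen τ (.e i)) (R.cartan τ) m.toNat
  else iter (fun i => R.adGen τ (.f i)) (R.cartan τ) (-m).toNat

lemma tri_natCast (m : ℕ) :
    R.tri τ m = iter (fun i => R.adGen τ (.e i)) (R.cartan τ) m := by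
  rw [tri, if_pos (Int.natCast_nonneg m), Int.toNat_natCast]

lemma tri_neg_natCast (m : ℕ) :
    R.tri τ (-m) = iter (fun i => R.adGen τ (.f i)) (R.cartan τ) m := by
  cases m with
  | zero => rw [Nat.cast_zero, neg_zero, ← Nat.cast_zero, tri_natCast, iter, iter]
  | succ m => rw [tri, if_neg (by omega), neg_neg, Int.toNat_natCast]

lemma ad_h_cartan (h : H) : ∀ x ∈ R.cartan τ, R.adGen τ (.h h) x ∈ R.cartan τ := by
  rw [cartan_eq]
  rintro _ ⟨x, rfl⟩
  change (R.tilde τ).br (R.tgen τ (.h h)) (R.tgen τ (.h x)) ∈ _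
  rw [tgen_h_h]
  exact zero_mem _

lemma ad_h_e (h : H) (i : Fin n) : ∃ c : k, ∀ z,
    R.adGen τ (.h h) (R.adGen τ (.e i) z) = c • R.adGen τ (.e i) z + R.adGen τ (.e i)
        (R.adGen τ (.h h) z) := by
  refine ⟨R.root i h, fun z => ?_⟩
  have h1 := R.tgen_jacobi τ (.h h) (.e i) z
  rw [tgen_h_e, map_smul, LinearMap.smul_apply, Gen.parity, zero_mul, sgn_zero, one_smul] at h1
  rw [h1, sub_add_cancel]

lemma ad_h_f (h : H) (i : Fin n) : ∃ c : k, ∀ z,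
    R.adGen τ (.h h) (R.adGen τ (.f i) z) = c • R.adGen τ (.f i) z + R.adGen τ (.f i)
        (R.adGen τ (.h h) z) := by
  refine ⟨-R.root i h, fun z => ?_⟩
  have h1 := R.tgen_jacobi τ (.h h) (.f i) z
  rw [tgen_h_f, map_smul, LinearMap.smul_apply, Gen.parity, zero_mul, sgn_zero, one_smul] at h1
  rw [h1, sub_add_cancel]

lemma ad_e_f (i j : Fin n) : ∃ (c s : k) (h : H), ∀ z,
    R.adGen τ (.e i) (R.adGen τ (.f j) z) = c • R.adGen τ (.h h) z + s • R.adGen τ (.f j)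
        (R.adGen τ (.e i) z) := by
  refine ⟨if i = j then 1 else 0,
    sgn k ((Gen.e i : Gen n H).parity τ * (Gen.f j : Gen n H).parity τ), R.coroot i, fun z => ?_⟩
  have h1 := R.tgen_jacobi τ (.e i) (.f j) z
  rw [tgen_e_f, eq_comm, sub_eq_iff_eq_add] at h1
  rw [h1]
  split_ifs
  · rw [one_smul]
  · rw [map_zero, LinearMap.zero_apply, zero_smul]

lemma ad_f_e (j i : Fin n) : ∃ (c s : k) (h : H), ∀ z,
    R.adGen τ (.f j) (R.adGen τ (.e i) z) = c • R.adGen τ (.h h) z + s • R.adGen τ (.e i)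
        (R.adGen τ (.f j) z) := by
  obtain ⟨c, s, h, hc⟩ := R.ad_e_f τ i j
  have h1 := R.tgen_jacobi τ (.f j) (.e i)
  have h2 := R.tgen_skew τ (.f j) (.e i)
  rw [tgen_e_f] at h2
  refine ⟨if i = j then -sgn k ((Gen.f j : Gen n H).parity τ * (Gen.e i : Gen n H).parity τ)
    else 0, sgn k ((Gen.f j : Gen n H).parity τ * (Gen.e i : Gen n H).parity τ), R.coroot i,
        fun z => ?_⟩
  have h3 := h1 z
  rw [h2, eq_comm, sub_eq_iff_eq_add] at h3
  rw [h3]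
  split_ifs
  · simp only [map_neg, map_smul, LinearMap.neg_apply, LinearMap.smul_apply, neg_smul]
  · simp

lemma ad_e_cartan (i : Fin n) : ∀ x ∈ R.cartan τ, ∃ c : k, R.adGen τ (.e i) x =
    c • R.tgen τ (.e i) := by
  rw [cartan_eq]
  rintro _ ⟨x, rfl⟩
  change ∃ c : k, (R.tilde τ).br (R.tgen τ (.e i)) (R.tgen τ (.h x)) = _
  rw [tgen_skew, tgen_h_e, smul_smul]
  exact ⟨_, (neg_smul _ _).symm⟩

lemma ad_f_cartan (i : Fin n) : ∀ x ∈ R.cartan τ, ∃ c : k, R.adGen τ (.f i) x =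
    c • R.tgen τ (.f i) := by
  rw [cartan_eq]
  rintro _ ⟨x, rfl⟩
  change ∃ c : k, (R.tilde τ).br (R.tgen τ (.f i)) (R.tgen τ (.h x)) = _
  rw [tgen_skew, tgen_h_f, smul_smul]
  exact ⟨_, (neg_smul _ _).symm⟩

lemma ad_e_f_cartan (i j : Fin n) : ∀ x ∈ R.cartan τ, R.adGen τ (.e i)
    (R.adGen τ (.f j) x) ∈ R.cartan τ := by
  intro x hx
  obtain ⟨c, hc⟩ := R.ad_f_cartan τ j x hx
  rw [hc, map_smul, tgen_e_f, cartan_eq]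
  refine Submodule.smul_mem _ _ ?_
  split_ifs
  · exact ⟨_, rfl⟩
  · exact zero_mem _

lemma ad_f_e_cartan (j i : Fin n) : ∀ x ∈ R.cartan τ, R.adGen τ (.f j)
    (R.adGen τ (.e i) x) ∈ R.cartan τ := by
  intro x hx
  obtain ⟨c, hc⟩ := R.ad_e_cartan τ i x hx
  rw [hc, map_smul, tgen_skew, tgen_e_f, cartan_eq]
  refine Submodule.smul_mem _ _ (neg_mem (Submodule.smul_mem _ _ ?_))
  split_ifs
  · exact ⟨_, rfl⟩
  · exact zero_mem _

lemma ad_mem_tri (g : Gen n H) (m : ℤ) : ∀ x ∈ R.tri τ m, R.adGen τ g x ∈ R.tri τ (g.deg + m) := by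
  cases g with
  | h h =>
    rw [Gen.deg, zero_add]
    obtain ⟨m, rfl | rfl⟩ := m.eq_nat_or_neg
    · rw [tri_natCast]
      exact iter_h_mem (R.ad_h_cartan τ) (R.ad_h_e τ) h m
    · rw [tri_neg_natCast]
      exact iter_h_mem (R.ad_h_cartan τ) (R.ad_h_f τ) h m
  | e i =>
    rw [Gen.deg]
    obtain ⟨m, rfl | rfl⟩ := m.eq_nat_or_neg
    · rw [show (1 : ℤ) + (m : ℤ) = ((m + 1 : ℕ) : ℤ) by push_cast; ring, tri_natCast, tri_natCast]
      exact fun x hx => mem_iter_succ i hx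
    · cases m with
      | zero =>
        rw [show (1 : ℤ) + -((0 : ℕ) : ℤ) = ((0 + 1 : ℕ) : ℤ) by simp, tri_neg_natCast, tri_natCast]
        intro x hx
        rw [iter] at hx
        exact mem_iter_succ (m := 0) i (by rwa [iter])
      | succ m =>
        rw [show (1 : ℤ) + -((m + 1 : ℕ) : ℤ) = -(m : ℤ) by push_cast; ring, tri_neg_natCast,
          tri_neg_natCast]
        exact iter_f_mem (R.ad_h_cartan τ) (R.ad_h_f τ) (R.ad_e_f τ) (R.ad_e_f_cartan τ) i m
  | f i =>
    rw [Gen.deg]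
    obtain ⟨m, rfl | rfl⟩ := m.eq_nat_or_neg
    · cases m with
      | zero =>
        rw [show (-1 : ℤ) + ((0 : ℕ) : ℤ) = -((0 + 1 : ℕ) : ℤ) by simp, tri_neg_natCast,
            tri_natCast]
        intro x hx
        rw [iter] at hx
        exact mem_iter_succ (m := 0) i (by rwa [iter])
      | succ m =>
        rw [show (-1 : ℤ) + ((m + 1 : ℕ) : ℤ) = (m : ℤ) by push_cast; ring, tri_natCast,
          tri_natCast]
        exact iter_f_mem (R.ad_h_cartan τ) (R.ad_h_e τ) (R.ad_f_e τ) (R.ad_f_e_cartan τ) i m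
    · rw [show (-1 : ℤ) + -(m : ℤ) = -((m + 1 : ℕ) : ℤ) by push_cast; ring, tri_neg_natCast,
        tri_neg_natCast]
      exact fun x hx => mem_iter_succ i hx

lemma exists_root_eq_one (i : Fin n) : ∃ x, R.root i x = 1 := by
  obtain ⟨x, hx⟩ : ∃ x, R.root i x ≠ 0 := by
    by_contra h
    push Not at h
    exact R.root_indep.ne_zero i (LinearMap.ext h)
  exact ⟨(R.root i x)⁻¹ • x, by simp [hx]⟩

/-- The generators `e_i` and `f_i` are brackets with elements of `𝔥`, because the roots are not
zero. -/
lemma tgen_mem_tri (g : Gen n H) : R.tgen τ g ∈ R.tri τ g.deg := by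
  have hmem : ∀ x, R.tgen τ (.h x) ∈ R.tri τ 0 := fun x => by
    rw [show (0 : ℤ) = ((0 : ℕ) : ℤ) from rfl, tri_natCast, iter, cartan_eq]
    exact ⟨x, rfl⟩
  cases g with
  | h x => exact hmem x
  | e i =>
    obtain ⟨x, hx⟩ := R.exists_root_eq_one i
    have h1 := R.ad_mem_tri τ (.e i) 0 _ (hmem x)
    rw [tgen_skew, tgen_h_e, hx, one_smul, neg_mem_iff] at h1
    simpa [Gen.parity, sgn_zero] using h1
  | f i =>
    obtain ⟨x, hx⟩ := R.exists_root_eq_one i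
    have h1 := R.ad_mem_tri τ (.f i) 0 _ (hmem x)
    rw [tgen_skew, tgen_h_f, hx, neg_smul, one_smul, smul_neg, neg_neg] at h1
    simpa [Gen.parity, sgn_zero] using h1

omit [AddCommGroup H] [Module k H] in
lemma word_mem_gr (a : FreeMagma (Gen n H)) :
    MonoidAlgebra.ofMagma k (FreeMagma (Gen n H)) a ∈
      (freeAlg k H τ).gr (wordDeg (Gen.parity τ) a) :=
  Submodule.subset_span ⟨a, rfl, rfl⟩

/-- The candidates for the homogeneous components are compatible with all products. This is
where the Jacobi identity reduces nested words to iterated brackets of generators. -/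
lemma ad_word_mem_tri (a : FreeMagma (Gen n H)) : ∀ (m : ℤ), ∀ x ∈ R.tri τ m,
    (R.tilde τ).br ((R.relIdeal τ).mkQ (MonoidAlgebra.ofMagma k (FreeMagma (Gen n H)) a)) x ∈
      R.tri τ (wordDeg Gen.deg a + m) := by
  induction a with
  | ih1 g => exact R.ad_mem_tri τ g
  | ih2 a b iha ihb =>
    intro m x hx
    rw [word_mul, ← tilde_br_mkQ, R.tilde_jacobi τ (word_mem_gr τ a) (word_mem_gr τ b)]
    have h1 := iha _ _ (ihb _ _ hx)
    have h2 := ihb _ _ (iha _ _ hx)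
    rw [← add_assoc] at h1 h2
    rw [add_comm (wordDeg Gen.deg b)] at h2
    exact sub_mem h1 (Submodule.smul_mem _ _ h2)

/-- The component of degree `0` of `𝔤̃(A, τ)` is `𝔥`. -/
theorem tildeDeg_zero_le : R.tildeDeg τ 0 ≤ R.cartan τ := by
  have key : ∀ a : FreeMagma (Gen n H), (R.relIdeal τ).mkQ
      (MonoidAlgebra.ofMagma k (FreeMagma (Gen n H)) a) ∈ R.tri τ (wordDeg Gen.deg a) := by
    intro a
    induction a with
    | ih1 g => exact R.tgen_mem_tri τ g
    | ih2 a b iha ihb =>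
      rw [word_mul, ← tilde_br_mkQ]
      exact R.ad_word_mem_tri τ a _ _ ihb
  refine Submodule.map_le_iff_le_comap.2 (Submodule.span_le.2 ?_)
  rintro _ ⟨a, ha, rfl⟩
  have h := key a
  rw [ha, show (0 : ℤ) = ((0 : ℕ) : ℤ) from rfl, tri_natCast, iter] at h
  exact h

end Realization
end Recognition

namespace ChevalleyData

variable {k : Type*} [Field k] {n : ℕ} {H : Type*} [AddCommGroup H] [Module k H]
  {M : Type*} [AddCommGroup M] [Module k M] {A : Matrix (Fin n) (Fin n) k} {R : Realization A H}
  {τ : Finset (Fin n)} {B : SuperAlg k M} (d : ChevalleyData R τ B)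

/-- The images of the generators. -/
def gen : Gen n H → M
  | .h x => d.h x
  | .e i => d.e i
  | .f i => d.f i

/-- The homomorphism from the free algebra that extends `gen`. -/
def freeMap : FreeGen k n H →ₗ[k] M :=
  ((FreeNonUnitalNonAssocAlgebra.lift k (A := BrAlg B) d.gen : FreeGen k n H →ₙₐ[k] BrAlg B) :
    FreeGen k n H →ₗ[k] BrAlg B)

lemma freeMap_of (g : Gen n H) : d.freeMap (FreeNonUnitalNonAssocAlgebra.of k g) = d.gen g :=
  FreeNonUnitalNonAssocAlgebra.lift_of_apply k (A := BrAlg B) d.gen g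

lemma freeMap_mul (x y : FreeGen k n H) :
    d.freeMap (x * y) = B.br (d.freeMap x) (d.freeMap y) :=
  map_mul (FreeNonUnitalNonAssocAlgebra.lift k (A := BrAlg B) d.gen) x y

lemma gen_mem_gr (g : Gen n H) : d.gen g ∈ B.gr (g.parity τ) := by
  cases g with
  | h x => exact d.h_even x
  | e i => exact d.e_parity i
  | f i => exact d.f_parity i

lemma gen_mem_deg (g : Gen n H) : d.gen g ∈ d.deg g.deg := by
  cases g with
  | h x => exact d.h_deg x
  | e i => exact d.e_deg i
  | f i => exact d.f_deg i

lemma freeMap_mem {G : Type*} [Add G] {δ : Gen n H → G} {N : G → Submodule k M}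
    (h : ∀ g, d.gen g ∈ N (δ g)) (hN : ∀ i j, ∀ x ∈ N i, ∀ y ∈ N j, B.br x y ∈ N (i + j)) (i : G) :
    ∀ x ∈ freeGr k δ i, d.freeMap x ∈ N i := by
  have key : ∀ a : FreeMagma (Gen n H),
      d.freeMap (MonoidAlgebra.ofMagma k (FreeMagma (Gen n H)) a) ∈ N (wordDeg δ a) := by
    intro a
    induction a with
    | ih1 g => exact (d.freeMap_of g).symm ▸ h g
    | ih2 a b iha ihb =>
      rw [word_mul, freeMap_mul]
      exact hN _ _ _ iha _ ihb
  refine fun x hx => (Submodule.span_le (p := (N i).comap d.freeMap)).2 ?_ hx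
  rintro _ ⟨a, rfl, rfl⟩
  exact key a

lemma freeMap_mem_gr {i : ZMod 2} {x : FreeGen k n H} (hx : x ∈ (freeAlg k H τ).gr i) :
    d.freeMap x ∈ B.gr i :=
  d.freeMap_mem d.gen_mem_gr d.lie.br_mem i x hx

lemma freeMap_rel {x : FreeGen k n H} (hx : R.Rel τ x) : d.freeMap x = 0 := by
  cases hx with
  | skew i j a b ha hb =>
    rw [map_add, map_smul, freeMap_mul, freeMap_mul,
      d.lie.skew i j _ (d.freeMap_mem_gr ha) _ (d.freeMap_mem_gr hb), neg_add_cancel]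
  | jacobi i j a b c ha hb =>
    have h : ∀ z, B.br (B.br (d.freeMap a) (d.freeMap b)) z =
        B.br (d.freeMap a) (B.br (d.freeMap b) z)
          - sgn k (i * j) • B.br (d.freeMap b) (B.br (d.freeMap a) z) := by
      intro z
      have hz : z ∈ B.gr 0 ⊔ B.gr 1 := d.lie.isCompl.sup_eq_top ▸ Submodule.mem_top
      obtain ⟨y, hy, w, hw, rfl⟩ := Submodule.mem_sup.1 hz
      have h0 := d.lie.jacobi i j 0 _ (d.freeMap_mem_gr ha) _ (d.freeMap_mem_gr hb) y hy
      have h1 := d.lie.jacobi i j 1 _ (d.freeMap_mem_gr ha) _ (d.freeMap_mem_gr hb) w hw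
      simp only [map_add, h0, h1, smul_add]
      abel
    simp only [map_sub, map_smul, freeMap_mul, h, sub_self]
  | odd_cube a ha => rw [freeMap_mul, freeMap_mul, d.lie.odd_cube _ (d.freeMap_mem_gr ha)]
  | h_add x y =>
    simp only [map_sub, map_add, freeMap_of, gen, sub_self]
  | h_smul c x => simp only [map_sub, map_smul, freeMap_of, gen, sub_self]
  | e_f i j =>
    rw [map_sub, freeMap_mul, freeMap_of, freeMap_of, gen, gen, d.e_f]
    split_ifs
    · rw [freeMap_of, gen, sub_self]
    · rw [map_zero, sub_zero]
  | h_h x y => rw [freeMap_mul, freeMap_of, freeMap_of, gen, gen, d.h_h]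
  | h_e x i =>
    rw [map_sub, map_smul, freeMap_mul, freeMap_of, freeMap_of, gen, gen, d.h_e, sub_self]
  | h_f x i =>
    rw [map_add, map_smul, freeMap_mul, freeMap_of, freeMap_of, gen, gen, d.h_f, neg_add_cancel]

lemma relIdeal_le : R.relIdeal τ ≤ LinearMap.ker d.freeMap := by
  refine sInf_le ⟨fun x y hy => ?_, fun x hx => d.freeMap_rel hx⟩
  rw [LinearMap.mem_ker] at hy
  constructor
  · change d.freeMap (x * y) = 0
    rw [freeMap_mul, hy, map_zero]
  · change d.freeMap (y * x) = 0
    rw [freeMap_mul, hy, map_zero, LinearMap.zero_apply]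

/-- The homomorphism from `𝔤̃(A, τ)`. -/
def tildeMap : FreeGen k n H ⧸ R.relIdeal τ →ₗ[k] M :=
  (R.relIdeal τ).liftQ d.freeMap d.relIdeal_le

lemma tildeMap_br (x y : FreeGen k n H ⧸ R.relIdeal τ) :
    d.tildeMap ((R.tilde τ).br x y) = B.br (d.tildeMap x) (d.tildeMap y) := by
  obtain ⟨x, rfl⟩ := (R.relIdeal τ).mkQ_surjective x
  obtain ⟨y, rfl⟩ := (R.relIdeal τ).mkQ_surjective y
  exact d.freeMap_mul x y

lemma tildeMap_surjective : Function.Surjective d.tildeMap := by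
  rw [← LinearMap.range_eq_top]
  refine d.generate _ ?_ (fun x => ⟨R.tgen τ (.h x), d.freeMap_of (.h x)⟩)
    (fun i => ⟨R.tgen τ (.e i), d.freeMap_of (.e i)⟩)
    (fun i => ⟨R.tgen τ (.f i), d.freeMap_of (.f i)⟩)
  rintro _ ⟨x, rfl⟩ _ ⟨y, rfl⟩
  exact ⟨_, d.tildeMap_br x y⟩

lemma tildeMap_mem_gr {i : ZMod 2} {x : FreeGen k n H ⧸ R.relIdeal τ} (hx : x ∈ (R.tilde τ).gr i) :
    d.tildeMap x ∈ B.gr i := by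
  obtain ⟨x, hx, rfl⟩ := hx
  exact d.freeMap_mem_gr hx

lemma tildeMap_mem_deg {m : ℤ} {x : FreeGen k n H ⧸ R.relIdeal τ} (hx : x ∈ R.tildeDeg τ m) :
    d.tildeMap x ∈ d.deg m := by
  obtain ⟨x, hx, rfl⟩ := hx
  exact d.freeMap_mem d.gen_mem_deg d.br_deg m x hx

lemma iSup_tilde_gr : ⨆ i, (R.tilde τ).gr i = ⊤ := by
  change ⨆ i, (freeGr k (Gen.parity τ) i).map (R.relIdeal τ).mkQ = ⊤
  rw [← Submodule.map_iSup, iSup_freeGr, Submodule.map_top, Submodule.range_mkQ]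

lemma iSup_tildeDeg : ⨆ m, R.tildeDeg τ m = ⊤ := by
  change ⨆ i, (freeGr k Gen.deg i).map (R.relIdeal τ).mkQ = ⊤
  rw [← Submodule.map_iSup, iSup_freeGr, Submodule.map_top, Submodule.range_mkQ]

lemma map_tilde_gr (i : ZMod 2) : ((R.tilde τ).gr i).map d.tildeMap = B.gr i := by
  refine le_antisymm (Submodule.map_le_iff_le_comap.2 fun x hx => d.tildeMap_mem_gr hx)
    fun y hy => ?_
  obtain ⟨x, rfl⟩ := d.tildeMap_surjective y
  have hx : x ∈ ⨆ i, (R.tilde τ).gr i := by rw [iSup_tilde_gr]; trivial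
  rw [iSup_parity] at hx
  obtain ⟨x₀, h₀, x₁, h₁, rfl⟩ := Submodule.mem_sup.1 hx
  have h2 := d.tildeMap_mem_gr h₀
  have h3 := d.tildeMap_mem_gr h₁
  have hd := Submodule.disjoint_def.1 d.lie.isCompl.disjoint
  rw [map_add] at hy ⊢
  rcases parity_cases i with rfl | rfl
  · rw [hd _ (by simpa using sub_mem hy h2) h3, add_zero]
    exact Submodule.mem_map_of_mem h₀
  · rw [hd _ h2 (by simpa using sub_mem hy h3), zero_add]
    exact Submodule.mem_map_of_mem h₁

lemma map_isGradedIdeal {I : Submodule k (FreeGen k n H ⧸ R.relIdeal τ)}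
    (hI : (R.tilde τ).IsGradedIdeal I) : B.IsGradedIdeal (I.map d.tildeMap) := by
  refine ⟨?_, ?_⟩
  · rintro x _ ⟨y, hy, rfl⟩
    obtain ⟨x, rfl⟩ := d.tildeMap_surjective x
    rw [← tildeMap_br, ← tildeMap_br]
    exact ⟨Submodule.mem_map_of_mem (hI.1 x y hy).1, Submodule.mem_map_of_mem (hI.1 x y hy).2⟩
  · refine (Submodule.map_mono hI.2).trans ?_
    rw [Submodule.map_iSup]
    refine iSup_mono fun i => le_inf (Submodule.map_mono inf_le_left) ?_
    exact (Submodule.map_mono inf_le_right).trans (d.map_tilde_gr i).le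

/-- The kernel of the homomorphism from `𝔤̃(A, τ)` is the largest homogeneous ideal that intersects
`𝔥` trivially. -/
theorem ker_tildeMap : LinearMap.ker d.tildeMap = R.maxIdeal τ := by
  refine le_antisymm (le_sSup ⟨⟨fun x y hy => ?_, ?_⟩, ?_, ?_⟩) (sSup_le ?_)
  · rw [LinearMap.mem_ker] at hy
    simp only [LinearMap.mem_ker, tildeMap_br, hy, map_zero, LinearMap.zero_apply, and_self]
  · intro x hx
    have h1 : x ∈ ⨆ i, (R.tilde τ).gr i := by rw [iSup_tilde_gr]; trivial
    rw [iSup_parity] at h1 ⊢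
    obtain ⟨x₀, h₀, x₁, h₁, rfl⟩ := Submodule.mem_sup.1 h1
    have hd := Submodule.disjoint_def.1 d.lie.isCompl.disjoint
    rw [LinearMap.mem_ker, map_add] at hx
    have h2 : d.tildeMap x₀ = 0 := hd _ (d.tildeMap_mem_gr h₀)
      (eq_neg_of_add_eq_zero_left hx ▸ neg_mem (d.tildeMap_mem_gr h₁))
    rw [h2, zero_add] at hx
    exact add_mem (Submodule.mem_sup_left ⟨h2, h₀⟩) (Submodule.mem_sup_right ⟨hx, h₁⟩)
  · exact SuperAlg.isHomogeneous_ker iSup_tildeDeg d.degProj d.tildeMap fun i j x hx =>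
      d.degProj_of_mem i j _ (d.tildeMap_mem_deg hx)
  · refine eq_bot_iff.2 fun x hx => ?_
    obtain ⟨hx, hc⟩ := hx
    rw [SetLike.mem_coe, Realization.cartan_eq] at hc
    obtain ⟨y, rfl⟩ := hc
    have h1 : d.h y = 0 := (d.freeMap_of (.h y)).symm.trans hx
    rw [d.h_injective (h1.trans (map_zero d.h).symm), map_zero]
    exact zero_mem _
  · rintro I ⟨hI, hZ, hc⟩
    refine LinearMap.le_ker_iff_map.2 (d.ideal _ (d.map_isGradedIdeal hI) ?_)
    rintro _ ⟨x, hx, rfl⟩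
    have key : ⨆ m, I ⊓ R.tildeDeg τ m ≤ LinearMap.ker (d.degProj 0 ∘ₗ d.tildeMap) := by
      refine iSup_le fun m y hy => ?_
      by_cases hm : 0 = m
      · subst hm
        have h1 : y ∈ I ⊓ R.cartan τ := ⟨hy.1, R.tildeDeg_zero_le τ hy.2⟩
        rw [hc] at h1
        rw [(Submodule.mem_bot k).1 h1]
        exact zero_mem _
      · rw [LinearMap.mem_ker, LinearMap.comp_apply,
          d.degProj_of_mem 0 m _ (d.tildeMap_mem_deg hy.2), if_neg hm]
    exact key (hZ hx)

/-- A Lie superalgebra that satisfies the conditions of `ChevalleyData` is the contragredient Lie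
superalgebra. -/
theorem nonempty_iso (d : ChevalleyData R τ B) : Nonempty (B.Iso (R.contragredient τ)) :=
  SuperAlg.nonempty_iso_quotient d.tildeMap d.tildeMap_surjective d.tildeMap_br d.map_tilde_gr
    (R.isIdeal_maxIdeal τ) d.ker_tildeMap

/-- A quotient of a contragredient Lie superalgebra by the center. -/
theorem nonempty_iso_centerless (d : ChevalleyData R τ B) {L : Type*}
    [AddCommGroup L] [Module k L] {B' : SuperAlg k L}
    (F : M →ₗ[k] L) (hs : Function.Surjective F) (hbr : ∀ x y, F (B.br x y) = B'.br (F x) (F y))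
    (hgr : ∀ i, (B.gr i).map F = B'.gr i) (hker : LinearMap.ker F = B.center) :
    Nonempty (B'.Iso (R.centerless τ)) := by
  obtain ⟨φ⟩ := d.nonempty_iso
  have hφ : ∀ x y, φ.toEquiv.symm ((R.contragredient τ).br x y) =
      B.br (φ.toEquiv.symm x) (φ.toEquiv.symm y) := fun x y => by
    rw [LinearEquiv.symm_apply_eq, φ.map_br, LinearEquiv.apply_symm_apply,
      LinearEquiv.apply_symm_apply]
  refine SuperAlg.nonempty_iso_quotient (F ∘ₗ φ.toEquiv.symm.toLinearMap)
    (hs.comp φ.toEquiv.symm.surjective) (fun x y => ?_) (fun i => ?_) _ ?_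
  · rw [LinearMap.comp_apply, LinearEquiv.coe_coe, hφ, hbr]
    rfl
  · rw [Submodule.map_comp, ← hgr]
    congr 1
    ext x
    rw [← φ.map_gr]
    constructor
    · rintro ⟨y, hy, rfl⟩
      simpa using hy
    · exact fun hx => ⟨_, hx, by simp⟩
  · ext x
    rw [LinearMap.mem_ker, LinearMap.comp_apply, ← LinearMap.mem_ker, hker]
    constructor
    · intro hx y
      have h := hx (φ.toEquiv.symm y)
      rw [LinearEquiv.coe_coe, ← hφ, ← hφ] at h
      simpa using h
    · intro hx y
      have h := hx (φ.toEquiv y)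
      have h1 := congrArg φ.toEquiv.symm h.1
      have h2 := congrArg φ.toEquiv.symm h.2
      rw [hφ] at h1 h2
      simpa using And.intro h1 h2

end ChevalleyData

section Integral

variable {k : Type*} [Field k] [CharP k 3]

/-! ### Integral structure constants -/

/-- The coordinates of `e_a ∧ e_b ∧ e_c` as integers, for which products can be computed by
`decide`. -/
def intBasis (a b c x y z : Fin 6) : ℤ :=
  let δ : Fin 6 → Fin 6 → ℤ := fun p x => if x = p then 1 else 0
  δ a x * δ b y * δ c z - δ a x * δ b z * δ c y + δ a y * δ b z * δ c x - δ a y * δ b x * δ c z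
    + δ a z * δ b x * δ c y - δ a z * δ b y * δ c x

/-- The action of `E_{ij}` on integral arrays. -/
def intAct (i j : Fin 6) (u : Fin 6 → Fin 6 → Fin 6 → ℤ) (a b c : Fin 6) : ℤ :=
  (if a = i then u j b c else 0) + (if b = i then u a j c else 0) + (if c = i then u a b j else 0)
    + (if i = j then u a b c else 0)

/-- The pairing of integral trivectors. -/
def intPairing (u v : Fin 6 → Fin 6 → Fin 6 → ℤ) : ℤ :=
  u 0 1 2 * v 3 4 5 - u 0 1 3 * v 2 4 5 + u 0 1 4 * v 2 3 5 - u 0 1 5 * v 2 3 4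
    + u 0 2 3 * v 1 4 5 - u 0 2 4 * v 1 3 5 + u 0 2 5 * v 1 3 4 + u 0 3 4 * v 1 2 5
    - u 0 3 5 * v 1 2 4 + u 0 4 5 * v 1 2 3
    - (v 0 1 2 * u 3 4 5 - v 0 1 3 * u 2 4 5 + v 0 1 4 * u 2 3 5
      - v 0 1 5 * u 2 3 4 + v 0 2 3 * u 1 4 5 - v 0 2 4 * u 1 3 5
      + v 0 2 5 * u 1 3 4 + v 0 3 4 * u 1 2 5 - v 0 3 5 * u 1 2 4
      + v 0 4 5 * u 1 2 3)

lemma coe_basisVec (a b c x y z : Fin 6) :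
    (basisVec k a b c).1 x y z = (intBasis a b c x y z : k) := by
  simp only [basisVec, wedge_apply, Pi.single_apply, intBasis]
  push_cast
  rfl

lemma coe_act_basisVec (i j a b c x y z : Fin 6) :
    (act (Matrix.single i j (1 : k)) (basisVec k a b c)).1 x y z =
      (intAct i j (intBasis a b c) x y z : k) := by
  simp only [act_single_apply', coe_basisVec, intAct]
  push_cast
  rfl

lemma act_single_basisVec_eq_zero {i j a b c : Fin 6}
    (h : ∀ x y z, intAct i j (intBasis a b c) x y z = 0) :
    act (Matrix.single i j (1 : k)) (basisVec k a b c) = 0 := by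
  ext x y z
  rw [coe_act_basisVec, h, Int.cast_zero]
  rfl

lemma oddBr_basisVec {a b c d e f : Fin 6} (N : Fin 6 → Fin 6 → ℤ)
    (h : ∀ i j, intPairing (intAct j i (intBasis a b c)) (intBasis d e f) = N i j) :
    oddBr (basisVec k a b c) (basisVec k d e f) = Matrix.of fun i j => (N i j : k) := by
  ext i j
  rw [oddBr_apply, pairing_apply, Matrix.of_apply, ← h]
  simp only [coe_act_basisVec, coe_basisVec, intPairing]
  push_cast
  rfl

omit [CharP k 3] in
lemma of_diagonal (v : Fin 6 → ℤ) : (Matrix.of fun i j => ((if i = j then v i else 0 : ℤ) : k)) =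
    Matrix.diagonal fun i => (v i : k) := by
  ext i j
  rw [Matrix.of_apply, Matrix.diagonal_apply]
  split_ifs <;> simp

omit [CharP k 3] in
lemma of_single (a b : Fin 6) (c : ℤ) :
    (Matrix.of fun i j => ((if a = i ∧ b = j then c else 0 : ℤ) : k)) =
      (c : k) • Matrix.single a b 1 := by
  ext i j
  rw [Matrix.of_apply, Matrix.smul_apply, Matrix.single_apply]
  split_ifs <;> simp

end Integral

/-! ### The model as a contragredient Lie superalgebra -/

section Chevalley

variable {k : Type*} [Field k] [CharP k 3]

/-- The degrees of the basis vectors of `k⁶`, shifted so that `e_a ∧ e_b ∧ e_c` has degree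
`wt a + wt b + wt c - 16`. The shift is half of the sum of all weights, so that the grading is
compatible with the product of trivectors, and the weights are chosen in such a way that the simple
root vectors `chevalleyE` have degree `1`. -/
def wt : Fin 6 → ℤ := ![9, 8, 6, 5, 4, 0]

/-- The component of degree `m` of the model. -/
def modelDeg (k : Type*) [Field k] (m : ℤ) : Submodule k (Matrix (Fin 6) (Fin 6) k × Trivec k) where
  carrier := {x | (∀ i j, wt i - wt j ≠ m → x.1 i j = 0) ∧
    ∀ a b c, wt a + wt b + wt c - 16 ≠ m → x.2.1 a b c = 0}
  add_mem' := by
    rintro x y ⟨h1, h2⟩ ⟨h3, h4⟩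
    exact ⟨fun i j h => by simp [h1 i j h, h3 i j h], fun a b c h => by simp [h2 a b c h,
        h4 a b c h]⟩
  zero_mem' := by simp
  smul_mem' := by
    rintro r x ⟨h1, h2⟩
    exact ⟨fun i j h => by simp [h1 i j h], fun a b c h => by simp [h2 a b c h]⟩

/-- The projection onto the component of degree `m`. -/
def modelProj (k : Type*) [Field k] (m : ℤ) :
    Matrix (Fin 6) (Fin 6) k × Trivec k →ₗ[k] Matrix (Fin 6) (Fin 6) k × Trivec k where
  toFun x := (Matrix.of fun i j => if wt i - wt j = m then x.1 i j else 0,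
    ⟨fun a b c => if wt a + wt b + wt c - 16 = m then x.2.1 a b c else 0, by
      refine ⟨fun a b c => ?_, fun a b c => ?_⟩
      · change (if wt b + wt a + wt c - 16 = m then x.2.1 b a c else 0) =
          -(if wt a + wt b + wt c - 16 = m then x.2.1 a b c else 0)
        rw [add_comm (wt b) (wt a), x.2.2.1]; split_ifs <;> simp
      · change (if wt a + wt c + wt b - 16 = m then x.2.1 a c b else 0) =
          -(if wt a + wt b + wt c - 16 = m then x.2.1 a b c else 0)
        rw [add_right_comm, x.2.2.2]; split_ifs <;> simp⟩)
  map_add' x y := by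
    refine Prod.ext ?_ ?_
    · ext i j
      simp only [Matrix.of_apply, Prod.fst_add, Matrix.add_apply]
      split_ifs <;> simp
    · ext a b c
      simp only [Prod.snd_add, Submodule.coe_add, Pi.add_apply]
      split_ifs <;> simp
  map_smul' r x := by
    refine Prod.ext ?_ ?_
    · ext i j; simp
    · ext a b c; simp

omit [CharP k 3] in
lemma modelProj_of_mem (i j : ℤ) (x : Matrix (Fin 6) (Fin 6) k × Trivec k)
    (hx : x ∈ modelDeg k j) : modelProj k i x = if i = j then x else 0 := by
  split_ifs with h
  · subst h
    refine Prod.ext ?_ ?_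
    · ext a b
      change (if _ then _ else _) = _
      split_ifs with h
      · rfl
      · exact (hx.1 a b h).symm
    · ext a b c
      change (if _ then _ else _) = _
      split_ifs with h
      · rfl
      · exact (hx.2 a b c h).symm
  · refine Prod.ext ?_ ?_
    · ext a b
      change (if _ then _ else _) = _
      split_ifs with h'
      · exact hx.1 a b fun h2 => h (h'.symm.trans h2)
      · rfl
    · ext a b c
      change (if _ then _ else _) = _
      split_ifs with h'
      · exact hx.2 a b c fun h2 => h (h'.symm.trans h2)
      · rfl

omit [CharP k 3] in
lemma act_mem_modelDeg {i j : ℤ} {X : Matrix (Fin 6) (Fin 6) k} {u : Trivec k}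
    (hX : (X, (0 : Trivec k)) ∈ modelDeg k i)
    (hu : ((0 : Matrix (Fin 6) (Fin 6) k), u) ∈ modelDeg k j) :
    ((0 : Matrix (Fin 6) (Fin 6) k), act X u) ∈ modelDeg k (i + j) := by
  refine ⟨fun _ _ _ => rfl, fun a b c h => ?_⟩
  have h1 : ∀ p l, X p l ≠ 0 → wt p - wt l = i := fun p l h => by
    by_contra h'
    exact h (hX.1 p l h')
  have h2 : ∀ p q r, u.1 p q r ≠ 0 → wt p + wt q + wt r - 16 = j := fun p q r h => by
    by_contra h'
    exact h (hu.2 p q r h')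
  change (act X u).1 a b c = 0
  rw [act_apply, Finset.sum_eq_zero, Finset.sum_eq_zero, Finset.sum_eq_zero]
  · simp only [zero_add]
    by_contra h'
    obtain ⟨h3, h4⟩ := ne_zero_and_ne_zero_of_mul h'
    obtain ⟨l, -, h5⟩ := Finset.exists_ne_zero_of_sum_ne_zero h3
    have := h1 l l h5
    have := h2 a b c h4
    omega
  all_goals
    intro l _
    by_contra h'
    obtain ⟨h3, h4⟩ := ne_zero_and_ne_zero_of_mul h'
    have := h1 _ _ h3
    have := h2 _ _ _ h4
    omega

omit [CharP k 3] in
lemma pairing_eq_zero_of_mem {i j : ℤ} {u v : Trivec k} (hij : i + j ≠ 0)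
    (hu : ((0 : Matrix (Fin 6) (Fin 6) k), u) ∈ modelDeg k i)
    (hv : ((0 : Matrix (Fin 6) (Fin 6) k), v) ∈ modelDeg k j) : pairing u v = 0 := by
  have h : ∀ a b c d e f, wt a + wt b + wt c + (wt d + wt e + wt f) = 32 →
      u.1 a b c * v.1 d e f = 0 := by
    intro a b c d e f h
    by_cases h1 : wt a + wt b + wt c - 16 = i
    · rw [hv.2 d e f (by omega), mul_zero]
    · rw [hu.2 a b c h1, zero_mul]
  have h' : ∀ a b c d e f, wt a + wt b + wt c + (wt d + wt e + wt f) = 32 →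
      v.1 a b c * u.1 d e f = 0 := fun a b c d e f h1 => by
    rw [mul_comm]; exact h _ _ _ _ _ _ (by omega)
  rw [pairing_apply, h 0 1 2 3 4 5 rfl, h 0 1 3 2 4 5 rfl, h 0 1 4 2 3 5 rfl, h 0 1 5 2 3 4 rfl,
    h 0 2 3 1 4 5 rfl, h 0 2 4 1 3 5 rfl, h 0 2 5 1 3 4 rfl, h 0 3 4 1 2 5 rfl,
    h 0 3 5 1 2 4 rfl, h 0 4 5 1 2 3 rfl, h' 0 1 2 3 4 5 rfl, h' 0 1 3 2 4 5 rfl,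
    h' 0 1 4 2 3 5 rfl, h' 0 1 5 2 3 4 rfl, h' 0 2 3 1 4 5 rfl, h' 0 2 4 1 3 5 rfl,
    h' 0 2 5 1 3 4 rfl, h' 0 3 4 1 2 5 rfl, h' 0 3 5 1 2 4 rfl, h' 0 4 5 1 2 3 rfl]
  simp

omit [CharP k 3] in
lemma single_mem_modelDeg {i j : Fin 6} {m : ℤ} (h : wt i - wt j = m) :
    ((Matrix.single i j (1 : k)), (0 : Trivec k)) ∈ modelDeg k m := by
  refine ⟨fun a b hab => ?_, fun _ _ _ _ => rfl⟩
  change Matrix.single i j (1 : k) a b = 0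
  rw [Matrix.single_apply, if_neg]
  rintro ⟨rfl, rfl⟩
  exact hab h

omit [CharP k 3] in
lemma model_br_mem_modelDeg (i j : ℤ) (x : Matrix (Fin 6) (Fin 6) k × Trivec k)
    (hx : x ∈ modelDeg k i) (y : Matrix (Fin 6) (Fin 6) k × Trivec k) (hy : y ∈ modelDeg k j) :
    (model k).br x y ∈ modelDeg k (i + j) := by
  have even : ∀ {m : ℤ} {z : Matrix (Fin 6) (Fin 6) k × Trivec k}, z ∈ modelDeg k m →
      (z.1, (0 : Trivec k)) ∈ modelDeg k m := fun hz => ⟨hz.1, fun _ _ _ _ => rfl⟩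
  have odd : ∀ {m : ℤ} {z : Matrix (Fin 6) (Fin 6) k × Trivec k}, z ∈ modelDeg k m →
      ((0 : Matrix (Fin 6) (Fin 6) k), z.2) ∈ modelDeg k m := fun hz => ⟨fun _ _ _ => rfl, hz.2⟩
  have hmul : ∀ {i j : ℤ} {X Y : Matrix (Fin 6) (Fin 6) k}, (X, (0 : Trivec k)) ∈ modelDeg k i →
      (Y, (0 : Trivec k)) ∈ modelDeg k j → (X * Y, (0 : Trivec k)) ∈ modelDeg k (i + j) := by
    intro i j X Y hX hY
    refine ⟨fun a b hab => ?_, fun _ _ _ _ => rfl⟩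
    change (X * Y) a b = 0
    rw [Matrix.mul_apply]
    refine Finset.sum_eq_zero fun l _ => ?_
    by_cases h1 : wt a - wt l = i
    · rw [show Y l b = 0 from hY.1 l b (by omega), mul_zero]
    · rw [show X a l = 0 from hX.1 a l h1, zero_mul]
  have hodd : (oddBr x.2 y.2, (0 : Trivec k)) ∈ modelDeg k (i + j) := by
    refine ⟨fun a b hab => ?_, fun _ _ _ _ => rfl⟩
    exact pairing_eq_zero_of_mem (i := wt b - wt a + i) (j := j) (by omega)
      (act_mem_modelDeg (single_mem_modelDeg rfl) (odd hx)) (odd hy)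
  have e : (model k).br x y = (x.1 * y.1, 0) - (y.1 * x.1, 0) + (oddBr x.2 y.2, 0)
      + (0, act x.1 y.2) - (0, act y.1 x.2) := by
    rw [model_br]
    ext1 <;> simp
  rw [e]
  have h1 := hmul (even hy) (even hx)
  have h2 := act_mem_modelDeg (even hy) (odd hx)
  rw [add_comm j i] at h1 h2
  exact sub_mem (add_mem (add_mem (sub_mem (hmul (even hx) (even hy)) h1) hodd)
    (act_mem_modelDeg (even hx) (odd hy))) h2

omit [CharP k 3] in
lemma diagonal_mem_modelDeg (v : Fin 6 → k) :
    (Matrix.diagonal v, (0 : Trivec k)) ∈ modelDeg k 0 := by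
  refine ⟨fun i j h => ?_, fun _ _ _ _ => rfl⟩
  refine Matrix.diagonal_apply_ne _ ?_
  rintro rfl
  simp at h

lemma basisVec_mem_modelDeg {a b c : Fin 6} {m : ℤ} (h : wt a + wt b + wt c - 16 = m) :
    ((0 : Matrix (Fin 6) (Fin 6) k), basisVec k a b c) ∈ modelDeg k m := by
  refine ⟨fun _ _ _ => rfl, fun x y z hxyz => ?_⟩
  have key : ∀ p q r : Prop, ∀ [Decidable p] [Decidable q] [Decidable r], ¬(p ∧ q ∧ r) →
      (if p then (1 : k) else 0) * (if q then 1 else 0) * (if r then 1 else 0) = 0 := by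
    intro p q r _ _ _ h
    by_cases p <;> by_cases q <;> by_cases r <;> simp_all
  change (basisVec k a b c).1 x y z = 0
  simp only [basisVec, wedge_apply, Pi.single_apply]
  rw [key, key, key, key, key, key]
  · simp
  all_goals
    rintro ⟨rfl, rfl, rfl⟩
    omega

/-- A nonzero graded ideal of the model has a nonzero component of degree `0`: it contains a nonzero
scalar matrix or `diag(1, -1, 0, 0, 0, 0)`. -/
lemma model_ideal_eq_bot {J : Submodule k (Matrix (Fin 6) (Fin 6) k × Trivec k)}
    (hJ : (model k).IsGradedIdeal J) (h : ∀ x ∈ J, modelProj k 0 x = 0) : J = ⊥ := by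
  have h0 : ∀ v : Fin 6 → k, (Matrix.diagonal v, 0) ∈ J → Matrix.diagonal v = 0 := by
    intro v hv
    have h1 := h _ hv
    rw [modelProj_of_mem 0 0 _ (diagonal_mem_modelDeg v), if_pos rfl] at h1
    exact congrArg Prod.fst h1
  rcases model_stable hJ.2 fun d _ x hx => (hJ.1 d x hx).1 with h1 | h1
  · refine eq_bot_iff.2 fun x hx => ?_
    obtain ⟨c, rfl⟩ := h1 x hx
    have e : (c • 1 : Matrix (Fin 6) (Fin 6) k) = Matrix.diagonal fun _ => c := by
      rw [Matrix.smul_one_eq_diagonal]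
    rw [e] at hx ⊢
    rw [h0 _ hx]
    exact zero_mem _
  · exfalso
    have h2 := h0 ![1, -1, 0, 0, 0, 0] (h1 _ (by simp [Matrix.trace_diagonal, Fin.sum_univ_six]))
    have h3 := congrFun (congrFun h2 0) 0
    simp at h3

end Chevalley

/-! ### Generation by the simple root vectors -/

section Generation

variable {k : Type*} [Field k] [CharP k 3]

omit [CharP k 3] in
lemma model_br_even (X Y : Matrix (Fin 6) (Fin 6) k) :
    (model k).br (X, 0) (Y, 0) = (X * Y - Y * X, 0) := by
  simp [model_br]

omit [CharP k 3] in
lemma model_br_even_odd (X : Matrix (Fin 6) (Fin 6) k) (u : Trivec k) :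
    (model k).br (X, 0) (0, u) = (0, act X u) := by
  simp [model_br]

omit [CharP k 3] in
lemma model_br_odd_even (X : Matrix (Fin 6) (Fin 6) k) (u : Trivec k) :
    (model k).br (0, u) (X, 0) = -(0, act X u) := by
  simp [model_br]

omit [CharP k 3] in
lemma model_br_odd (u v : Trivec k) : (model k).br (0, u) (0, v) = (oddBr u v, 0) := by
  simp [model_br]

/-- The simple root vectors of the model, with respect to the diagonal matrices. -/
def chevalleyE (k : Type*) [Field k] [CharP k 3] : Fin 5 → Matrix (Fin 6) (Fin 6) k × Trivec k :=
  ![(Matrix.single 3 4 1, 0), (Matrix.single 2 3 1, 0), (0, basisVec k 1 3 4),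
    (Matrix.single 0 1 1, 0), (0, basisVec k 0 1 5)]

/-- The negative simple root vectors of the model. The signs of the odd ones, together with the
order of the roots, make the coroots `[e_i, f_i]` satisfy `α_j([e_i, f_i]) = A_{ij}`. -/
def chevalleyF (k : Type*) [Field k] [CharP k 3] : Fin 5 → Matrix (Fin 6) (Fin 6) k × Trivec k :=
  ![(Matrix.single 4 3 1, 0), (Matrix.single 3 2 1, 0), (0, -basisVec k 0 2 5),
    (Matrix.single 1 0 1, 0), (0, -basisVec k 2 3 4)]

/-- The diagonal entries of the brackets `[e_i, f_i]`. -/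
def corootDiag : Fin 5 → Fin 6 → ℤ :=
  ![![0, 0, 0, 1, -1, 0], ![0, 0, 1, -1, 0, 0], ![1, 2, 1, 2, 2, 1], ![1, -1, 0, 0, 0, 0],
    ![2, 2, 1, 1, 1, 2]]

lemma chevalley_br (i j : Fin 5) : (model k).br (chevalleyE k i) (chevalleyF k j) =
    if i = j then (Matrix.diagonal fun a => (corootDiag i a : k), 0) else 0 := by
  have odd : ∀ {a b c d e f : Fin 6} {v : Fin 6 → ℤ}, (∀ i j, intPairing
      (intAct j i (intBasis a b c)) (intBasis d e f) = if i = j then -v i else 0) →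
      (-oddBr (basisVec k a b c) (basisVec k d e f), (0 : Trivec k)) =
        (Matrix.diagonal fun a => (v a : k), 0) := by
    intro a b c d e f v h
    rw [oddBr_basisVec _ h, of_diagonal]
    simp [← Matrix.diagonal_neg]
  have odd_zero : ∀ {a b c d e f : Fin 6}, (∀ i j, intPairing
      (intAct j i (intBasis a b c)) (intBasis d e f) = 0) →
      (-oddBr (basisVec k a b c) (basisVec k d e f), (0 : Trivec k)) = 0 := by
    intro a b c d e f h
    rw [oddBr_basisVec _ h]
    simp only [Int.cast_zero]
    exact Prod.ext neg_zero rfl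
  have diag : ∀ {a b : Fin 6} {v : Fin 6 → ℤ},
      (∀ i, v i = (if i = a then 1 else 0) - (if i = b then 1 else 0)) →
      (Matrix.single a b (1 : k) * Matrix.single b a 1 - Matrix.single b a 1 * Matrix.single a b 1,
        (0 : Trivec k)) = (Matrix.diagonal fun a => (v a : k), 0) := by
    intro a b v h
    rw [Matrix.single_mul_single_same, Matrix.single_mul_single_same, mul_one,
      ← Matrix.diagonal_single, ← Matrix.diagonal_single, Matrix.diagonal_sub]
    congr 2
    funext i
    simp [h, Pi.single_apply]
  fin_cases i <;> fin_cases j <;>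
    simp only [chevalleyE, chevalleyF, Fin.mk_zero, Fin.mk_one, Fin.reduceFinMk,
      Matrix.cons_val, Fin.isValue, Fin.reduceEq, if_true, if_false, model_br_even,
      model_br_even_odd, model_br_odd_even, model_br_odd, map_neg]
  all_goals first
    | (rw [act_single_basisVec_eq_zero (by decide +kernel)]; simp)
    | skip
  all_goals first
    | exact diag (by decide)
    | exact odd (by decide +kernel)
    | exact odd_zero (by decide +kernel)
    | (rw [Matrix.single_mul_single_of_ne _ _ _ _ (by decide),
        Matrix.single_mul_single_of_ne _ _ _ _ (by decide), sub_zero]; rfl)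

/-- The simple root vectors and the diagonal matrices generate the model. The brackets of odd root
vectors supply the missing elementary matrices next to the diagonal, these generate `gl₆`, and a
single `e_a ∧ e_b ∧ e_c` generates `⋀³`. -/
lemma model_generate {N : Submodule k (Matrix (Fin 6) (Fin 6) k × Trivec k)}
    (hN : ∀ x ∈ N, ∀ y ∈ N, (model k).br x y ∈ N)
    (hd : ∀ v, (Matrix.diagonal v, 0) ∈ N) (he : ∀ i, chevalleyE k i ∈ N)
    (hf : ∀ i, chevalleyF k i ∈ N) : N = ⊤ := by
  let S : Fin 6 → Fin 6 → Prop := fun i j => (Matrix.single i j 1, 0) ∈ N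
  let O : Fin 6 → Fin 6 → Fin 6 → Prop := fun a b c => (0, basisVec k a b c) ∈ N
  have hneg : ∀ {u : Trivec k}, ((0, -u) : Matrix (Fin 6) (Fin 6) k × Trivec k) ∈ N →
      ((0, u) : Matrix (Fin 6) (Fin 6) k × Trivec k) ∈ N := fun h => by
    simpa using neg_mem h
  have trans : ∀ {i j l}, i ≠ l → S i j → S j l → S i l := by
    intro i j l hil h1 h2
    have := hN _ h1 _ h2
    rwa [model_br_even, Matrix.single_mul_single_same,
        Matrix.single_mul_single_of_ne _ _ _ _ hil.symm,
      sub_zero, mul_one] at this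
  have move : ∀ {i a b c}, a ≠ b → a ≠ c → i ≠ a → S i a → O a b c → O i b c := by
    intro i a b c hb hc hi h1 h2
    have := hN _ h1 _ h2
    rwa [model_br_even_odd, act_single_basisVec hb hc hi] at this
  have swap : ∀ {a b c}, O a b c → O b a c := fun h => hneg (by rw [← basisVec_swap₁₂]; exact h)
  have odd : ∀ {a b c d e f i j : Fin 6} (n : ℤ), (n = 1 ∨ n = -1) →
      (∀ x y, intPairing (intAct y x (intBasis a b c)) (intBasis d e f) =
        if i = x ∧ j = y then n else 0) → O a b c → O d e f → S i j := by
    intro a b c d e f i j n hn h h1 h2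
    have h3 := hN _ h1 _ h2
    rw [model_br_odd, oddBr_basisVec _ h, of_single] at h3
    rcases hn with rfl | rfl
    · simpa using h3
    · have := neg_mem h3
      simpa using this
  have o134 : O 1 3 4 := he 2
  have o015 : O 0 1 5 := he 4
  have o025 : O 0 2 5 := hneg (hf 2)
  have o234 : O 2 3 4 := hneg (hf 4)
  have s01 : S 0 1 := he 3
  have s23 : S 2 3 := he 1
  have s12 : S 1 2 := odd 1 (by decide) (by decide +kernel) o134 o015
  have s21 : S 2 1 := odd (-1) (by decide) (by decide +kernel) o025 o234
  have s20 : S 2 0 := trans (by decide) s21 (hf 3)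
  have s30 : S 3 0 := trans (by decide) (hf 1) s20
  have o024 : O 0 2 4 := swap (move (by decide) (by decide) (by decide) s23
    (swap (move (by decide) (by decide) (by decide) s01 o134)))
  have o135 : O 1 3 5 := swap (move (by decide) (by decide) (by decide) s30 o015)
  have s45 : S 4 5 := odd 1 (by decide) (by decide +kernel) o134 o024
  have s54 : S 5 4 := odd (-1) (by decide) (by decide +kernel) o025 o135
  have step : ∀ i j : Fin 6, i.val + 1 = j.val → S i j ∧ S j i := by
    intro i j hij
    obtain rfl : j = i + 1 := by ext; rw [← hij]; decide +revert
    fin_cases i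
    · exact ⟨s01, hf 3⟩
    · exact ⟨s12, s21⟩
    · exact ⟨s23, hf 1⟩
    · exact ⟨he 0, hf 0⟩
    · exact ⟨s45, s54⟩
    · exact absurd hij (by decide)
  have far : ∀ (n : ℕ) (i j : Fin 6), i.val + n + 1 = j.val → S i j ∧ S j i := by
    intro n
    induction n with
    | zero => exact fun i j h => step i j h
    | succ n ih =>
      intro i j h
      obtain ⟨h1, h2⟩ := ih i ⟨i.val + n + 1, by omega⟩ rfl
      obtain ⟨h3, h4⟩ := step ⟨i.val + n + 1, by omega⟩ j h
      have hij : i ≠ j := by rintro rfl; omega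
      exact ⟨trans hij h1 h3, trans hij.symm h4 h2⟩
  have hS : ∀ i j, S i j := by
    intro i j
    rcases lt_trichotomy i j with h | rfl | h
    · exact (far (j.val - i.val - 1) i j (by omega)).1
    · have := hd (Pi.single i 1)
      rwa [Matrix.diagonal_single] at this
    · exact (far (i.val - j.val - 1) j i (by omega)).2
  have hM : ∀ X, (X, 0) ∈ N := by
    intro X
    have : (⊤ : Submodule k (Matrix (Fin 6) (Fin 6) k)) ≤
        N.comap (LinearMap.inl k _ (Trivec k)) := by
      intro X _
      rw [Matrix.matrix_eq_sum_single X]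
      refine sum_mem fun i _ => sum_mem fun j _ => ?_
      rw [← mul_one (X i j), ← smul_eq_mul, ← Matrix.smul_single]
      exact Submodule.smul_mem _ _ (hS i j)
    exact this (Submodule.mem_top (x := X))
  have hT : N.comap (LinearMap.inr k (Matrix (Fin 6) (Fin 6) k) (Trivec k)) = ⊤ := by
    refine eq_top_of_basisVec_mem fun a b c _ _ _ => ?_
    refine basisVec_mem_of_stable (N := N.comap (LinearMap.inr k _ (Trivec k)))
        (fun i j _ u hu => ?_) (a := 1) (b := 3) (c := 4) (by decide)
      (by decide) (by decide) o134 a b c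
    have := hN _ (hS i j) _ hu
    rwa [LinearMap.inr_apply, model_br_even_odd] at this
  refine eq_top_iff.2 fun x _ => ?_
  have h2 : x.2 ∈ N.comap (LinearMap.inr k (Matrix (Fin 6) (Fin 6) k) (Trivec k)) :=
    hT ▸ Submodule.mem_top
  have := add_mem (hM x.1) h2
  simpa using this

end Generation

/-! ### Realizations of the matrix -/

section CartanRealization

variable {k : Type*} [Field k] [CharP k 3]

/-- In characteristic `3` the fifth row of the matrix is the difference of the first two. -/
lemma rank_cartanMatrix : (cartanMatrix k).rank = 4 := by
  have h3 := three_eq_zero (k := k)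
  refine le_antisymm ?_ ?_
  · have e : cartanMatrix k = (!![1, 0, 0, 0; 0, 1, 0, 0; 0, 0, 1, 0; 0, 0, 0, 1; 1, -1, 0, 0] :
        Matrix (Fin 5) (Fin 4) k) * (!![2, -1, 0, 0, 0; -1, 2, -1, 0, 0; 0, -1, 0, -1, 1;
          0, 0, -1, 2, 0] : Matrix (Fin 4) (Fin 5) k) := by
      ext i j
      fin_cases i <;> fin_cases j <;>
        simp [cartanMatrix, Matrix.mul_apply, Fin.sum_univ_succ] <;>
        first | linear_combination h3 | linear_combination -h3
    rw [e]
    exact (Matrix.rank_mul_le_left _ _).trans (Matrix.rank_le_width _)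
  · have e : (cartanMatrix k).submatrix ![0, 1, 2, 3] ![1, 2, 3, 4] =
        !![-1, 0, 0, 0; 2, -1, 0, 0; -1, 0, -1, 1; 0, -1, 2, 0] := by
      ext i j
      fin_cases i <;> fin_cases j <;> rfl
    have hdet : ((cartanMatrix k).submatrix ![0, 1, 2, 3] ![1, 2, 3, 4]).det = 1 := by
      rw [e]
      simp [Matrix.det_succ_row_zero, Fin.sum_univ_succ, Fin.succAbove]
      linear_combination -h3
    have h := Matrix.rank_of_isUnit _ ((Matrix.isUnit_iff_isUnit_det _).2 (hdet ▸ isUnit_one))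
    rw [Fintype.card_fin] at h
    have := Matrix.rank_submatrix_le (cartanMatrix k) ![0, 1, 2, 3] ![1, 2, 3, 4]
    omega

variable {H : Type*} [AddCommGroup H] [Module k H] (R : Realization (cartanMatrix k) H)

omit [CharP k 3] in
lemma exists_dual_coroot (w : Fin 5 → k) :
    ∃ l : Module.Dual k H, ∀ i, l (R.coroot i) = w i := by
  let b := Module.Basis.span R.coroot_indep
  obtain ⟨l, hl⟩ := LinearMap.exists_extend (b.constr k w)
  refine ⟨l, fun i => ?_⟩
  have h1 : R.coroot i = (b i : H) :=
    (congrArg Subtype.val (Module.Basis.span_apply R.coroot_indep i)).symm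
  rw [h1, ← Module.Basis.constr_basis b k w i, ← hl]
  rfl

lemma finrank_realization (R : Realization (cartanMatrix k) H) : Module.finrank k H = 6 := by
  have := R.dim
  rw [rank_cartanMatrix] at this
  omega

/-- The roots vanish simultaneously on a line, which is spanned by the coroot combination that
the linear dependence between the rows of the matrix provides. -/
lemma eq_smul_of_root_eq_zero {x : H} (hx : ∀ i, R.root i x = 0) :
    ∃ c : k, x = c • (R.coroot 0 - R.coroot 1 - R.coroot 4) := by
  have h3 := three_eq_zero (k := k)
  have := R.finite
  have h1 := Subspace.finrank_add_finrank_dualCoannihilator_eq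
    (Submodule.span k (Set.range R.root))
  rw [finrank_span_eq_card R.root_indep, Fintype.card_fin, finrank_realization R] at h1
  have h2 : Module.finrank k (Submodule.span k (Set.range R.root)).dualCoannihilator = 1 := by
    omega
  have hmem : ∀ y : H, (∀ i, R.root i y = 0) →
      y ∈ (Submodule.span k (Set.range R.root)).dualCoannihilator := by
    intro y hy
    rw [Submodule.mem_dualCoannihilator]
    intro φ hφ
    have : Submodule.span k (Set.range R.root) ≤ LinearMap.ker (Module.Dual.eval k H y) := by
      refine Submodule.span_le.2 ?_
      rintro _ ⟨i, rfl⟩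
      exact hy i
    exact this hφ
  let z := R.coroot 0 - R.coroot 1 - R.coroot 4
  have hz : ∀ i, R.root i z = 0 := by
    intro i
    simp only [z, map_sub, R.root_coroot]
    fin_cases i <;> simp [cartanMatrix] <;> first | linear_combination h3 | linear_combination -h3
  have hz0 : z ≠ 0 := by
    obtain ⟨l, hl⟩ := exists_dual_coroot R ![1, 0, 0, 0, 0]
    intro h
    have := congrArg l h
    simp [z, hl] at this
  obtain ⟨c, hc⟩ := (finrank_eq_one_iff_of_nonzero'
    (⟨z, hmem z hz⟩ : (Submodule.span k (Set.range R.root)).dualCoannihilator)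
    (fun h => hz0 (congrArg Subtype.val h))).1 h2 ⟨x, hmem x hx⟩
  exact ⟨c, (congrArg Subtype.val hc).symm⟩

/-- Every realization is isomorphic to the space of diagonal matrices, with the coroots
`corootDiag`. The functionals on the right are the weights of the simple root vectors of the model. -/
lemma exists_realization_equiv : ∃ θ : H ≃ₗ[k] (Fin 6 → k),
    (∀ i, θ (R.coroot i) = fun a => (corootDiag i a : k)) ∧
    ∀ x, R.root 0 x = θ x 3 - θ x 4 ∧ R.root 1 x = θ x 2 - θ x 3 ∧
      R.root 2 x = θ x 1 + θ x 3 + θ x 4 + ∑ a, θ x a ∧ R.root 3 x = θ x 0 - θ x 1 ∧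
      R.root 4 x = θ x 0 + θ x 1 + θ x 5 + ∑ a, θ x a := by
  have h3 := three_eq_zero (k := k)
  have := R.finite
  obtain ⟨l, hl⟩ := exists_dual_coroot R ![-1, 0, 2, 0, 1]
  -- A section of the five roots, corrected by a scalar matrix. The scalar `l` is the last but one
  -- diagonal entry, and its values on the coroots are prescribed by `corootDiag`.
  let θ : H →ₗ[k] (Fin 6 → k) := LinearMap.pi
    ![R.root 0 + R.root 1 + R.root 2 + R.root 4 + R.root 3 + l,
      R.root 0 + R.root 1 + R.root 2 + R.root 4 + l, R.root 0 + R.root 1 + l, R.root 0 + l, l,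
      R.root 2 - R.root 1 - R.root 3 + l]
  have hθ : ∀ x, θ x = ![R.root 0 x + R.root 1 x + R.root 2 x + R.root 4 x + R.root 3 x + l x,
      R.root 0 x + R.root 1 x + R.root 2 x + R.root 4 x + l x, R.root 0 x + R.root 1 x + l x,
      R.root 0 x + l x, l x, R.root 2 x - R.root 1 x - R.root 3 x + l x] := by
    intro x
    funext a
    fin_cases a <;> rfl
  have hinj : Function.Injective θ := by
    refine (injective_iff_map_eq_zero θ).2 fun x hx => ?_
    rw [hθ] at hx
    have e0 := congrFun hx 0
    have e1 := congrFun hx 1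
    have e2 := congrFun hx 2
    have e3 := congrFun hx 3
    have e4 := congrFun hx 4
    have e5 := congrFun hx 5
    simp at e0 e1 e2 e3 e4 e5
    have r3 : R.root 3 x = 0 := by linear_combination e0 - e1
    have r0 : R.root 0 x = 0 := by linear_combination e3 - e4
    have r1 : R.root 1 x = 0 := by linear_combination e2 - e3
    have r2 : R.root 2 x = 0 := by linear_combination e5 + r1 + r3 - e4
    have r4 : R.root 4 x = 0 := by linear_combination e1 - r0 - r1 - r2 - e4
    obtain ⟨c, rfl⟩ := eq_smul_of_root_eq_zero R (x := x) fun i => by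
      fin_cases i <;> assumption
    have : c = 0 := by
      simp [hl] at e4
      rcases e4 with h | h
      · exact h
      · exfalso
        exact one_ne_zero (α := k) (by linear_combination h3 + h)
    rw [this, zero_smul]
  refine ⟨LinearEquiv.ofInjectiveOfFinrankEq θ hinj (by simp [finrank_realization R]), ?_, ?_⟩
  · intro i
    change θ _ = _
    rw [hθ]
    simp only [R.root_coroot, hl]
    funext a
    fin_cases i <;> fin_cases a <;> simp [cartanMatrix, corootDiag] <;> grind
  · intro x
    change _ = θ x 3 - θ x 4 ∧ _ = θ x 2 - θ x 3 ∧ _ = θ x 1 + θ x 3 + θ x 4 + ∑ a, θ x a ∧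
      _ = θ x 0 - θ x 1 ∧ _ = θ x 0 + θ x 1 + θ x 5 + ∑ a, θ x a
    rw [hθ, Fin.sum_univ_six]
    simp only [Matrix.cons_val]
    refine ⟨?_, ?_, ?_, ?_, ?_⟩ <;> first | ring1 | grind

end CartanRealization

/-! ### Chevalley generators and center of the model -/

section ModelData

variable {k : Type*} [Field k] [CharP k 3]

lemma act_diagonal_basisVec (v : Fin 6 → k) (a b c : Fin 6) :
    act (Matrix.diagonal v) (basisVec k a b c) =
      (v a + v b + v c + ∑ i, v i) • basisVec k a b c := by
  have h : ∀ a, (Matrix.diagonal v).mulVec (Pi.single a 1) = v a • Pi.single a 1 := by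
    intro a
    ext i
    rw [Matrix.mulVec_diagonal, Pi.smul_apply, smul_eq_mul, Pi.single_apply]
    split_ifs with h
    · rw [h]
    · simp
  rw [basisVec, act_wedge, h, h, h, Matrix.trace_diagonal]
  ext x y z
  simp only [Submodule.coe_add, Submodule.coe_smul, Pi.add_apply, Pi.smul_apply, smul_eq_mul,
    wedge_apply]
  ring

omit [CharP k 3] in
lemma model_br_diagonal_single (v : Fin 6 → k) (i j : Fin 6) :
    (model k).br (Matrix.diagonal v, 0) (Matrix.single i j 1, 0) =
      (v i - v j) • (Matrix.single i j 1, 0) := by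
  rw [model_br_even]
  refine Prod.ext ?_ (smul_zero _).symm
  ext a b
  simp only [Matrix.sub_apply, Matrix.diagonal_mul, Matrix.mul_diagonal, Matrix.single_apply,
    Prod.smul_fst, Matrix.smul_apply, smul_eq_mul]
  split_ifs with h
  · rw [h.1, h.2]; ring
  · ring

lemma model_br_diagonal_basisVec (v : Fin 6 → k) (a b c : Fin 6) :
    (model k).br (Matrix.diagonal v, 0) (0, basisVec k a b c) =
      (v a + v b + v c + ∑ i, v i) • (0, basisVec k a b c) := by
  rw [model_br_even_odd, act_diagonal_basisVec]
  exact Prod.ext (smul_zero _).symm rfl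

/-- The model is the contragredient Lie superalgebra of the matrix. -/
theorem nonempty_chevalleyData {H : Type*} [AddCommGroup H] [Module k H]
    (R : Realization (cartanMatrix k) H) : Nonempty (ChevalleyData R {2, 4} (model k)) := by
  have h3 := three_eq_zero (k := k)
  obtain ⟨θ, hθ, hroot⟩ := exists_realization_equiv R
  have neg : ∀ u : Trivec k, ((0, -u) : Matrix (Fin 6) (Fin 6) k × Trivec k) = -(0, u) :=
    fun u => Prod.ext neg_zero.symm rfl
  exact ⟨{
    lie := model_isLieSuperalgebra
    h := LinearMap.inl k _ _ ∘ₗ Matrix.diagonalLinearMap (Fin 6) k k ∘ₗ θ.toLinearMap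
    e := chevalleyE k
    f := chevalleyF k
    h_even := fun x => (prodSpace_zero k).2 rfl
    e_parity := fun i => by
      fin_cases i
      · exact (prodSpace_zero k).2 rfl
      · exact (prodSpace_zero k).2 rfl
      · exact (prodSpace_one k).2 rfl
      · exact (prodSpace_zero k).2 rfl
      · exact (prodSpace_one k).2 rfl
    f_parity := fun i => by
      fin_cases i
      · exact (prodSpace_zero k).2 rfl
      · exact (prodSpace_zero k).2 rfl
      · exact (prodSpace_one k).2 rfl
      · exact (prodSpace_zero k).2 rfl
      · exact (prodSpace_one k).2 rfl
    e_f := fun i j => by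
      rw [chevalley_br, ← hθ]
      rfl
    h_h := fun x y => by
      change (model k).br (Matrix.diagonal (θ x), 0) (Matrix.diagonal (θ y), 0) = 0
      rw [model_br_even, Matrix.diagonal_mul_diagonal, Matrix.diagonal_mul_diagonal]
      simp only [mul_comm, sub_self]
      rfl
    h_e := fun x i => by
      change (model k).br (Matrix.diagonal (θ x), 0) _ = _
      obtain ⟨r0, r1, r2, r3, r4⟩ := hroot x
      fin_cases i
      · exact (model_br_diagonal_single _ _ _).trans (congrArg (· • _) r0.symm)
      · exact (model_br_diagonal_single _ _ _).trans (congrArg (· • _) r1.symm)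
      · exact (model_br_diagonal_basisVec _ _ _ _).trans (congrArg (· • _) r2.symm)
      · exact (model_br_diagonal_single _ _ _).trans (congrArg (· • _) r3.symm)
      · exact (model_br_diagonal_basisVec _ _ _ _).trans (congrArg (· • _) r4.symm)
    h_f := fun x i => by
      change (model k).br (Matrix.diagonal (θ x), 0) _ = _
      obtain ⟨r0, r1, r2, r3, r4⟩ := hroot x
      rw [Fin.sum_univ_six] at r2 r4
      rw [← neg_smul]
      fin_cases i
      · refine (model_br_diagonal_single _ _ _).trans (congrArg (· • _) ?_)
        change _ = -R.root 0 x
        linear_combination r0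
      · refine (model_br_diagonal_single _ _ _).trans (congrArg (· • _) ?_)
        change _ = -R.root 1 x
        linear_combination r1
      · change (model k).br _ (0, -basisVec k 0 2 5) = _ • (0, -basisVec k 0 2 5)
        rw [neg, map_neg, model_br_diagonal_basisVec, smul_neg, Fin.sum_univ_six]
        refine congrArg (fun c : k => -(c • _)) ?_
        change _ = -R.root 2 x
        linear_combination r2 + (θ x 0 + θ x 1 + θ x 2 + θ x 3 + θ x 4 + θ x 5) * h3
      · refine (model_br_diagonal_single _ _ _).trans (congrArg (· • _) ?_)
        change _ = -R.root 3 x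
        linear_combination r3
      · change (model k).br _ (0, -basisVec k 2 3 4) = _ • (0, -basisVec k 2 3 4)
        rw [neg, map_neg, model_br_diagonal_basisVec, smul_neg, Fin.sum_univ_six]
        refine congrArg (fun c : k => -(c • _)) ?_
        change _ = -R.root 4 x
        linear_combination r4 + (θ x 0 + θ x 1 + θ x 2 + θ x 3 + θ x 4 + θ x 5) * h3
    deg := modelDeg k
    degProj := modelProj k
    degProj_of_mem := modelProj_of_mem
    br_deg := model_br_mem_modelDeg
    h_deg := fun x => diagonal_mem_modelDeg _
    e_deg := fun i => by
      fin_cases i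
      · exact single_mem_modelDeg rfl
      · exact single_mem_modelDeg rfl
      · exact basisVec_mem_modelDeg rfl
      · exact single_mem_modelDeg rfl
      · exact basisVec_mem_modelDeg rfl
    f_deg := fun i => by
      fin_cases i
      · exact single_mem_modelDeg rfl
      · exact single_mem_modelDeg rfl
      · change (0, -basisVec k 0 2 5) ∈ _
        rw [neg]
        exact neg_mem (basisVec_mem_modelDeg rfl)
      · exact single_mem_modelDeg rfl
      · change (0, -basisVec k 2 3 4) ∈ _
        rw [neg]
        exact neg_mem (basisVec_mem_modelDeg rfl)
    h_injective := fun x y h =>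
      θ.injective (Matrix.diagonal_injective (congrArg Prod.fst h))
    generate := fun N hN hh he hf => model_generate hN (fun v => by
      obtain ⟨x, rfl⟩ := θ.surjective v
      exact hh x) he hf
    ideal := fun J hJ h => model_ideal_eq_bot hJ h }⟩

/-- The center of the model consists of the scalar matrices. -/
lemma mem_center_model {x : Matrix (Fin 6) (Fin 6) k × Trivec k} :
    x ∈ (model k).center ↔ ∃ c : k, x = (c • 1, 0) := by
  constructor
  · intro hx
    obtain ⟨c, hc⟩ := eq_smul_one_of_act_eq_zero (Y := x.1) fun u => by
      have h := congrArg Prod.snd (hx (0, u)).1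
      rwa [model_br, map_zero, LinearMap.zero_apply, sub_zero] at h
    refine ⟨c, Prod.ext hc (trivec_ext fun a b c hab hbc => ?_)⟩
    have h := congrArg Prod.snd (hx (Matrix.single a a 1, 0)).2
    rw [model_br] at h
    simp only [map_zero, sub_zero] at h
    have h1 := congrFun (congrFun (congrFun (congrArg Subtype.val h) a) b) c
    rw [act_single_apply', if_pos rfl, if_neg hab.ne', if_neg (hab.trans hbc).ne',
      add_zero, add_zero] at h1
    exact eq_zero_of_eq_neg (eq_neg_of_add_eq_zero_left h1)
  · rintro ⟨c, rfl⟩ y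
    simp [model_br, act_one]

theorem ker_toMagic : LinearMap.ker (toMagic k) = (model k).center := by
  ext x
  rw [LinearMap.mem_ker, toMagic_eq_zero, mem_center_model]

/-- `g(S₂, S₄,₂)` is the contragredient Lie superalgebra modulo its center. -/
theorem nonempty_iso_centerless {H : Type*} [AddCommGroup H] [Module k H]
    (R : Realization (cartanMatrix k) H) :
    Nonempty ((magicAlg (S2 k) (S42 k)).Iso (R.centerless {2, 4})) := by
  obtain ⟨d⟩ := nonempty_chevalleyData R
  have hs := toMagic_surjective (k := k)
  have hbr := fun x y => toMagic_br (k := k) x y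
  have hgr := fun i => map_toMagic_gr (k := k) i
  have hker := ker_toMagic (k := k)
  generalize toMagic k = F at hs hbr hgr hker
  generalize magicAlg (S2 k) (S42 k) = B at hbr hgr ⊢
  exact d.nonempty_iso_centerless F hs hbr hgr hker

end ModelData

/-! ### The derived superalgebra -/

namespace SuperAlg

variable {k L : Type*} [Field k] [AddCommGroup L] [Module k L]

lemma IsLieSuperalgebra.isGradedIdeal_derived {A : SuperAlg k L} (hA : A.IsLieSuperalgebra) :
    A.IsGradedIdeal A.derived := by
  refine ⟨fun x y _ => ⟨Submodule.subset_span ⟨x, y, rfl⟩, Submodule.subset_span ⟨y, x, rfl⟩⟩,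
    Submodule.span_le.2 ?_⟩
  rintro _ ⟨x, y, rfl⟩
  have h : ∀ x, ∃ a ∈ A.gr 0, ∃ b ∈ A.gr 1, a + b = x := fun x => Submodule.mem_sup.1
    (hA.isCompl.sup_eq_top ▸ Submodule.mem_top)
  have hb : ∀ {i j x y}, x ∈ A.gr i → y ∈ A.gr j → A.br x y ∈ ⨆ i, A.derived ⊓ A.gr i :=
    fun {i j x y} hx hy => Submodule.mem_iSup_of_mem (i + j)
      ⟨Submodule.subset_span ⟨x, y, rfl⟩, hA.br_mem i j x hx y hy⟩
  obtain ⟨a, ha, b, hb', rfl⟩ := h x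
  obtain ⟨c, hc, d, hd, rfl⟩ := h y
  rw [map_add, map_add, LinearMap.add_apply, LinearMap.add_apply]
  exact add_mem (add_mem (hb ha hc) (hb hb' hc)) (add_mem (hb ha hd) (hb hb' hd))

end SuperAlg

/-! ### Central quotients of the model -/

section ModelQuotient

variable {k : Type*} [Field k] [CharP k 3] {M : Type*} [AddCommGroup M] [Module k M]

/-- A surjective homomorphism of superalgebras from the model, whose kernel is the center. -/
structure IsModelQuotient (F : Matrix (Fin 6) (Fin 6) k × Trivec k →ₗ[k] M) (B : SuperAlg k M) :
    Prop where
  surjective : Function.Surjective F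
  map_br : ∀ x y, F ((model k).br x y) = B.br (F x) (F y)
  map_gr : ∀ i, ((model k).gr i).map F = B.gr i
  map_eq_zero : ∀ x, F x = 0 ↔ ∃ c : k, x = (c • 1, 0)

lemma trace_smul_one (c : k) : (c • 1 : Matrix (Fin 6) (Fin 6) k).trace = 0 := by
  rw [Matrix.trace_smul, Matrix.trace_one, Fintype.card_fin, smul_eq_mul]
  push_cast
  linear_combination 2 * c * three_eq_zero (k := k)

namespace IsModelQuotient

variable {F : Matrix (Fin 6) (Fin 6) k × Trivec k →ₗ[k] M} {B : SuperAlg k M}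
  (hF : IsModelQuotient F B)

include hF

omit [CharP k 3] in
lemma exists_mem_gr {i : ZMod 2} {x : M} (hx : x ∈ B.gr i) : ∃ y ∈ (model k).gr i, F y = x := by
  rw [← hF.map_gr] at hx
  exact hx

omit [CharP k 3] in
lemma mem_gr {i : ZMod 2} {y : Matrix (Fin 6) (Fin 6) k × Trivec k} (hy : y ∈ (model k).gr i) :
    F y ∈ B.gr i := by
  rw [← hF.map_gr]
  exact Submodule.mem_map_of_mem hy

theorem isLieSuperalgebra : B.IsLieSuperalgebra where
  isCompl := by
    refine IsCompl.of_eq (eq_bot_iff.2 fun x hx => ?_) (eq_top_iff.2 fun x _ => ?_)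
    · obtain ⟨y, hy, rfl⟩ := hF.exists_mem_gr hx.1
      obtain ⟨z, hz, hyz⟩ := hF.exists_mem_gr hx.2
      obtain ⟨c, hc⟩ := (hF.map_eq_zero (z - y)).1 (by rw [map_sub, hyz, sub_self])
      have h2 : z.2 = 0 := by
        have := congrArg Prod.snd hc
        rwa [Prod.snd_sub, (prodSpace_zero k).1 hy, sub_zero] at this
      rw [← hyz, show z = 0 from Prod.ext ((prodSpace_one k).1 hz) h2]
      exact map_zero F
    · obtain ⟨y, rfl⟩ := hF.surjective x
      obtain ⟨a, ha, b, hb, rfl⟩ := Submodule.mem_sup.1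
        ((model_isLieSuperalgebra (k := k)).isCompl.sup_eq_top ▸ Submodule.mem_top (x := y))
      rw [map_add]
      exact Submodule.add_mem_sup (hF.mem_gr ha) (hF.mem_gr hb)
  br_mem i j x hx y hy := by
    obtain ⟨x, hx', rfl⟩ := hF.exists_mem_gr hx
    obtain ⟨y, hy', rfl⟩ := hF.exists_mem_gr hy
    rw [← hF.map_br]
    exact hF.mem_gr (model_isLieSuperalgebra.br_mem i j x hx' y hy')
  skew i j x hx y hy := by
    obtain ⟨x, hx', rfl⟩ := hF.exists_mem_gr hx
    obtain ⟨y, hy', rfl⟩ := hF.exists_mem_gr hy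
    rw [← hF.map_br, ← hF.map_br, model_isLieSuperalgebra.skew i j x hx' y hy', map_neg,
      map_smul]
  jacobi i j l x hx y hy z hz := by
    obtain ⟨x, hx', rfl⟩ := hF.exists_mem_gr hx
    obtain ⟨y, hy', rfl⟩ := hF.exists_mem_gr hy
    obtain ⟨z, hz', rfl⟩ := hF.exists_mem_gr hz
    simp only [← hF.map_br]
    rw [model_isLieSuperalgebra.jacobi i j l x hx' y hy' z hz', map_sub, map_smul]
  odd_cube x hx := by
    obtain ⟨x, hx', rfl⟩ := hF.exists_mem_gr hx
    rw [← hF.map_br, ← hF.map_br, model_isLieSuperalgebra.odd_cube x hx', map_zero]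

lemma map_mem_derived {x : Matrix (Fin 6) (Fin 6) k × Trivec k} :
    F x ∈ B.derived ↔ x.1.trace = 0 := by
  have h : B.derived = (model k).derived.map F := by
    rw [SuperAlg.derived, SuperAlg.derived, Submodule.map_span]
    congr 1
    ext z
    constructor
    · rintro ⟨x, y, rfl⟩
      obtain ⟨x, rfl⟩ := hF.surjective x
      obtain ⟨y, rfl⟩ := hF.surjective y
      exact ⟨_, ⟨x, y, rfl⟩, hF.map_br x y⟩
    · rintro ⟨_, ⟨x, y, rfl⟩, rfl⟩
      exact ⟨F x, F y, (hF.map_br x y).symm⟩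
  rw [h, ← mem_derived_model]
  refine ⟨?_, Submodule.mem_map_of_mem⟩
  rintro ⟨y, hy, hxy⟩
  obtain ⟨c, hc⟩ := (hF.map_eq_zero (x - y)).1 (by rw [map_sub, hxy, sub_self])
  rw [mem_derived_model, ← sub_add_cancel x y, hc, Prod.fst_add, Matrix.trace_add,
    trace_smul_one, zero_add]
  exact mem_derived_model.1 hy

/-- The derived superalgebra has codimension `1`, since it is the kernel of the trace. -/
theorem finrank_quotient_derived : Module.finrank k (M ⧸ B.derived) = 1 := by
  refine finrank_eq_one_iff'.2 ⟨B.derived.mkQ (F (Matrix.single 0 0 1, 0)), ?_, fun w => ?_⟩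
  · intro h
    rw [Submodule.mkQ_apply, Submodule.Quotient.mk_eq_zero, hF.map_mem_derived] at h
    simp at h
  · obtain ⟨y, rfl⟩ := B.derived.mkQ_surjective w
    obtain ⟨x, rfl⟩ := hF.surjective y
    refine ⟨x.1.trace, ?_⟩
    rw [← map_smul, ← map_smul, ← sub_eq_zero, ← map_sub, ← map_sub, Submodule.mkQ_apply,
      Submodule.Quotient.mk_eq_zero, hF.map_mem_derived]
    simp

lemma derived_ne_top : B.derived ≠ ⊤ := by
  intro h
  have := hF.map_mem_derived (x := (Matrix.single 0 0 1, 0)).1 (h ▸ Submodule.mem_top)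
  simp at this

omit [CharP k 3] in
lemma br_ne_zero : F ((model k).br (Matrix.single 0 1 1, 0) (Matrix.single 1 0 1, 0)) ≠ 0 := by
  rw [Ne, hF.map_eq_zero]
  rintro ⟨c, hc⟩
  have h := congrArg Prod.fst hc
  rw [model_br_even] at h
  have h0 := congrFun (congrFun h 0) 0
  have h2 := congrFun (congrFun h 2) 2
  simp at h0 h2
  rw [← h2] at h0
  exact one_ne_zero h0

theorem not_isSimple : ¬ B.IsSimple := by
  intro h
  rcases h.2 _ hF.isLieSuperalgebra.isGradedIdeal_derived with h1 | h1
  · refine hF.br_ne_zero ((Submodule.mem_bot k).1 (h1 ▸ ?_))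
    exact hF.map_mem_derived.2 (trace_model_br _ _)
  · exact hF.derived_ne_top h1

/-- The derived superalgebra is simple: the preimage in the model of an ideal is a graded subspace
that is stable under `sl₆ ⊕ ⋀³`. -/
theorem isSimple_derivedAlg : B.derivedAlg.IsSimple := by
  constructor
  · refine ⟨⟨F (Matrix.single 0 1 1, 0), hF.map_mem_derived.2 (by simp)⟩,
      ⟨F (Matrix.single 1 0 1, 0), hF.map_mem_derived.2 (by simp)⟩, fun h => hF.br_ne_zero ?_⟩
    rw [hF.map_br]
    exact congrArg Subtype.val h
  · intro I hI
    let J := (I.map B.derived.subtype).comap F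
    have hJ : SuperAlg.IsHomogeneous (model k).gr J := by
      intro x hx
      obtain ⟨y, hy, hxy⟩ := hx
      have h1 := hI.2 hy
      rw [iSup_parity] at h1 ⊢
      obtain ⟨a, ha, b, hb, rfl⟩ := Submodule.mem_sup.1 h1
      obtain ⟨a', ha', haa⟩ := hF.exists_mem_gr (i := 0) (x := a.1) ha.2
      obtain ⟨b', hb', hbb⟩ := hF.exists_mem_gr (i := 1) (x := b.1) hb.2
      have ha2 : a' ∈ J := ⟨a, ha.1, haa.symm⟩
      have hb2 : b' ∈ J := ⟨b, hb.1, hbb.symm⟩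
      have h0 : F (x - a' - b') = 0 := by
        rw [map_sub, map_sub, haa, hbb, ← hxy]
        change a.1 + b.1 - a.1 - b.1 = 0
        abel
      obtain ⟨c, hc⟩ := (hF.map_eq_zero _).1 h0
      rw [show x = (x - a' - b') + a' + b' by abel]
      refine Submodule.add_mem_sup ⟨add_mem ?_ ha2, add_mem ?_ ha'⟩ ⟨hb2, hb'⟩
      · change F (x - a' - b') ∈ I.map B.derived.subtype
        rw [h0]
        exact zero_mem _
      · rw [hc]
        exact (prodSpace_zero k).2 rfl
    have hstable : ∀ d : Matrix (Fin 6) (Fin 6) k × Trivec k, d.1.trace = 0 →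
        ∀ x ∈ J, (model k).br d x ∈ J := by
      rintro d hd x ⟨y, hy, hxy⟩
      refine ⟨_, (hI.1 ⟨F d, hF.map_mem_derived.2 hd⟩ y hy).1, ?_⟩
      rw [hF.map_br, ← hxy]
      rfl
    rcases model_stable hJ hstable with h | h
    · left
      refine eq_bot_iff.2 fun y hy => ?_
      obtain ⟨x, hx⟩ := hF.surjective y.1
      have h1 := (hF.map_eq_zero x).2 (h x ⟨y, hy, hx.symm⟩)
      rw [hx] at h1
      exact (Submodule.mem_bot k).2 (Subtype.ext h1)
    · right
      refine eq_top_iff.2 fun y _ => ?_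
      obtain ⟨x, hx⟩ := hF.surjective y.1
      obtain ⟨z, hz, hzx⟩ := h x (hF.map_mem_derived.1 (hx ▸ y.2))
      rwa [show y = z from Subtype.ext (hx.symm.trans hzx.symm)]

end IsModelQuotient

end ModelQuotient

/-! ### The even and the odd part -/

section Parts

variable {k : Type*} [Field k]

/-- Two surjective linear maps with the same kernel have isomorphic targets. -/
lemma exists_equiv_of_ker_eq {V W Z : Type*} [AddCommGroup V] [Module k V] [AddCommGroup W]
    [Module k W] [AddCommGroup Z] [Module k Z] {p : V →ₗ[k] W} {q : V →ₗ[k] Z}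
    (hp : Function.Surjective p) (hq : Function.Surjective q)
    (h : LinearMap.ker p = LinearMap.ker q) : ∃ e : W ≃ₗ[k] Z, ∀ x, e (p x) = q x := by
  refine ⟨(p.quotKerEquivOfSurjective hp).symm ≪≫ₗ Submodule.quotEquivOfEq _ _ h ≪≫ₗ
    q.quotKerEquivOfSurjective hq, fun x => ?_⟩
  have : (p.quotKerEquivOfSurjective hp).symm (p x) = (LinearMap.ker p).mkQ x := by
    rw [LinearEquiv.symm_apply_eq]; rfl
  rw [LinearEquiv.trans_apply, LinearEquiv.trans_apply, this]
  rfl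

attribute [local instance] LieRing.ofAssociativeRing

/-- The projection from `gl_n` to `pgl_n`. -/
def toPGLHom (k : Type*) [Field k] (n : ℕ) : Matrix (Fin n) (Fin n) k →ₗ[k] PGL k n where
  toFun := toPGL
  map_add' _ _ := rfl
  map_smul' _ _ := rfl

lemma toPGLHom_surjective (n : ℕ) : Function.Surjective (toPGLHom k n) := fun x =>
  Quotient.inductionOn' x fun X => ⟨X, rfl⟩

lemma toPGL_lie {n : ℕ} (X Y : Matrix (Fin n) (Fin n) k) :
    ⁅(toPGL X : PGL k n), toPGL Y⁆ = toPGL (X * Y - Y * X) := rfl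

lemma toPGLHom_eq_zero {n : ℕ} {X : Matrix (Fin n) (Fin n) k} :
    toPGLHom k n X = 0 ↔ ∃ c : k, X = c • 1 := by
  have h : toPGLHom k n X = 0 ↔ X ∈ scalars k n :=
    Submodule.Quotient.mk_eq_zero (scalars k n).toSubmodule
  rw [h]
  refine Submodule.mem_span_singleton.trans ?_
  simp only [eq_comm]

/-- The exterior product of three vectors, as an alternating map. -/
def wedgeMap (k : Type*) [Field k] : (Fin 6 → k) [⋀^Fin 3]→ₗ[k] Trivec k where
  toFun v := wedge (v 0) (v 1) (v 2)
  map_update_add' := by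
    intro inst v i x y
    obtain rfl : inst = instDecidableEqFin 3 := Subsingleton.elim _ _
    ext a b c
    fin_cases i <;> simp [wedge_apply, Function.update] <;> ring
  map_update_smul' := by
    intro inst v i r x
    obtain rfl : inst = instDecidableEqFin 3 := Subsingleton.elim _ _
    ext a b c
    fin_cases i <;> simp [wedge_apply, Function.update] <;> ring
  map_eq_zero_of_eq' v i j h hij := by
    ext a b c
    change (wedge (v 0) (v 1) (v 2)).1 a b c = 0
    rw [wedge_apply]
    fin_cases i <;> fin_cases j <;> simp at hij h <;> rw [h] <;> ring

variable [CharP k 3]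

lemma finrank_trivec : Module.finrank k (Trivec k) = 20 := by
  let T := {t : Fin 6 × Fin 6 × Fin 6 // t.1 < t.2.1 ∧ t.2.1 < t.2.2}
  let f : Trivec k →ₗ[k] (T → k) :=
    { toFun := fun u t => u.1 t.1.1 t.1.2.1 t.1.2.2
      map_add' := fun _ _ => rfl
      map_smul' := fun _ _ => rfl }
  have hf : Function.Bijective f := by
    constructor
    · intro u v h
      exact trivec_ext fun a b c hab hbc => congrFun h ⟨(a, b, c), hab, hbc⟩
    · intro g
      obtain ⟨u, hu⟩ := exists_trivec fun a b c =>
        if h : a < b ∧ b < c then g ⟨(a, b, c), h⟩ else 0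
      refine ⟨u, funext fun t => ?_⟩
      change u.1 _ _ _ = _
      rw [hu _ _ _ t.2.1 t.2.2, dif_pos t.2]
  rw [(LinearEquiv.ofBijective f hf).finrank_eq, Module.finrank_fintype_fun_eq_card]
  decide +kernel

/-- Trivectors are the elements of the third exterior power. -/
lemma exists_exteriorPower_equiv : ∃ e : ⋀[k]^3 (Fin 6 → k) ≃ₗ[k] Trivec k,
    ∀ v, e (exteriorPower.ιMulti k 3 v) = wedge (v 0) (v 1) (v 2) := by
  let f := exteriorPower.alternatingMapLinearEquiv (wedgeMap k)
  have hf : ∀ v, f (exteriorPower.ιMulti k 3 v) = wedge (v 0) (v 1) (v 2) := fun v =>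
    exteriorPower.alternatingMapLinearEquiv_apply_ιMulti _ _
  have hs : Function.Surjective f := by
    rw [← LinearMap.range_eq_top]
    exact eq_top_of_basisVec_mem fun a b c _ _ _ =>
      ⟨_, hf ![Pi.single a 1, Pi.single b 1, Pi.single c 1]⟩
  have hd : Module.finrank k (⋀[k]^3 (Fin 6 → k)) = Module.finrank k (Trivec k) := by
    rw [finrank_trivec, exteriorPower.finrank_eq, Module.finrank_fintype_fun_eq_card]
    rfl
  have hi : Function.Injective f :=
    (LinearMap.injective_iff_surjective_of_finrank_eq_finrank hd).2 hs
  exact ⟨LinearEquiv.ofBijective f ⟨hi, hs⟩, hf⟩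

namespace IsModelQuotient

variable {M : Type*} [AddCommGroup M] [Module k M]
  {F : Matrix (Fin 6) (Fin 6) k × Trivec k →ₗ[k] M} {B : SuperAlg k M}
  (hF : IsModelQuotient F B)

include hF

omit [CharP k 3] in
theorem exists_even_equiv : ∃ φ : PGL k 6 ≃ₗ[k] B.gr 0, ∀ X, (φ (toPGL X) : M) = F (X, 0) := by
  let G : Matrix (Fin 6) (Fin 6) k →ₗ[k] B.gr 0 :=
    (F ∘ₗ LinearMap.inl k _ _).codRestrict _ fun X => hF.mem_gr ((prodSpace_zero k).2 rfl)
  obtain ⟨φ, hφ⟩ := exists_equiv_of_ker_eq (q := G) (toPGLHom_surjective 6) (fun x => by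
    obtain ⟨y, hy, hyx⟩ := hF.exists_mem_gr x.2
    refine ⟨y.1, Subtype.ext (Eq.trans ?_ hyx)⟩
    exact congrArg F (Prod.ext rfl ((prodSpace_zero k).1 hy).symm)) (by
    ext X
    rw [LinearMap.mem_ker, LinearMap.mem_ker, toPGLHom_eq_zero, ← Subtype.val_inj]
    change _ ↔ F (X, 0) = 0
    rw [hF.map_eq_zero]
    simp only [Prod.mk.injEq, and_true])
  exact ⟨φ, fun X => congrArg Subtype.val (hφ X)⟩

theorem exists_odd_equiv : ∃ ψ : ⋀[k]^3 (Fin 6 → k) ≃ₗ[k] B.gr 1,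
    ∀ v, (ψ (exteriorPower.ιMulti k 3 v) : M) = F (0, wedge (v 0) (v 1) (v 2)) := by
  let G : Trivec k →ₗ[k] B.gr 1 :=
    (F ∘ₗ LinearMap.inr k _ _).codRestrict _ fun X => hF.mem_gr ((prodSpace_one k).2 rfl)
  have hG : Function.Bijective G := by
    constructor
    · refine (injective_iff_map_eq_zero G).2 fun u hu => ?_
      obtain ⟨c, hc⟩ := (hF.map_eq_zero (0, u)).1 (congrArg Subtype.val hu)
      exact congrArg Prod.snd hc
    · intro x
      obtain ⟨y, hy, hyx⟩ := hF.exists_mem_gr x.2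
      refine ⟨y.2, Subtype.ext (Eq.trans ?_ hyx)⟩
      exact congrArg F (Prod.ext ((prodSpace_one k).1 hy).symm rfl)
  obtain ⟨e, he⟩ := exists_exteriorPower_equiv (k := k)
  exact ⟨e ≪≫ₗ LinearEquiv.ofBijective G hG, fun v => congrArg (fun u => F (0, u)) (he v)⟩

lemma finrank_odd : Module.finrank k (B.gr 1) = 20 := by
  obtain ⟨ψ, -⟩ := hF.exists_odd_equiv
  rw [← ψ.finrank_eq, exteriorPower.finrank_eq, Module.finrank_fintype_fun_eq_card]
  rfl

/-- The even part is `pgl₆`, and the odd part is the third exterior power of the natural module,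
twisted by the trace. -/
theorem exists_parts_equiv : ∃ (φ : PGL k 6 ≃ₗ[k] B.gr 0)
    (ψ : ⋀[k]^3 (Fin 6 → k) ≃ₗ[k] B.gr 1),
    (∀ X Y : PGL k 6, (φ ⁅X, Y⁆ : M) = B.br (φ X) (φ Y)) ∧
    ∀ (X : Matrix (Fin 6) (Fin 6) k) (v : Fin 3 → Fin 6 → k),
      B.br (φ (toPGL X)) (ψ (exteriorPower.ιMulti k 3 v)) =
        ψ (∑ i, exteriorPower.ιMulti k 3 (Function.update v i (X.mulVec (v i)))
          + X.trace • exteriorPower.ιMulti k 3 v) := by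
  obtain ⟨φ, hφ⟩ := hF.exists_even_equiv
  obtain ⟨ψ, hψ⟩ := hF.exists_odd_equiv
  refine ⟨φ, ψ, fun X Y => ?_, fun X v => ?_⟩
  · obtain ⟨X, rfl⟩ := toPGLHom_surjective 6 X
    obtain ⟨Y, rfl⟩ := toPGLHom_surjective 6 Y
    change (φ ⁅(toPGL X : PGL k 6), toPGL Y⁆ : M) = B.br (φ (toPGL X)) (φ (toPGL Y))
    rw [toPGL_lie, hφ, hφ, hφ, ← hF.map_br, model_br_even]
  · rw [hφ, hψ, ← hF.map_br, model_br_even_odd, act_wedge]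
    simp only [map_add, map_smul, Submodule.coe_add,
      Submodule.coe_smul, hψ, Fin.sum_univ_three]
    simp only [← map_add, ← map_smul]
    refine congrArg F (Prod.ext ?_ ?_)
    · simp
    · simp [Function.update]

end IsModelQuotient

end Parts

lemma isModelQuotient_toMagic (k : Type*) [Field k] [CharP k 3] :
    IsModelQuotient (toMagic k) (magicAlg (S2 k) (S42 k)) where
  surjective := toMagic_surjective
  map_br := toMagic_br
  map_gr := map_toMagic_gr
  map_eq_zero _ := toMagic_eq_zero

end SuperSquare

end

open SuperSquare in
theorem mainTheorem7 (k : Type*) [Field k] [CharP k 3] :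
    (magicAlg (S2 k) (S42 k)).IsLieSuperalgebra ∧
    (∀ (H : Type*) [AddCommGroup H] [Module k H] (R : Realization (cartanMatrix k) H),
      Nonempty ((magicAlg (S2 k) (S42 k)).Iso (R.centerless {2, 4}))) ∧
    ¬ (magicAlg (S2 k) (S42 k)).IsSimple ∧
    (magicAlg (S2 k) (S42 k)).IsGradedIdeal (magicAlg (S2 k) (S42 k)).derived ∧
    (magicAlg (S2 k) (S42 k)).derivedAlg.IsSimple ∧
    Module.finrank k (Magic (S2 k) (S42 k) ⧸ (magicAlg (S2 k) (S42 k)).derived) = 1 ∧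
    Module.finrank k ((magicAlg (S2 k) (S42 k)).gr 1) = 20 ∧
    ∃ (φ : PGL k 6 ≃ₗ[k] (magicAlg (S2 k) (S42 k)).gr 0)
      (ψ : ⋀[k]^3 (Fin 6 → k) ≃ₗ[k] (magicAlg (S2 k) (S42 k)).gr 1),
      (∀ X Y : PGL k 6, (φ ⁅X, Y⁆ : Magic (S2 k) (S42 k)) =
        (magicAlg (S2 k) (S42 k)).br (φ X) (φ Y)) ∧
      ∀ (X : Matrix (Fin 6) (Fin 6) k) (v : Fin 3 → Fin 6 → k),
        (magicAlg (S2 k) (S42 k)).br (φ (toPGL X)) (ψ (exteriorPower.ιMulti k 3 v)) =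
          ψ (∑ i, exteriorPower.ιMulti k 3 (Function.update v i (X.mulVec (v i)))
            + X.trace • exteriorPower.ιMulti k 3 v) := by
  have hF := isModelQuotient_toMagic k
  exact ⟨hF.isLieSuperalgebra, fun H _ _ R => nonempty_iso_centerless R, hF.not_isSimple,
    hF.isLieSuperalgebra.isGradedIdeal_derived, hF.isSimple_derivedAlg,
    hF.finrank_quotient_derived, hF.finrank_odd, hF.exists_parts_equiv⟩
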